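/- Let $\sigma>0$, $r>0$ and $\alpha\in(0,2)$. For $h>0$ let $\tilde Z_h$ be the value at time $h$ of the real Lévy process $\tilde Z_t=\sigma B_t+S_t$, $\tilde Z_0=0$, where $B$ is a standard Brownian motion and $S$ is an independent symmetric $\alpha$-stable Lévy process with Lévy measure $\tilde\nu(dz)=\alpha r|z|^{-1-\alpha}\,dz$; that is, $\tilde Z$ has characteristic triplet $(0,\sigma^2,\tilde\nu)$ (with respect to any odd bounded truncation function). Regard $\sigma$ as fixed and $(r,\alpha)$ as the parameter. Then for every $h>0$ the law of $\tilde Z_h$ has a continuous Lebesgue density $p_h(x)=p_h(x;r,\alpha)$ whose partial derivatives $\partial_r p_h(x)$ and $\partial_\alpha p_h(x)$ exist for all $x$, the entries $$\mathcal I_h^{a,b}=\int_{\mathbb R}\frac{\partial_a p_h(x)\,\partial_b p_h(x)}{p_h(x)}\,dx,\qquad a,b\in\{r,\alpha\},$$ of the Fisher information matrix of $\tilde Z_h$ are absolutely convergent integrals, and, as $h\downarrow0$, $$\frac{(h\log(1/h))^{\alpha/2}}{h}\begin{pmatrix}1&0\\0&\frac1{\log(1/h)}\end{pmatrix}\begin{pmatrix}\mathcal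 I_h^{r,r}&\mathcal I_h^{r,\alpha}\\\mathcal I_h^{r,\alpha}&\mathcal I_h^{\alpha,\alpha}\end{pmatrix}\begin{pmatrix}1&0\\0&\frac1{\log(1/h)}\end{pmatrix}\longrightarrow\frac{2r}{\sigma^\alpha(2-\alpha)^{\alpha/2}}\begin{pmatrix}\frac1{r^2}&\frac1{2r}\\\frac1{2r}&\frac14\end{pmatrix}.$$ In particular, the limiting matrix is singular. -/

import Mathlib

open Filter Topology MeasureTheory

noncomputable section

/-- An odd (measurable) truncation function with `|τ| ≤ 2` and `τ z = z` on `(-1, 1)`. -/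
structure IsTruncation (τ : ℝ → ℝ) : Prop where
  measurable : Measurable τ
  odd : ∀ z, τ (-z) = -τ z
  bound : ∀ z, |τ z| ≤ 2
  eq_self : ∀ z, |z| < 1 → τ z = z

/-- The Lévy measure of an `α`-stable process, with Lebesgue density
`α / |z|^(1+α) * (rp 1_{z>0} + rm 1_{z<0})`. -/
def stableLevyMeasure (α rp rm : ℝ) : Measure ℝ :=
  volume.withDensity fun z =>
    ENNReal.ofReal (α / |z| ^ (1 + α) * (if 0 < z then rp else if z < 0 then rm else 0))

/-- The Lévy–Khintchine exponent of the triplet `(b, c, ν)`, where `c` is the squared volatility,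
relative to the truncation function `τ`. -/
def levyExponent (τ : ℝ → ℝ) (b c : ℝ) (ν : Measure ℝ) (u : ℝ) : ℂ :=
  Complex.I * u * b - c * u ^ 2 / 2 +
    ∫ z, (Complex.exp (Complex.I * u * z) - 1 - Complex.I * u * τ z) ∂ν

/-- `μ` is the law at time `h` of a Lévy process, started at `0`, with triplet `(b, c, ν)`. -/
def IsLevyMarginal (τ : ℝ → ℝ) (b c : ℝ) (ν : Measure ℝ) (h : ℝ) (μ : Measure ℝ) : Prop :=
  IsProbabilityMeasure μ ∧ ∀ u : ℝ, charFun μ u = Complex.exp (h * levyExponent τ b c ν u)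

open Classical in
/-- The law at time `h` of a Lévy process with triplet `(b, c, ν)`. It is unique by
`levyMarginal_eq`. (The value is the zero measure if there is no such law.) -/
def levyMarginal (τ : ℝ → ℝ) (b c : ℝ) (ν : Measure ℝ) (h : ℝ) : Measure ℝ :=
  if H : ∃ μ, IsLevyMarginal τ b c ν h μ then H.choose else 0

theorem levyMarginal_eq {τ : ℝ → ℝ} {b c : ℝ} {ν : Measure ℝ} {h : ℝ} {μ : Measure ℝ}
    (hμ : IsLevyMarginal τ b c ν h μ) : levyMarginal τ b c ν h = μ := by
  have H : ∃ μ, IsLevyMarginal τ b c ν h μ := ⟨μ, hμ⟩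
  rw [levyMarginal, dif_pos H]
  have h1 := H.choose_spec
  have := h1.1
  have := hμ.1
  exact Measure.ext_of_charFun (funext fun u => by rw [h1.2 u, hμ.2 u])

/-- `f` is a continuous Lebesgue density of the probability measure `μ`. -/
def IsContinuousDensity (μ : Measure ℝ) (f : ℝ → ℝ) : Prop :=
  IsProbabilityMeasure μ ∧ Continuous f ∧ (∀ x, 0 ≤ f x) ∧
    μ = volume.withDensity fun x => ENNReal.ofReal (f x)

/-- `J` is the Fisher information matrix at `θ` of the statistical model `P`:
near `θ` the model consists of probability measures with continuous densities `p η`, the partial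
derivatives `∂_i p` exist at `θ`, the products `∂_i p ∂_j p / p` are integrable, and their integrals
are the entries of `J`. Such a `J` is unique (`IsFisherInformation.unique`). -/
def IsFisherInformation {ι : Type*} [DecidableEq ι] (P : (ι → ℝ) → Measure ℝ) (θ : ι → ℝ)
    (J : Matrix ι ι ℝ) : Prop :=
  ∃ (p : (ι → ℝ) → ℝ → ℝ) (dp : ι → ℝ → ℝ),
    (∀ᶠ η in 𝓝 θ, IsContinuousDensity (P η) (p η)) ∧
    (∀ i x, HasDerivAt (fun t => p (Function.update θ i t) x) (dp i x) (θ i)) ∧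
    ∀ i j, Integrable (fun x => dp i x * dp j x / p θ x) ∧
      J i j = ∫ x, dp i x * dp j x / p θ x

theorem IsContinuousDensity.unique {μ : Measure ℝ} {f g : ℝ → ℝ}
    (hf : IsContinuousDensity μ f) (hg : IsContinuousDensity μ g) : f = g := by
  obtain ⟨hμ, hfc, hf0, hf1⟩ := hf
  obtain ⟨-, hgc, hg0, hg1⟩ := hg
  have hfin : ∫⁻ x, ENNReal.ofReal (f x) ≠ ⊤ := by
    rw [← setLIntegral_univ, ← withDensity_apply _ MeasurableSet.univ, ← hf1]
    exact measure_ne_top μ _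
  have hae := (withDensity_eq_iff hfc.measurable.ennreal_ofReal.aemeasurable
    hgc.measurable.ennreal_ofReal.aemeasurable hfin).1 (hf1.symm.trans hg1)
  have hae' : f =ᵐ[volume] g := by
    filter_upwards [hae] with x hx
    exact (ENNReal.ofReal_eq_ofReal_iff (hf0 x) (hg0 x)).1 hx
  exact (Continuous.ae_eq_iff_eq volume hfc hgc).1 hae'

theorem IsFisherInformation.unique {ι : Type*} [DecidableEq ι] {P : (ι → ℝ) → Measure ℝ}
    {θ : ι → ℝ} {J K : Matrix ι ι ℝ} (hJ : IsFisherInformation P θ J)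
    (hK : IsFisherInformation P θ K) : J = K := by
  obtain ⟨p, dp, hp, hdp, hJ⟩ := hJ
  obtain ⟨q, dq, hq, hdq, hK⟩ := hK
  have hpq : ∀ᶠ η in 𝓝 θ, p η = q η := by
    filter_upwards [hp, hq] with η h1 h2 using h1.unique h2
  have hd : ∀ i x, dp i x = dq i x := by
    intro i x
    have hc : Tendsto (fun t => Function.update θ i t) (𝓝 (θ i)) (𝓝 θ) := by
      have : Continuous (fun t => Function.update θ i t) := continuous_const.update i continuous_id
      simpa using this.tendsto (θ i)
    refine (hdp i x).unique ((hdq i x).congr_of_eventuallyEq ?_)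
    filter_upwards [hc.eventually hpq] with t ht
    rw [ht]
  ext i j
  rw [(hJ i j).2, (hK i j).2]
  simp only [hd, hpq.self_of_nhds]

/-- The model for the observation at time `h` of a Brownian motion with volatility `σ` plus an
independent symmetric `α`-stable process, with parameter `θ = (r, α)` and triplet
`(0, σ², α r / |z|^(1+α) dz)`. -/
def stablePlusBrownianModel (τ : ℝ → ℝ) (σ h : ℝ) (θ : Fin 2 → ℝ) : Measure ℝ :=
  levyMarginal τ 0 (σ ^ 2) (stableLevyMeasure (θ 1) (θ 0) (θ 0)) h

end

/-!
# Fisher information of a Brownian motion plus a symmetric stable process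

Let `s = σ √h`. Dividing the observation at time `h` by `s` gives the sum of a standard normal
variable and an independent symmetric stable one, with characteristic function
`exp (-u ^ 2 / 2 - c |u| ^ α)`, where `c = r κ(α) h s ^ (-α)` and `κ(α)` (`stableConst`) is the
constant relating the Lévy measure `α |z| ^ (-1 - α) dz` to its exponent (`levyExponent_stable`).
Its density `G` (`stableGaussDensity`) is an explicit Fourier integral; it is the convolution of the
normal density with a stable law, hence positive (`stableGaussDensity_spec`). The stable law itself
is a limit of sums of Pareto variables (`exists_charFun_stable`).

Write `A` for the derivative of `G` in `c`, and `c B` for its derivative in `α`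
(`hasFDerivAt_stableGaussDensity`). By the chain rule both partial derivatives of the density of the
model are rescaled combinations of `A` and `B`: `(c / r) A` for `r`, and `c (λ A + B)` for `α`, with
`λ = κ'(α) / κ(α) - log s`. So the Fisher information is a combination of `∫ A² / G`, `∫ A B / G`
and `∫ B² / G`. As `h → 0`, `c` tends to `0` like `h ^ (1 - α / 2)` and `λ / log (1 / h)` tends to
`1 / 2`. In the normalization of the theorem every `B` brings a factor `1 / log (1 / h)`, and
`c ∫ A B / G` and `c ∫ B² / G` stay bounded (`exists_fisherIntegral_le`), so the terms with `B` are
of order at most `log (1 / h) ^ (α / 2 - 1)` and vanish. Only `∫ A² / G` survives. It multiplies the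
rank-one matrix `v vᵀ` with `v = (1 / r, 1 / 2)`, which is why the limit is singular.

The behaviour of `∫ A² / G` is that of a threshold phenomenon
(`tendsto_rpow_mul_fisherIntegral`). Uniformly in `c ≤ 1`, `A(x) ~ (α / κ) |x| ^ (-1 - α)` for large
`|x|` (`exists_stableGaussDerivScale_tail`), and by the mean value theorem `G` is the normal density
plus `c` times a value of `A` at a smaller coefficient. Choose `R` with `exp (-R² / 2) = c`. For
`|x| < R` the normal density dominates, and this range contributes negligibly; for `|x| > R` the
Lévy tail dominates, so `G ~ c A` and `c A² / G ~ A`. Hence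
`c ∫ A² / G ~ 2 (α / κ) ∫_R^∞ x ^ (-1 - α) dx = (2 / κ) R ^ (-α)`, and `R² ~ (2 - α) log (1 / h)`.

The tails of `A` and `B` come from turning the contour of the Fourier integral to the ray
`arg u = π / 6`, on which `exp (I u x)` decays while `exp (-u² / 2 - c u ^ α)` stays bounded. In the
coordinate `u = exp z` the integrands are entire, and the rotation is a shift of a horizontal line
(`integral_horizontal_shift`).
-/

section

open Real Set

/-! ### The Lévy constant of a symmetric stable law -/

/-- The Laplace transform of `1 - cos`. -/
theorem integral_one_sub_cos_mul_exp {s : ℝ} (hs : 0 < s) :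
    IntegrableOn (fun z ↦ (1 - cos z) * exp (-(s * z))) (Ioi 0) ∧
    ∫ z in Ioi 0, (1 - cos z) * exp (-(s * z)) = 1 / (s * (1 + s ^ 2)) := by
  have hd : ∀ z ∈ Ici (0 : ℝ), HasDerivAt
      (fun z ↦ exp (-(s * z)) * (-1 / s + (s * cos z - sin z) / (1 + s ^ 2)))
      ((1 - cos z) * exp (-(s * z))) z := by
    intro z _
    have h1 : HasDerivAt (fun z ↦ exp (-(s * z))) (exp (-(s * z)) * (-(s * 1))) z :=
      (((hasDerivAt_id z).const_mul s).neg).exp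
    have h2 : HasDerivAt (fun z ↦ -1 / s + (s * cos z - sin z) / (1 + s ^ 2))
        ((s * (-sin z) - cos z) / (1 + s ^ 2)) z :=
      ((((hasDerivAt_cos z).const_mul s).sub (hasDerivAt_sin z)).div_const _).const_add _
    refine (h1.mul h2).congr_deriv ?_
    have : 1 + s ^ 2 ≠ 0 := by positivity
    field_simp
    ring
  have hpos : ∀ z ∈ Ioi (0 : ℝ), 0 ≤ (1 - cos z) * exp (-(s * z)) := fun z _ ↦
    mul_nonneg (by linarith [cos_le_one z]) (exp_pos _).le
  have hlim : Tendsto (fun z ↦ exp (-(s * z)) * (-1 / s + (s * cos z - sin z) / (1 + s ^ 2)))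
      atTop (𝓝 0) := by
    have h0 : Tendsto (fun z ↦ exp (-(s * z))) atTop (𝓝 0) :=
      tendsto_exp_neg_atTop_nhds_zero.comp (tendsto_id.const_mul_atTop hs)
    refine h0.zero_mul_isBoundedUnder_le ?_
    refine isBoundedUnder_of ⟨1 / s + (s + 1) / (1 + s ^ 2), fun z ↦ ?_⟩
    have hc := abs_cos_le_one z
    have hsn := abs_sin_le_one z
    have : |s * cos z - sin z| ≤ s + 1 := by
      refine (abs_sub _ _).trans ?_
      rw [abs_mul, abs_of_pos hs]
      nlinarith
    simp only [Function.comp, norm_eq_abs]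
    refine (abs_add_le _ _).trans ?_
    rw [abs_div, abs_div, abs_neg, abs_one, abs_of_pos hs,
      abs_of_pos (by positivity : 0 < 1 + s ^ 2)]
    gcongr
  refine ⟨integrableOn_Ioi_deriv_of_nonneg' hd hpos hlim, ?_⟩
  rw [integral_Ioi_of_hasDerivAt_of_nonneg' hd hpos hlim]
  have : 1 + s ^ 2 ≠ 0 := by positivity
  simp
  field_simp
  ring

/-- Writing `1 / (1 + s ^ 2)` as `∫ exp (-(1 + s ^ 2) t) dt` gives
`Gamma (a / 2) Gamma (1 - a / 2)`, to which the reflection formula applies. -/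
theorem lintegral_rpow_div_one_add_sq {a : ℝ} (ha : 0 < a) (ha2 : a < 2) :
    ∫⁻ s in Ioi (0 : ℝ), ENNReal.ofReal (s ^ (a - 1) / (1 + s ^ 2)) =
      ENNReal.ofReal (π / (2 * sin (π * a / 2))) := by
  have h1 : ∀ s ∈ Ioi (0 : ℝ), ENNReal.ofReal (s ^ (a - 1) / (1 + s ^ 2)) =
      ∫⁻ t in Ioi (0 : ℝ), ENNReal.ofReal (s ^ (a - 1) * exp (-((1 + s ^ 2) * t))) := by
    intro s hs
    have hs0 : (0 : ℝ) < s := hs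
    have hpos : 0 < 1 + s ^ 2 := by positivity
    have hI := integral_rpow_mul_exp_neg_mul_Ioi one_pos hpos
    simp only [sub_self, rpow_zero, one_mul, rpow_one, Gamma_one, mul_one] at hI
    have hint : IntegrableOn (fun t ↦ exp (-((1 + s ^ 2) * t))) (Ioi 0) :=
      .of_integral_ne_zero (by rw [hI]; positivity)
    rw [← ofReal_integral_eq_lintegral_ofReal (hint.const_mul _)
      (ae_of_all _ fun t ↦ by positivity), integral_const_mul, hI]
    congr 1
    ring
  have h2 : ∀ t ∈ Ioi (0 : ℝ),
      ∫⁻ s in Ioi (0 : ℝ), ENNReal.ofReal (s ^ (a - 1) * exp (-((1 + s ^ 2) * t))) =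
        ENNReal.ofReal (1 / 2 * Gamma (a / 2) * (t ^ ((1 - a / 2) - 1) * exp (-(1 * t)))) := by
    intro t ht
    have ht0 : (0 : ℝ) < t := ht
    have hI := integral_rpow_mul_exp_neg_mul_rpow (p := 2) (q := a - 1) two_pos (by linarith) ht0
    have hG := Gamma_pos_of_pos (half_pos ha)
    have e : (a - 1 + 1) / 2 = a / 2 := by ring
    have hint : IntegrableOn (fun s ↦ s ^ (a - 1) * exp (-t * s ^ (2 : ℝ))) (Ioi 0) :=
      .of_integral_ne_zero (by rw [hI, e]; positivity)
    have hcongr : ∀ s : ℝ, s ^ (a - 1) * exp (-((1 + s ^ 2) * t)) =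
        exp (-t) * (s ^ (a - 1) * exp (-t * s ^ (2 : ℝ))) := by
      intro s
      rw [mul_left_comm, ← exp_add, rpow_two]
      ring_nf
    simp_rw [hcongr]
    rw [← ofReal_integral_eq_lintegral_ofReal (hint.const_mul _), integral_const_mul, hI]
    · congr 1
      rw [e, show -(a - 1 + 1) / 2 = 1 - a / 2 - 1 by ring]
      ring_nf
    · filter_upwards [self_mem_ae_restrict measurableSet_Ioi] with s hs
      have : (0 : ℝ) < s := hs
      positivity
  have hG := Gamma_pos_of_pos (half_pos ha)
  have hG' := Gamma_pos_of_pos (show 0 < 1 - a / 2 by linarith)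
  have hI := integral_rpow_mul_exp_neg_mul_Ioi (show 0 < 1 - a / 2 by linarith) one_pos
  have hint : IntegrableOn (fun t ↦ t ^ ((1 - a / 2) - 1) * exp (-(1 * t))) (Ioi 0) :=
    .of_integral_ne_zero (by rw [hI]; positivity)
  rw [setLIntegral_congr_fun measurableSet_Ioi h1, lintegral_lintegral_swap (by fun_prop),
    setLIntegral_congr_fun measurableSet_Ioi h2,
    ← ofReal_integral_eq_lintegral_ofReal (hint.const_mul _), integral_const_mul, hI]
  · congr 1
    have := Gamma_mul_Gamma_one_sub (a / 2)
    rw [div_one, one_rpow, one_mul, mul_assoc, this]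
    rw [show π * (a / 2) = π * a / 2 by ring]
    ring
  · filter_upwards [self_mem_ae_restrict measurableSet_Ioi] with s hs
    have : (0 : ℝ) < s := hs
    positivity

theorem sin_pi_mul_half_pos {a : ℝ} (ha : 0 < a) (ha2 : a < 2) : 0 < sin (π * a / 2) :=
  sin_pos_of_pos_of_lt_pi (by positivity) (by nlinarith [pi_pos])

/-- The power `z ^ (-1 - a)` is a Laplace transform: `Gamma (1 + a) z ^ (-1 - a)` is
`∫ s ^ a exp (-s z) ds`. Swapping the integrals leaves the Laplace transform of `1 - cos`. -/
theorem lintegral_one_sub_cos_mul_rpow {a : ℝ} (ha : 0 < a) (ha2 : a < 2) :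
    ∫⁻ z in Ioi (0 : ℝ), ENNReal.ofReal ((1 - cos z) * z ^ (-1 - a)) =
      ENNReal.ofReal (π / (2 * Gamma (1 + a) * sin (π * a / 2))) := by
  have hG := Gamma_pos_of_pos (show 0 < 1 + a by linarith)
  have h1 : ∀ z ∈ Ioi (0 : ℝ), ENNReal.ofReal ((1 - cos z) * z ^ (-1 - a)) =
      ∫⁻ s in Ioi (0 : ℝ), ENNReal.ofReal ((Gamma (1 + a))⁻¹ * s ^ a *
        ((1 - cos z) * exp (-(s * z)))) := by
    intro z hz
    have hz0 : (0 : ℝ) < z := hz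
    have hI := integral_rpow_mul_exp_neg_mul_Ioi (show 0 < 1 + a by linarith) hz0
    rw [add_sub_cancel_left] at hI
    have hint : IntegrableOn (fun s ↦ s ^ a * exp (-(z * s))) (Ioi 0) :=
      .of_integral_ne_zero (by rw [hI]; positivity)
    have hcongr : ∀ s : ℝ, (Gamma (1 + a))⁻¹ * s ^ a * ((1 - cos z) * exp (-(s * z))) =
        (Gamma (1 + a))⁻¹ * (1 - cos z) * (s ^ a * exp (-(z * s))) := by
      intro s
      rw [mul_comm s z]; ring
    have hc : 0 ≤ 1 - cos z := by linarith [cos_le_one z]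
    simp_rw [hcongr]
    rw [← ofReal_integral_eq_lintegral_ofReal (hint.const_mul _), integral_const_mul, hI]
    · congr 1
      rw [one_div, inv_rpow hz0.le, ← rpow_neg hz0.le, show -(1 + a) = -1 - a by ring]
      field_simp
    · filter_upwards [self_mem_ae_restrict measurableSet_Ioi] with s hs
      have : (0 : ℝ) < s := hs
      positivity
  have h2 : ∀ s ∈ Ioi (0 : ℝ),
      ∫⁻ z in Ioi (0 : ℝ), ENNReal.ofReal ((Gamma (1 + a))⁻¹ * s ^ a *
        ((1 - cos z) * exp (-(s * z)))) =
      ENNReal.ofReal (Gamma (1 + a))⁻¹ * ENNReal.ofReal (s ^ (a - 1) / (1 + s ^ 2)) := by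
    intro s hs
    have hs0 : (0 : ℝ) < s := hs
    obtain ⟨hint, hI⟩ := integral_one_sub_cos_mul_exp hs0
    rw [← ofReal_integral_eq_lintegral_ofReal (hint.const_mul _), integral_const_mul, hI,
      ← ENNReal.ofReal_mul (by positivity)]
    · congr 1
      rw [rpow_sub_one hs0.ne']
      field_simp
    · refine ae_of_all _ fun z ↦ ?_
      have hc : 0 ≤ 1 - cos z := by linarith [cos_le_one z]
      simp only [Pi.zero_apply]
      positivity
  rw [setLIntegral_congr_fun measurableSet_Ioi h1, lintegral_lintegral_swap (by fun_prop),
    setLIntegral_congr_fun measurableSet_Ioi h2, lintegral_const_mul _ (by fun_prop),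
    lintegral_rpow_div_one_add_sq ha ha2, ← ENNReal.ofReal_mul (by positivity)]
  congr 1
  have := (sin_pi_mul_half_pos ha ha2).ne'
  field_simp

theorem one_sub_cos_mul_rpow_nonneg {a z : ℝ} (hz : 0 ≤ z) : 0 ≤ (1 - cos z) * z ^ (-1 - a) :=
  mul_nonneg (by linarith [cos_le_one z]) (rpow_nonneg hz _)

theorem integrableOn_one_sub_cos_mul_rpow {a : ℝ} (ha : 0 < a) (ha2 : a < 2) :
    IntegrableOn (fun z ↦ (1 - cos z) * z ^ (-1 - a)) (Ioi 0) := by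
  refine ⟨by fun_prop, ?_⟩
  rw [hasFiniteIntegral_iff_ofReal, lintegral_one_sub_cos_mul_rpow ha ha2]
  · exact ENNReal.ofReal_lt_top
  · filter_upwards [self_mem_ae_restrict measurableSet_Ioi] with z hz
    exact one_sub_cos_mul_rpow_nonneg (le_of_lt hz)

theorem integral_one_sub_cos_mul_rpow {a : ℝ} (ha : 0 < a) (ha2 : a < 2) :
    ∫ z in Ioi (0 : ℝ), (1 - cos z) * z ^ (-1 - a) =
      π / (2 * Gamma (1 + a) * sin (π * a / 2)) := by
  have hG := Gamma_pos_of_pos (show 0 < 1 + a by linarith)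
  have := sin_pi_mul_half_pos ha ha2
  rw [integral_eq_lintegral_of_nonneg_ae, lintegral_one_sub_cos_mul_rpow ha ha2,
    ENNReal.toReal_ofReal (by positivity)]
  · filter_upwards [self_mem_ae_restrict measurableSet_Ioi] with z hz
    exact one_sub_cos_mul_rpow_nonneg (le_of_lt hz)
  · fun_prop

/-- The constant `κ(α)` for which the Lévy measure `α |z|^(-1-α) dz` has the characteristic
exponent `-κ(α) |u|^α`. -/
noncomputable def stableConst (α : ℝ) : ℝ := π * α / (Gamma (1 + α) * sin (π * α / 2))

theorem stableConst_pos {a : ℝ} (ha : 0 < a) (ha2 : a < 2) : 0 < stableConst a := by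
  have hG := Gamma_pos_of_pos (show 0 < 1 + a by linarith)
  have := sin_pi_mul_half_pos ha ha2
  unfold stableConst
  positivity

theorem differentiableAt_stableConst {a : ℝ} (ha : 0 < a) (ha2 : a < 2) :
    DifferentiableAt ℝ stableConst a := by
  have hG := Gamma_pos_of_pos (show 0 < 1 + a by linarith)
  have := sin_pi_mul_half_pos ha ha2
  have h1 : DifferentiableAt ℝ (fun x : ℝ ↦ Gamma (1 + x)) a := by
    have h : DifferentiableAt ℝ Gamma (1 + a) := differentiableAt_Gamma fun m h ↦ by
      have : (0 : ℝ) ≤ m := by positivity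
      linarith
    exact (h.hasDerivAt.comp_const_add 1 a).differentiableAt
  unfold stableConst
  exact DifferentiableAt.div (by fun_prop) (h1.mul (by fun_prop)) (by positivity)

theorem integral_one_sub_cos_mul_rpow' {a : ℝ} (ha : 0 < a) (ha2 : a < 2) :
    ∫ z in Ioi (0 : ℝ), (1 - cos z) * z ^ (-1 - a) = stableConst a / (2 * a) := by
  rw [integral_one_sub_cos_mul_rpow ha ha2, stableConst]
  field_simp

/-! ### Lévy exponents of stable processes with a Gaussian part -/

theorem integrable_comp_abs_of_integrableOn_Ioi {f : ℝ → ℝ} (hf : IntegrableOn f (Ioi 0)) :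
    Integrable (fun x ↦ f |x|) := by
  have h1 : IntegrableOn (fun x ↦ f |x|) (Ioi 0) :=
    hf.congr_fun (fun x hx ↦ by rw [abs_of_pos hx]) measurableSet_Ioi
  have h2 : IntegrableOn (fun x ↦ f |x|) (Iio 0) := by
    have h := h1.comp_neg
    simp only [abs_neg] at h
    convert h using 2
    ext x; simp
  have h3 : IntegrableOn (fun x ↦ f |x|) (Iic 0) :=
    (integrableOn_Iic_iff_integrableOn_Iio (by finiteness)).2 h2
  have := h3.union h1
  rwa [Iic_union_Ioi, integrableOn_univ] at this

theorem integrableOn_one_sub_cos_mul_mul_rpow {a : ℝ} (ha : 0 < a) (ha2 : a < 2) (u : ℝ) :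
    IntegrableOn (fun z ↦ (1 - cos (u * z)) * z ^ (-1 - a)) (Ioi 0) := by
  rcases eq_or_ne u 0 with rfl | hu
  · simp
  have hu' : 0 < |u| := abs_pos.2 hu
  have h := (integrableOn_Ioi_comp_mul_left_iff (fun z ↦ (1 - cos z) * z ^ (-1 - a)) 0 hu').2
    (by simpa using integrableOn_one_sub_cos_mul_rpow ha ha2)
  refine IntegrableOn.congr_fun (h.const_mul (|u| ^ (1 + a))) (fun z hz ↦ ?_) measurableSet_Ioi
  have hz0 : (0 : ℝ) < z := hz
  rw [mul_rpow hu'.le hz0.le, show cos (|u| * z) = cos (u * z) by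
    rw [← abs_of_pos hz0, ← abs_mul, cos_abs, abs_of_pos hz0]]
  rw [mul_left_comm, ← mul_assoc (|u| ^ (1 + a)), ← rpow_add hu']
  simp

theorem integral_one_sub_cos_mul_mul_rpow {a : ℝ} (ha : 0 < a) (ha2 : a < 2) (u : ℝ) :
    ∫ z in Ioi (0 : ℝ), (1 - cos (u * z)) * z ^ (-1 - a) = stableConst a / (2 * a) * |u| ^ a := by
  rcases eq_or_ne u 0 with rfl | hu
  · simp [zero_rpow ha.ne']
  have hu' : 0 < |u| := abs_pos.2 hu
  have h := integral_comp_mul_left_Ioi (fun z ↦ (1 - cos z) * z ^ (-1 - a)) 0 hu'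
  rw [mul_zero, integral_one_sub_cos_mul_rpow' ha ha2, smul_eq_mul] at h
  have h2 : ∫ z in Ioi (0 : ℝ), (1 - cos (u * z)) * z ^ (-1 - a) =
      ∫ z in Ioi (0 : ℝ), |u| ^ (1 + a) * ((1 - cos (|u| * z)) * (|u| * z) ^ (-1 - a)) := by
    refine setIntegral_congr_fun measurableSet_Ioi fun z hz ↦ ?_
    have hz0 : (0 : ℝ) < z := hz
    rw [mul_rpow hu'.le hz0.le, show cos (|u| * z) = cos (u * z) by
      rw [← abs_of_pos hz0, ← abs_mul, cos_abs, abs_of_pos hz0]]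
    rw [mul_left_comm (1 - cos (u * z)), ← mul_assoc (|u| ^ (1 + a)), ← rpow_add hu']
    simp
  rw [h2, integral_const_mul, h, add_comm, rpow_add_one hu'.ne']
  field_simp

theorem norm_cexp_I_mul_sub_one_sub_le (x : ℝ) :
    ‖Complex.exp (Complex.I * x) - 1 - Complex.I * x‖ ≤ 3 * x ^ 2 := by
  rcases le_total |x| 1 with h | h
  · have := Complex.norm_exp_sub_one_sub_id_le (x := Complex.I * x) (by simpa using h)
    refine this.trans ?_
    simp only [norm_mul, Complex.norm_I, one_mul, Complex.norm_real, norm_eq_abs, sq_abs]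
    nlinarith [sq_nonneg x]
  · refine (norm_sub_le _ _).trans ?_
    have h1 : ‖Complex.exp (Complex.I * x) - 1‖ ≤ |x| := by
      simpa using norm_exp_I_mul_ofReal_sub_one_le (x := x)
    have h2 : ‖Complex.I * (x : ℂ)‖ = |x| := by simp
    rw [h2, ← sq_abs x]
    nlinarith

theorem integrable_min_one_sq_mul_rpow {a : ℝ} (ha : 0 < a) (ha2 : a < 2) :
    Integrable (fun z : ℝ ↦ min 1 (|z| ^ 2) * |z| ^ (-1 - a)) := by
  refine integrable_comp_abs_of_integrableOn_Ioi (f := fun z ↦ min 1 (z ^ 2) * z ^ (-1 - a)) ?_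
  rw [← Ioc_union_Ioi_eq_Ioi (zero_le_one' ℝ)]
  refine IntegrableOn.union ?_ ?_
  · have h : IntegrableOn (fun z : ℝ ↦ z ^ (1 - a)) (Ioc 0 1) := by
      rw [← intervalIntegrable_iff_integrableOn_Ioc_of_le zero_le_one]
      exact intervalIntegral.intervalIntegrable_rpow' (by linarith)
    refine h.congr_fun (fun z hz ↦ ?_) measurableSet_Ioc
    simp only
    rw [min_eq_right (by nlinarith [hz.1, hz.2]), ← rpow_natCast, ← rpow_add hz.1]
    congr 1; push_cast; ring
  · refine (integrableOn_Ioi_rpow_of_lt (show -1 - a < -1 by linarith) one_pos).congr_fun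
      (fun z hz ↦ ?_) measurableSet_Ioi
    have hz1 : (1 : ℝ) < z := hz
    simp only
    rw [min_eq_left (by nlinarith), one_mul]

/-- The characteristic exponent of a Brownian motion plus a symmetric stable process. The odd part
of the Lévy–Khintchine integrand does not contribute, whatever the truncation function. -/
theorem levyExponent_stable {τ : ℝ → ℝ} (hτ : IsTruncation τ) {a r : ℝ} (ha : 0 < a) (ha2 : a < 2)
    (hr : 0 < r) (c u : ℝ) :
    levyExponent τ 0 c (stableLevyMeasure a r r) u =
      ((-(c * u ^ 2 / 2) - r * stableConst a * |u| ^ a : ℝ) : ℂ) := by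
  set k : ℝ → ℝ := fun z ↦ a / |z| ^ (1 + a) * (if 0 < z then r else if z < 0 then r else 0) with hk
  have hkm : Measurable k := by
    refine Measurable.mul (by fun_prop) ?_
    exact Measurable.ite measurableSet_Ioi measurable_const
      (Measurable.ite measurableSet_Iio measurable_const measurable_const)
  have hk1 : ∀ z, z ≠ 0 → k z = a * r * |z| ^ (-1 - a) := by
    intro z hz
    have : (if 0 < z then r else if z < 0 then r else 0) = r := by
      rcases lt_or_gt_of_ne hz with h | h <;> simp [h, h.not_gt]
    simp only [hk, this]
    rw [show -1 - a = -(1 + a) by ring, rpow_neg (abs_nonneg z)]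
    ring
  have hk0 : k 0 = 0 := by simp [hk]
  have hkneg : ∀ z, k (-z) = k z := by
    intro z
    rcases eq_or_ne z 0 with rfl | hz
    · simp
    · rw [hk1 z hz, hk1 (-z) (neg_ne_zero.2 hz), abs_neg]
  have hkpos : ∀ z, 0 ≤ k z := by
    intro z
    rcases eq_or_ne z 0 with rfl | hz
    · rw [hk0]
    · rw [hk1 z hz]; positivity
  set g : ℝ → ℂ := fun z ↦ Complex.exp (Complex.I * u * z) - 1 - Complex.I * u * τ z with hg
  have hgm : Measurable g := by
    have := hτ.measurable
    fun_prop
  have hgb : ∀ z, ‖g z‖ ≤ (3 * u ^ 2 + 2 + 2 * |u|) * min 1 (|z| ^ 2) := by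
    intro z
    have e : Complex.I * u * z = Complex.I * ((u * z : ℝ) : ℂ) := by push_cast; ring
    rcases lt_or_ge |z| 1 with h | h
    · have := norm_cexp_I_mul_sub_one_sub_le (u * z)
      rw [min_eq_right (by nlinarith [abs_nonneg z])]
      simp only [hg, hτ.eq_self z h]
      rw [e]
      refine this.trans ?_
      rw [sq_abs]
      nlinarith [sq_nonneg z, abs_nonneg u, mul_nonneg (sq_nonneg z) (abs_nonneg u)]
    · rw [min_eq_left (by nlinarith [abs_nonneg z])]
      simp only [hg]
      rw [e]
      refine (norm_sub_le _ _).trans ?_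
      have h1 : ‖Complex.exp (Complex.I * ((u * z : ℝ) : ℂ)) - 1‖ ≤ 2 := by
        refine (norm_sub_le _ _).trans ?_
        rw [Complex.norm_exp_I_mul_ofReal, norm_one]; norm_num
      have h2 : ‖Complex.I * (u : ℂ) * (τ z : ℂ)‖ ≤ |u| * 2 := by
        simp only [norm_mul, Complex.norm_I, one_mul, Complex.norm_real, norm_eq_abs]
        exact mul_le_mul_of_nonneg_left (hτ.bound z) (abs_nonneg u)
      nlinarith [sq_nonneg u]
  have hint : Integrable (fun z ↦ (k z : ℂ) * g z) := by
    refine ((integrable_min_one_sq_mul_rpow ha ha2).const_mul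
      (a * r * (3 * u ^ 2 + 2 + 2 * |u|))).mono' (by fun_prop) (ae_of_all _ fun z ↦ ?_)
    rw [norm_mul, Complex.norm_real, norm_eq_abs, abs_of_nonneg (hkpos z)]
    rcases eq_or_ne z 0 with rfl | hz
    · simp [hk0]
    · rw [hk1 z hz]
      calc _ ≤ a * r * |z| ^ (-1 - a) * ((3 * u ^ 2 + 2 + 2 * |u|) * min 1 (|z| ^ 2)) := by
            gcongr; exact hgb z
        _ = _ := by ring
  have hI : ∫ z, g z ∂(stableLevyMeasure a r r) = ∫ z, (k z : ℂ) * g z := by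
    rw [stableLevyMeasure, integral_withDensity_eq_integral_toReal_smul
      (by exact hkm.ennreal_ofReal) (ae_of_all _ fun z ↦ ENNReal.ofReal_lt_top)]
    refine integral_congr_ae (ae_of_all _ fun z ↦ ?_)
    simp only
    rw [ENNReal.toReal_ofReal (hkpos z), Complex.real_smul]
  have hodd : ∀ z, (k z : ℂ) * g z + k (-z) * g (-z) =
      ((2 * (-(a * r) * ((1 - cos (u * |z|)) * |z| ^ (-1 - a))) : ℝ) : ℂ) := by
    intro z
    rw [hkneg, ← mul_add]
    have h1 : g z + g (-z) = ((-2 * (1 - cos (u * |z|)) : ℝ) : ℂ) := by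
      have : cos (u * |z|) = cos (u * z) := by
        rw [← cos_abs (u * z), abs_mul, ← cos_abs (u * |z|), abs_mul, abs_abs]
      simp only [hg, hτ.odd, this]
      push_cast
      rw [Complex.cos, show Complex.I * u * -(z : ℂ) = -(↑u * ↑z) * Complex.I by ring,
        show Complex.I * u * (z : ℂ) = (↑u * ↑z) * Complex.I by ring]
      ring
    rw [h1]
    rcases eq_or_ne z 0 with rfl | hz
    · simp
    · rw [hk1 z hz]; push_cast; ring
  have h2 : 2 * ∫ z, (k z : ℂ) * g z =
      ((2 * (2 * (-(a * r) * (stableConst a / (2 * a) * |u| ^ a))) : ℝ) : ℂ) := by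
    have hneg : ∫ z, (k (-z) : ℂ) * g (-z) = ∫ z, (k z : ℂ) * g z :=
      integral_neg_eq_self (fun z ↦ (k z : ℂ) * g z) volume
    rw [two_mul]
    nth_rewrite 2 [← hneg]
    rw [← integral_add hint hint.comp_neg]
    simp_rw [hodd]
    rw [integral_complex_ofReal, integral_const_mul, integral_const_mul,
      integral_comp_abs (f := fun z ↦ (1 - cos (u * z)) * z ^ (-1 - a)),
      integral_one_sub_cos_mul_mul_rpow ha ha2]
    congr 1; ring
  have h3 : ∫ z, (k z : ℂ) * g z = ((-(r * stableConst a * |u| ^ a) : ℝ) : ℂ) := by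
    have : (2 : ℂ) ≠ 0 := two_ne_zero
    apply mul_left_cancel₀ this
    rw [h2]
    push_cast
    have : (a : ℂ) ≠ 0 := by exact_mod_cast ha.ne'
    field_simp
  rw [levyExponent, hI, h3]
  push_cast
  ring

/-! ### Lévy's continuity theorem and existence of stable laws -/

/-- **Lévy's continuity theorem**, existence part: a pointwise limit of characteristic functions
that is continuous at the origin is a characteristic function. -/
theorem exists_charFun_eq_of_tendsto {μ : ℕ → ProbabilityMeasure ℝ} {f : ℝ → ℂ}
    (hf : ContinuousAt f 0)
    (h : ∀ t, Tendsto (fun n ↦ charFun (μ n : Measure ℝ) t) atTop (𝓝 (f t))) :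
    ∃ m : Measure ℝ, IsProbabilityMeasure m ∧ ∀ t, charFun m t = f t := by
  have htight := isTightMeasureSet_of_tendsto_charFun (μ := fun n ↦ (μ n : Measure ℝ)) hf h
  have hcomp : IsCompact (closure (range μ)) := by
    refine isCompact_closure_of_isTightMeasureSet ?_
    convert htight using 1
    ext m
    simp
  obtain ⟨m, -, hm⟩ := isCompact_iff_ultrafilter_le_nhds.1 hcomp
    ((Ultrafilter.of atTop).map μ) (by
      rw [le_principal_iff, Ultrafilter.mem_coe, Ultrafilter.mem_map]
      exact mem_of_superset univ_mem fun n _ ↦ subset_closure (mem_range_self n))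
  refine ⟨m, inferInstance, fun t ↦ ?_⟩
  have h1 : Tendsto (fun n ↦ charFun (μ n : Measure ℝ) t)
      ((Ultrafilter.of atTop : Ultrafilter ℕ) : Filter ℕ)
      (𝓝 (charFun (m : Measure ℝ) t)) := by
    have := (ProbabilityMeasure.tendsto_iff_forall_integral_rclike_tendsto ℂ
      (F := (Ultrafilter.of (atTop : Filter ℕ) : Filter ℕ)) (μs := μ)).1 hm
      (BoundedContinuousFunction.innerProbChar t)
    simpa only [charFun_eq_integral_innerProbChar] using this
  exact tendsto_nhds_unique h1 ((h t).mono_left (Ultrafilter.of_le _))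

theorem exists_charFun_eq_pow (μ : Measure ℝ) [IsProbabilityMeasure μ] (n : ℕ) :
    ∃ m : ProbabilityMeasure ℝ, ∀ t, charFun (m : Measure ℝ) t = charFun μ t ^ n := by
  induction n with
  | zero => exact ⟨⟨Measure.dirac 0, inferInstance⟩, fun t ↦ by simp⟩
  | succ n ih =>
    obtain ⟨m, hm⟩ := ih
    refine ⟨⟨(m : Measure ℝ).conv μ, inferInstance⟩, fun t ↦ ?_⟩
    rw [ProbabilityMeasure.coe_mk, charFun_conv, hm, pow_succ]

/-- The symmetric Pareto law with scale `η` and index `a`: its Lévy-type exponent is that of the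
symmetric stable law, cut off at distance `η` from the origin. -/
theorem exists_charFun_symmetric_pareto {a η : ℝ} (ha : 0 < a) (hη : 0 < η) :
    ∃ m : Measure ℝ, IsProbabilityMeasure m ∧ ∀ t, charFun m t =
      ((1 - a * η ^ a * ∫ z in Ioi η, (1 - cos (t * z)) * z ^ (-1 - a) : ℝ) : ℂ) := by
  set w : ℝ → ℝ := fun z ↦ a * η ^ a * z ^ (-1 - a) with hw
  have hw0 : ∀ z ∈ Ioi η, 0 ≤ w z := fun z hz ↦ by
    have : 0 < z := hη.trans hz
    positivity
  have hwint : IntegrableOn w (Ioi η) :=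
    (integrableOn_Ioi_rpow_of_lt (show -1 - a < -1 by linarith) hη).const_mul _
  have hwI : ∫ z in Ioi η, w z = 1 := by
    rw [integral_const_mul, integral_Ioi_rpow_of_lt (show -1 - a < -1 by linarith) hη,
      show -1 - a + 1 = -a by ring, rpow_neg hη.le]
    have := (rpow_pos_of_pos hη a).ne'
    field_simp
  set ν : Measure ℝ := (volume.restrict (Ioi η)).withDensity fun z ↦ ENNReal.ofReal (w z) with hν
  have hνp : IsProbabilityMeasure ν := ⟨by
    rw [hν, withDensity_apply _ MeasurableSet.univ, Measure.restrict_univ,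
      ← ofReal_integral_eq_lintegral_ofReal hwint, hwI, ENNReal.ofReal_one]
    filter_upwards [self_mem_ae_restrict measurableSet_Ioi] with z hz using hw0 z hz⟩
  have hνm : IsProbabilityMeasure (ν.map Neg.neg) :=
    Measure.isProbabilityMeasure_map (by fun_prop)
  have hνc : ∀ t, charFun ν t = ∫ z in Ioi η, (w z : ℂ) * Complex.exp (t * z * Complex.I) := by
    intro t
    rw [charFun_apply_real, hν, integral_withDensity_eq_integral_toReal_smul (by fun_prop)
      (ae_of_all _ fun z ↦ ENNReal.ofReal_lt_top)]
    refine setIntegral_congr_fun measurableSet_Ioi fun z hz ↦ ?_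
    rw [ENNReal.toReal_ofReal (hw0 z hz), Complex.real_smul]
  have hmapc : ∀ t, charFun (ν.map Neg.neg) t = charFun ν (-t) := by
    intro t
    have := charFun_map_mul (μ := ν) (-1) t
    simpa [show ((fun x : ℝ ↦ -x) = Neg.neg) from rfl] using this
  have hint : ∀ t : ℝ, IntegrableOn (fun z ↦ (w z : ℂ) * Complex.exp (t * z * Complex.I))
      (Ioi η) := by
    intro t
    refine (hwint.norm).mono' (by fun_prop) (ae_of_all _ fun z ↦ ?_)
    rw [norm_mul, Complex.norm_real, show (t : ℂ) * z * Complex.I = ((t * z : ℝ) : ℂ) * Complex.I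
      by push_cast; ring, Complex.norm_exp_ofReal_mul_I, mul_one]
  refine ⟨(1 / 2 : ENNReal) • (ν + ν.map Neg.neg), ⟨?_⟩, fun t ↦ ?_⟩
  · simp only [Measure.smul_apply, Measure.add_apply, measure_univ, smul_eq_mul]
    rw [one_add_one_eq_two, one_div, ENNReal.inv_mul_cancel two_ne_zero ENNReal.ofNat_ne_top]
  · have hi : ∀ m : Measure ℝ, IsProbabilityMeasure m →
        Integrable (fun x : ℝ ↦ Complex.exp (t * x * Complex.I)) m := by
      intro m hm
      refine (integrable_const (1 : ℝ)).mono' (by fun_prop) (ae_of_all _ fun z ↦ ?_)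
      rw [show (t : ℂ) * z * Complex.I = ((t * z : ℝ) : ℂ) * Complex.I
        by push_cast; ring, Complex.norm_exp_ofReal_mul_I]
    have h1 : charFun ((1 / 2 : ENNReal) • (ν + ν.map Neg.neg)) t =
        (1 / 2 : ℂ) * (charFun ν t + charFun ν (-t)) := by
      rw [← hmapc]
      simp only [charFun_apply_real]
      rw [integral_smul_measure, integral_add_measure (hi _ hνp) (hi _ hνm)]
      simp [mul_add]
    rw [h1, hνc, hνc, ← integral_add (hint t) (hint (-t)), ← integral_const_mul]
    have h2 : ∀ z : ℝ, (1 / 2 : ℂ) * ((w z : ℂ) * Complex.exp (t * z * Complex.I) +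
        (w z : ℂ) * Complex.exp ((-t : ℝ) * z * Complex.I)) =
        ((w z - a * η ^ a * ((1 - cos (t * z)) * z ^ (-1 - a)) : ℝ) : ℂ) := by
      intro z
      have : w z - a * η ^ a * ((1 - cos (t * z)) * z ^ (-1 - a)) = w z * cos (t * z) := by
        simp only [hw]; ring
      rw [this]
      push_cast
      rw [Complex.cos]
      ring_nf
    simp_rw [h2]
    have hint2 : IntegrableOn (fun z ↦ (1 - cos (t * z)) * z ^ (-1 - a)) (Ioi η) := by
      refine ((integrableOn_Ioi_rpow_of_lt (show -1 - a < -1 by linarith) hη).const_mul 2).mono'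
        (by fun_prop) ?_
      filter_upwards [self_mem_ae_restrict measurableSet_Ioi] with z hz
      have hz0 : 0 < z := hη.trans hz
      rw [norm_mul, norm_eq_abs, norm_eq_abs, abs_of_nonneg (rpow_nonneg hz0.le _)]
      gcongr
      rw [abs_le]
      constructor <;> linarith [cos_le_one (t * z), neg_one_le_cos (t * z)]
    rw [integral_complex_ofReal, integral_sub hwint (hint2.const_mul _), hwI, integral_const_mul]

/-- Existence of the symmetric stable law, as a weak limit of normalised sums of independent
variables with symmetric Pareto law. -/
theorem exists_charFun_stable {a c : ℝ} (ha : 0 < a) (ha2 : a < 2) (hc : 0 < c) :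
    ∃ m : Measure ℝ, IsProbabilityMeasure m ∧
      ∀ t, charFun m t = ((exp (-(c * |t| ^ a)) : ℝ) : ℂ) := by
  have hκ := stableConst_pos ha ha2
  -- The scale `η n` of the Pareto law is chosen so that `(n + 1) * η n ^ a = 2 * c / κ(a)`.
  set b : ℝ := 2 * c / stableConst a with hb
  have hb0 : 0 < b := by positivity
  set η : ℕ → ℝ := fun n ↦ (b / (n + 1)) ^ (1 / a) with hη
  have hη0 : ∀ n, 0 < η n := fun n ↦ by positivity
  have hηa : ∀ n, η n ^ a = b / (n + 1) := fun n ↦ by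
    simp only [hη]
    rw [← rpow_mul (by positivity), one_div_mul_cancel ha.ne', rpow_one]
  have hηlim : Tendsto η atTop (𝓝 0) := by
    have h1 : Tendsto (fun n : ℕ ↦ b / ((n : ℝ) + 1)) atTop (𝓝 0) := by
      have := (tendsto_one_div_add_atTop_nhds_zero_nat (𝕜 := ℝ)).const_mul b
      simpa only [mul_one_div, mul_zero] using this
    have := h1.rpow_const (p := 1 / a) (Or.inr (by positivity))
    rwa [zero_rpow (by positivity)] at this
  have hp : ∀ n, ∃ m : ProbabilityMeasure ℝ, ∀ t, charFun (m : Measure ℝ) t =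
      (((1 - a * η n ^ a * ∫ z in Ioi (η n), (1 - cos (t * z)) * z ^ (-1 - a) : ℝ) : ℂ)) ^
        (n + 1) := by
    intro n
    obtain ⟨ρ, hρ, h⟩ := exists_charFun_symmetric_pareto ha (hη0 n)
    obtain ⟨m, hm⟩ := exists_charFun_eq_pow ρ (n + 1)
    exact ⟨m, fun t ↦ by rw [hm, h]⟩
  choose μ hμ using hp
  refine exists_charFun_eq_of_tendsto (μ := μ) ?_ fun t ↦ ?_
  · refine Continuous.continuousAt ?_
    have : Continuous fun t : ℝ ↦ |t| ^ a := continuous_abs.rpow_const fun _ ↦ Or.inr ha.le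
    fun_prop
  simp_rw [hμ]
  simp_rw [← Complex.ofReal_pow]
  refine (Complex.continuous_ofReal.tendsto _).comp ?_
  have hI : Tendsto (fun n ↦ ∫ z in Ioi (η n), (1 - cos (t * z)) * z ^ (-1 - a)) atTop
      (𝓝 (stableConst a / (2 * a) * |t| ^ a)) := by
    rw [← integral_one_sub_cos_mul_mul_rpow ha ha2 t]
    have hint := integrableOn_one_sub_cos_mul_mul_rpow ha ha2 t
    simp_rw [← integral_indicator (measurableSet_Ioi (a := (0 : ℝ))),
      ← integral_indicator measurableSet_Ioi]
    refine tendsto_integral_of_dominated_convergence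
      (fun z ↦ ‖(Ioi 0).indicator (fun z ↦ (1 - cos (t * z)) * z ^ (-1 - a)) z‖) ?_ ?_ ?_ ?_
    · intro n
      exact (by fun_prop : Measurable fun z : ℝ ↦ (1 - cos (t * z)) * z ^ (-1 - a)).indicator
        measurableSet_Ioi |>.aestronglyMeasurable
    · exact ((integrable_indicator_iff measurableSet_Ioi).2 hint).norm
    · intro n
      refine ae_of_all _ fun z ↦ ?_
      exact norm_indicator_le_of_subset (Ioi_subset_Ioi (hη0 n).le) _ z
    · refine ae_of_all _ fun z ↦ ?_
      rcases lt_or_ge 0 z with hz | hz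
      · refine tendsto_const_nhds.congr' ?_
        filter_upwards [hηlim.eventually_lt_const hz] with n hn
        rw [indicator_of_mem (show z ∈ Ioi 0 from hz),
          indicator_of_mem (show z ∈ Ioi (η n) from hn)]
      · refine tendsto_const_nhds.congr fun n ↦ ?_
        rw [indicator_of_notMem (by simpa using hz),
          indicator_of_notMem (by simpa using hz.trans (hη0 n).le)]
  have hlim := Real.tendsto_one_add_pow_exp_of_tendsto
    (g := fun n : ℕ ↦ -(a * (b / n) *
      ∫ z in Ioi ((b / n) ^ (1 / a)), (1 - cos (t * z)) * z ^ (-1 - a))) (t := -(c * |t| ^ a)) (by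
    rw [← tendsto_add_atTop_iff_nat 1]
    have h1 : Tendsto (fun n ↦ -(a * b * ∫ z in Ioi (η n), (1 - cos (t * z)) * z ^ (-1 - a)))
        atTop (𝓝 (-(a * b * (stableConst a / (2 * a) * |t| ^ a)))) := (hI.const_mul _).neg
    have e : a * b * (stableConst a / (2 * a) * |t| ^ a) = c * |t| ^ a := by
      rw [hb]; field_simp
    rw [e] at h1
    refine h1.congr fun n ↦ ?_
    simp only [hη]
    push_cast
    have : (n : ℝ) + 1 ≠ 0 := by positivity
    field_simp)
  rw [← tendsto_add_atTop_iff_nat 1] at hlim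
  refine hlim.congr fun n ↦ ?_
  rw [hηa]
  simp only [hη]
  push_cast
  ring_nf

/-! ### The density of a normal plus an independent stable variable -/

/-- The density, in Fourier form, of the sum of a standard normal variable and an independent
symmetric `a`-stable one with characteristic function `exp (-c |u|^a)`. Below, `c` is called the
scale and `a` the index. -/
noncomputable def stableGaussDensity (a c x : ℝ) : ℝ :=
  (1 / π) * ∫ u in Ioi 0, cos (u * x) * exp (-(u ^ 2 / 2) - c * u ^ a)

theorem integrableOn_rpow_mul_exp_neg_sq_half {b : ℝ} (hb : -1 < b) :
    IntegrableOn (fun u : ℝ ↦ u ^ b * exp (-(u ^ 2 / 2))) (Ioi 0) := by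
  refine (integrableOn_rpow_mul_exp_neg_mul_sq (b := 1 / 2) (by norm_num) hb).congr_fun
    (fun u _ ↦ ?_) measurableSet_Ioi
  ring_nf

theorem integrableOn_exp_neg_sq_half :
    IntegrableOn (fun u : ℝ ↦ exp (-(u ^ 2 / 2))) (Ioi 0) := by
  simpa using integrableOn_rpow_mul_exp_neg_sq_half (b := 0) (by norm_num)

theorem norm_cos_mul_exp_le {c u b x : ℝ} (hc : 0 ≤ c) (hu : 0 ≤ u) :
    ‖cos (u * x) * exp (-(u ^ 2 / 2) - c * u ^ b)‖ ≤ exp (-(u ^ 2 / 2)) := by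
  rw [norm_mul, norm_eq_abs, norm_eq_abs, abs_of_pos (exp_pos _)]
  calc _ ≤ 1 * exp (-(u ^ 2 / 2)) := by
        gcongr
        · exact abs_cos_le_one _
        · exact mul_nonneg hc (rpow_nonneg hu _) |> fun h ↦ by linarith
    _ = _ := one_mul _

theorem continuous_stableGaussDensity {a c : ℝ} (hc : 0 ≤ c) :
    Continuous (stableGaussDensity a c) := by
  unfold stableGaussDensity
  refine continuous_const.mul (continuous_of_dominated (bound := fun u ↦ exp (-(u ^ 2 / 2)))
    (fun x ↦ by fun_prop) (fun x ↦ ?_) integrableOn_exp_neg_sq_half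
    (ae_of_all _ fun u ↦ by fun_prop))
  filter_upwards [self_mem_ae_restrict measurableSet_Ioi] with u hu
  exact norm_cos_mul_exp_le hc (le_of_lt hu)

/-- Convolving a probability measure `m` with the standard normal law gives the density whose
Fourier transform is the product of the two characteristic functions. -/
theorem integral_gaussianPDFReal_sub {m : Measure ℝ} [IsProbabilityMeasure m] {f : ℝ → ℝ}
    (hm : ∀ t, charFun m t = (f |t| : ℂ)) (x : ℝ) :
    ∫ y, ProbabilityTheory.gaussianPDFReal 0 1 (x - y) ∂m =
      (1 / π) * ∫ u in Ioi 0, cos (u * x) * (exp (-(u ^ 2 / 2)) * f u) := by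
  have hφ : ∀ z : ℝ, (ProbabilityTheory.gaussianPDFReal 0 1 z : ℂ) =
      1 / (2 * π) * ∫ u : ℝ, Complex.exp (Complex.I * z * u) * Complex.exp (-(1 / 2) * u ^ 2) := by
    intro z
    rw [fourierIntegral_gaussian (by norm_num) (z : ℂ), ProbabilityTheory.gaussianPDFReal]
    have h1 : ((π : ℂ) / (1 / 2)) ^ (1 / 2 : ℂ) = ((√(2 * π) : ℝ) : ℂ) := by
      rw [sqrt_eq_rpow, Complex.ofReal_cpow (by positivity)]
      push_cast
      congr 1
      ring
    rw [h1]
    have h2 : (0 : ℝ) < √(2 * π) := by positivity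
    have h3 : ((√(2 * π) : ℝ) : ℂ) ≠ 0 := by exact_mod_cast h2.ne'
    have h4 : ((√(2 * π) : ℝ) : ℂ) * ((√(2 * π) : ℝ) : ℂ) = 2 * π := by
      rw [← Complex.ofReal_mul, mul_self_sqrt (by positivity)]; push_cast; ring
    rw [← h4]
    push_cast
    simp only [mul_one, sub_zero]
    rw [show -(z : ℂ) ^ 2 / (4 * (1 / 2)) = -(z : ℂ) ^ 2 / 2 by ring]
    field_simp
  have hnorm : ∀ w u : ℝ, ‖Complex.exp (Complex.I * w * u) * Complex.exp (-(1 / 2) * u ^ 2)‖ =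
      exp (-(1 / 2) * u ^ 2) := by
    intro w u
    rw [norm_mul, show Complex.I * w * u = Complex.I * ((w * u : ℝ) : ℂ) by push_cast; ring,
      Complex.norm_exp_I_mul_ofReal, one_mul, Complex.norm_exp]
    congr 1
    rw [show -(1 / 2) * (u : ℂ) ^ 2 = ((-(1 / 2) * u ^ 2 : ℝ) : ℂ) by push_cast; ring,
      Complex.ofReal_re]
  have hswap : ∫ y, (∫ u : ℝ, Complex.exp (Complex.I * ((x - y : ℝ) : ℂ) * u) *
      Complex.exp (-(1 / 2) * u ^ 2)) ∂m = ∫ u : ℝ, ∫ y, Complex.exp (Complex.I * ((x - y : ℝ) : ℂ)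
        * u) * Complex.exp (-(1 / 2) * u ^ 2) ∂m := by
    refine integral_integral_swap ?_
    have : Integrable (fun p : ℝ × ℝ ↦ (1 : ℝ) * exp (-(1 / 2) * p.2 ^ 2)) (m.prod volume) :=
      (integrable_const (1 : ℝ)).mul_prod (integrable_exp_neg_mul_sq (by norm_num))
    refine this.mono' (by fun_prop) (ae_of_all _ fun p ↦ ?_)
    simp only [Function.uncurry]
    rw [hnorm, one_mul]
  have hinner : ∀ u : ℝ, ∫ y, Complex.exp (Complex.I * ((x - y : ℝ) : ℂ) * u) *
      Complex.exp (-(1 / 2) * u ^ 2) ∂m =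
      Complex.exp (Complex.I * x * u) * ((exp (-(u ^ 2 / 2)) * f |u| : ℝ) : ℂ) := by
    intro u
    have h1 : ∀ y : ℝ, Complex.exp (Complex.I * ((x - y : ℝ) : ℂ) * u) *
        Complex.exp (-(1 / 2) * u ^ 2) = Complex.exp (Complex.I * x * u) *
          (exp (-(u ^ 2 / 2)) : ℝ) * Complex.exp ((-u : ℝ) * y * Complex.I) := by
      intro y
      rw [Complex.ofReal_exp, ← Complex.exp_add, ← Complex.exp_add, ← Complex.exp_add]
      congr 1
      push_cast
      ring
    simp_rw [h1]
    rw [integral_const_mul, ← charFun_apply_real, hm, abs_neg]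
    push_cast
    ring
  have hre : ∀ u : ℝ, (Complex.exp (Complex.I * x * u) *
      ((exp (-(u ^ 2 / 2)) * f |u| : ℝ) : ℂ)).re =
      (fun v ↦ cos (v * x) * (exp (-(v ^ 2 / 2)) * f v)) |u| := by
    intro u
    rw [Complex.re_mul_ofReal, show Complex.I * x * u = ((u * x : ℝ) : ℂ) * Complex.I by
      push_cast; ring, Complex.exp_ofReal_mul_I_re]
    simp only [sq_abs]
    congr 1
    rw [← cos_abs, ← cos_abs (|u| * x), abs_mul, abs_mul, abs_abs]
  have hint : Integrable fun u : ℝ ↦ Complex.exp (Complex.I * x * u) *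
      ((exp (-(u ^ 2 / 2)) * f |u| : ℝ) : ℂ) := by
    have hmeas : Measurable fun u : ℝ ↦ ((f |u| : ℝ) : ℂ) := by
      have : (fun u : ℝ ↦ ((f |u| : ℝ) : ℂ)) = charFun m := funext fun t ↦ (hm t).symm
      rw [this]
      exact measurable_charFun
    refine (integrable_exp_neg_mul_sq (b := 1 / 2) (by norm_num)).mono' ?_ (ae_of_all _ fun u ↦ ?_)
    · push_cast
      fun_prop
    · rw [norm_mul, show Complex.I * x * u = Complex.I * ((x * u : ℝ) : ℂ) by push_cast; ring,
        Complex.norm_exp_I_mul_ofReal, one_mul, Complex.ofReal_mul, norm_mul, ← hm,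
        Complex.norm_real, norm_eq_abs, abs_of_pos (exp_pos _),
        show -(1 / 2) * u ^ 2 = -(u ^ 2 / 2) by ring]
      exact mul_le_of_le_one_right (exp_pos _).le (norm_charFun_le_one _)
  have hC : ((∫ y, ProbabilityTheory.gaussianPDFReal 0 1 (x - y) ∂m : ℝ) : ℂ) =
      ((1 / (2 * π) : ℝ) : ℂ) * ∫ u : ℝ, Complex.exp (Complex.I * x * u) *
      ((exp (-(u ^ 2 / 2)) * f |u| : ℝ) : ℂ) := by
    rw [← integral_complex_ofReal]
    simp_rw [hφ]
    rw [integral_const_mul, hswap]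
    simp_rw [hinner]
    push_cast
    rfl
  have := congrArg Complex.re hC
  rw [Complex.ofReal_re, Complex.re_ofReal_mul] at this
  have hreint := (Complex.reCLM.integral_comp_comm hint)
  simp only [Complex.reCLM_apply] at hreint
  rw [this, ← hreint]
  rw [integral_congr_ae (ae_of_all _ hre),
    integral_comp_abs (f := fun v ↦ cos (v * x) * (exp (-(v ^ 2 / 2)) * f v))]
  rw [← mul_assoc]
  congr 1
  field_simp

theorem stableGaussDensity_zero (a x : ℝ) :
    stableGaussDensity a 0 x = ProbabilityTheory.gaussianPDFReal 0 1 x := by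
  have h := integral_gaussianPDFReal_sub (m := Measure.dirac 0) (f := fun _ ↦ 1) (by simp) x
  rw [integral_dirac, sub_zero] at h
  rw [h, stableGaussDensity]
  simp

/-- The function `stableGaussDensity a c` is the positive density of a probability measure whose
characteristic function is `exp (-u ^ 2 / 2 - c * |u| ^ a)`. -/
theorem stableGaussDensity_spec {a c : ℝ} (ha : 0 < a) (ha2 : a < 2) (hc : 0 < c) :
    (∀ x, 0 < stableGaussDensity a c x) ∧
    IsProbabilityMeasure (volume.withDensity fun x ↦ ENNReal.ofReal (stableGaussDensity a c x)) ∧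
    ∀ u, charFun (volume.withDensity fun x ↦ ENNReal.ofReal (stableGaussDensity a c x)) u =
      ((exp (-(u ^ 2 / 2) - c * |u| ^ a) : ℝ) : ℂ) := by
  obtain ⟨m, hmp, hm⟩ := exists_charFun_stable ha ha2 hc
  have hG : ∀ x, ∫ y, ProbabilityTheory.gaussianPDFReal 0 1 (x - y) ∂m =
      stableGaussDensity a c x := by
    intro x
    rw [integral_gaussianPDFReal_sub (f := fun u ↦ exp (-(c * u ^ a))) (fun t ↦ hm t),
      stableGaussDensity]
    simp_rw [← exp_add, ← sub_eq_add_neg]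
  have hint : ∀ x, Integrable (fun y ↦ ProbabilityTheory.gaussianPDFReal 0 1 (x - y)) m := by
    intro x
    refine (integrable_const ((√(2 * π * (1 : NNReal)))⁻¹)).mono'
      ((ProbabilityTheory.measurable_gaussianPDFReal 0 1).comp (by fun_prop)).aestronglyMeasurable
      (ae_of_all _ fun y ↦ ?_)
    rw [norm_eq_abs, abs_of_nonneg (ProbabilityTheory.gaussianPDFReal_nonneg _ _ _),
      ProbabilityTheory.gaussianPDFReal]
    refine mul_le_of_le_one_right (by positivity) (exp_le_one_iff.2 ?_)
    rw [neg_div, neg_nonpos]; positivity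
  have hpos : ∀ x, 0 < stableGaussDensity a c x := by
    intro x
    rw [← hG]
    rw [integral_pos_iff_support_of_nonneg
      (fun y ↦ ProbabilityTheory.gaussianPDFReal_nonneg _ _ _) (hint x)]
    have : Function.support (fun y ↦ ProbabilityTheory.gaussianPDFReal 0 1 (x - y)) = univ := by
      ext y
      simpa using (ProbabilityTheory.gaussianPDFReal_pos 0 1 (x - y) one_ne_zero).ne'
    rw [this, measure_univ]
    exact one_pos
  have hconv : volume.withDensity (fun x ↦ ENNReal.ofReal (stableGaussDensity a c x)) =
      (ProbabilityTheory.gaussianReal 0 1).conv m := by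
    refine Measure.ext_of_lintegral _ fun f hf ↦ ?_
    have hGm : Measurable fun x ↦ ENNReal.ofReal (stableGaussDensity a c x) :=
      (continuous_stableGaussDensity hc.le).measurable.ennreal_ofReal
    have hpdf := ProbabilityTheory.measurable_gaussianPDF 0 1
    rw [Measure.lintegral_conv hf, ProbabilityTheory.gaussianReal_of_var_ne_zero 0 one_ne_zero,
      lintegral_withDensity_eq_lintegral_mul _ hGm hf,
      lintegral_withDensity_eq_lintegral_mul _ hpdf (by fun_prop)]
    have h1 : ∀ x, (ProbabilityTheory.gaussianPDF 0 1 * fun x ↦ ∫⁻ y, f (x + y) ∂m) x =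
        ∫⁻ y, ProbabilityTheory.gaussianPDF 0 1 x * f (x + y) ∂m := by
      intro x
      rw [Pi.mul_apply, lintegral_const_mul _ (by fun_prop)]
    simp_rw [h1]
    rw [lintegral_lintegral_swap (by fun_prop)]
    have h2 : ∀ y, ∫⁻ x, ProbabilityTheory.gaussianPDF 0 1 x * f (x + y) =
        ∫⁻ x, ProbabilityTheory.gaussianPDF 0 1 (x - y) * f x := by
      intro y
      rw [← lintegral_add_right_eq_self (fun x ↦ ProbabilityTheory.gaussianPDF 0 1 (x - y) * f x) y]
      simp only [add_sub_cancel_right]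
    simp_rw [h2]
    rw [lintegral_lintegral_swap (by fun_prop)]
    refine lintegral_congr fun x ↦ ?_
    rw [lintegral_mul_const _ (by fun_prop), Pi.mul_apply, ← hG]
    congr 1
    rw [ofReal_integral_eq_lintegral_ofReal (hint x)
      (ae_of_all _ fun y ↦ ProbabilityTheory.gaussianPDFReal_nonneg _ _ _)]
    rfl
  refine ⟨hpos, hconv ▸ inferInstance, fun u ↦ ?_⟩
  rw [hconv, charFun_conv, hm, ProbabilityTheory.charFun_gaussianReal, Complex.ofReal_exp,
    Complex.ofReal_exp, ← Complex.exp_add]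
  congr 1
  push_cast
  simp
  ring

/-! ### Contour rotation for Fourier integrals -/

theorem integrable_exp_neg_half_abs : Integrable fun s : ℝ ↦ exp (-(|s| / 2)) := by
  refine integrable_comp_abs_of_integrableOn_Ioi (f := fun s ↦ exp (-(s / 2))) ?_
  refine (integrableOn_exp_mul_Ioi (show (-(1 / 2) : ℝ) < 0 by norm_num) 0).congr_fun
    (fun s _ ↦ ?_) measurableSet_Ioi
  ring_nf

/-- Shift of a horizontal line of integration for an entire function that decays exponentially in
a horizontal strip. -/
theorem integral_horizontal_shift {F : ℂ → ℂ} (hF : Differentiable ℂ F) {θ K : ℝ} (hθ : 0 ≤ θ)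
    (hb : ∀ s : ℝ, ∀ y ∈ Icc 0 θ, ‖F (s + y * Complex.I)‖ ≤ K * exp (-(|s| / 2))) :
    ∫ s : ℝ, F s = ∫ s : ℝ, F (s + θ * Complex.I) := by
  have hint : ∀ y ∈ Icc 0 θ, Integrable fun s : ℝ ↦ F (s + y * Complex.I) := by
    intro y hy
    refine (integrable_exp_neg_half_abs.const_mul K).mono' ?_ (ae_of_all _ fun s ↦ hb s y hy)
    have := hF.continuous
    exact Continuous.aestronglyMeasurable (by fun_prop)
  have h0 : ∀ s : ℝ, F (s + (0 : ℝ) * Complex.I) = F s := fun s ↦ by simp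
  have hi0 : Integrable fun s : ℝ ↦ F s := by
    have := hint 0 ⟨le_rfl, hθ⟩
    simpa only [h0] using this
  have hiθ := hint θ ⟨hθ, le_rfl⟩
  have hlim1 := intervalIntegral_tendsto_integral hi0 tendsto_neg_atTop_atBot tendsto_id
  have hlim2 := intervalIntegral_tendsto_integral hiθ tendsto_neg_atTop_atBot tendsto_id
  have hdecay : Tendsto (fun T : ℝ ↦ θ * K * exp (-(|T| / 2))) atTop (𝓝 0) := by
    have h1 : Tendsto (fun T : ℝ ↦ exp (-(|T| / 2))) atTop (𝓝 0) :=
      tendsto_exp_neg_atTop_nhds_zero.comp (tendsto_abs_atTop_atTop.atTop_div_const two_pos)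
    simpa using h1.const_mul (θ * K)
  have hvert : ∀ s : ℝ, ‖∫ y in (0 : ℝ)..θ, F (s + y * Complex.I)‖ ≤
      θ * K * exp (-(|s| / 2)) := by
    intro s
    have := intervalIntegral.norm_integral_le_of_norm_le_const (a := 0) (b := θ)
      (f := fun y : ℝ ↦ F (s + y * Complex.I)) (C := K * exp (-(|s| / 2))) (fun y hy ↦ by
        rw [uIoc_of_le hθ] at hy
        exact hb s y ⟨hy.1.le, hy.2⟩)
    rw [sub_zero, abs_of_nonneg hθ] at this
    linarith
  have hr : Tendsto (fun T : ℝ ↦ ∫ y in (0 : ℝ)..θ, F ((T : ℝ) + y * Complex.I)) atTop (𝓝 0) :=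
    squeeze_zero_norm hvert hdecay
  have hl : Tendsto (fun T : ℝ ↦ ∫ y in (0 : ℝ)..θ, F ((-T : ℝ) + y * Complex.I)) atTop (𝓝 0) :=
    squeeze_zero_norm (fun T ↦ hvert (-T)) (by simpa only [abs_neg] using hdecay)
  have hrect : ∀ T : ℝ, (∫ s in -T..T, F s) - (∫ s in -T..T, F (s + θ * Complex.I)) =
      Complex.I * (∫ y in (0 : ℝ)..θ, F ((-T : ℝ) + y * Complex.I)) -
      Complex.I * ∫ y in (0 : ℝ)..θ, F ((T : ℝ) + y * Complex.I) := by
    intro T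
    have := Complex.integral_boundary_rect_eq_zero_of_differentiableOn F
      ((-T : ℝ) : ℂ) (T + θ * Complex.I) hF.differentiableOn
    simp only [Complex.ofReal_re, Complex.ofReal_im, Complex.add_re, Complex.mul_re, Complex.I_re,
      mul_zero, Complex.I_im, mul_one, sub_self, add_zero, Complex.add_im, Complex.mul_im, zero_add,
      Complex.ofReal_zero, zero_mul, smul_eq_mul] at this
    linear_combination this
  have h1 := (hlim1.sub hlim2)
  have h2 := (hl.const_mul Complex.I).sub (hr.const_mul Complex.I)
  simp only [id, mul_zero, sub_zero] at h1 h2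
  exact sub_eq_zero.1 (tendsto_nhds_unique (h1.congr fun T ↦ hrect T) h2)

theorem norm_cexp_sub_one_le_norm {w : ℂ} (hw : w.re ≤ 0) : ‖Complex.exp w - 1‖ ≤ ‖w‖ := by
  have := (convex_halfSpace_re_le 0).norm_image_sub_le_of_norm_deriv_le (f := Complex.exp) (C := 1)
    (fun z _ ↦ Complex.differentiableAt_exp) (fun z hz ↦ by
      rw [Complex.deriv_exp, Complex.norm_exp]
      exact exp_le_one_iff.2 hz) (show (0 : ℂ) ∈ {z : ℂ | z.re ≤ 0} by simp)
      (show w ∈ {z : ℂ | z.re ≤ 0} from hw)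
  simpa using this

/-- A crude integrable majorant, used for every integral after the substitution `u = exp s`. The
constant is `2 ^ 7 * 7!`, from the seventh term of the exponential series. -/
theorem one_add_abs_mul_exp_le {p : ℝ} (hp : 1 ≤ p) (hp5 : p ≤ 5) (s : ℝ) :
    (1 + |s|) * (exp (p * s) * exp (-(exp s / 2))) ≤ 645120 * exp (-(|s| / 2)) := by
  rcases le_total s 0 with hs | hs
  · rw [abs_of_nonpos hs]
    have h1 : 1 + -s ≤ 2 * exp (-s / 2) := by linarith [add_one_le_exp (-s / 2)]
    have h2 : exp (p * s) ≤ exp s := exp_le_exp.2 (by nlinarith)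
    have h3 : exp (-(exp s / 2)) ≤ 1 := exp_le_one_iff.2 (by linarith [exp_pos s])
    calc (1 + -s) * (exp (p * s) * exp (-(exp s / 2)))
        ≤ (2 * exp (-s / 2)) * (exp s * 1) := by gcongr
      _ = 2 * exp (-(-s / 2)) := by rw [mul_one, mul_assoc, ← exp_add]; ring_nf
      _ ≤ 645120 * exp (-(-s / 2)) := by gcongr; norm_num
  · rw [abs_of_nonneg hs]
    have h1 : 1 + s ≤ exp s := by linarith [add_one_le_exp s]
    have h2 : exp (p * s) ≤ exp (5 * s) := exp_le_exp.2 (by nlinarith)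
    have h3 : (exp s / 2) ^ 7 / (Nat.factorial 7 : ℝ) ≤ exp (exp s / 2) :=
      pow_div_factorial_le_exp _ (by positivity) 7
    have h4 : exp (-(exp s / 2)) ≤ 645120 * exp (-(7 * s)) := by
      rw [exp_neg, inv_le_comm₀ (exp_pos _) (by positivity)]
      refine le_trans (le_of_eq ?_) h3
      rw [mul_inv, ← exp_neg, neg_neg, div_pow, ← exp_nat_mul]
      norm_num [Nat.factorial]
      ring
    calc (1 + s) * (exp (p * s) * exp (-(exp s / 2)))
        ≤ exp s * (exp (5 * s) * (645120 * exp (-(7 * s)))) := by gcongr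
      _ = 645120 * exp (-s) := by
        rw [show -s = s + (5 * s + -(7 * s)) by ring, exp_add, exp_add]; ring
      _ ≤ 645120 * exp (-(s / 2)) := by gcongr; linarith

theorem exp_mul_exp_le {p : ℝ} (hp : 1 ≤ p) (hp5 : p ≤ 5) (s : ℝ) :
    exp (p * s) * exp (-(exp s / 2)) ≤ 645120 * exp (-(|s| / 2)) := by
  refine le_trans ?_ (one_add_abs_mul_exp_le hp hp5 s)
  refine le_mul_of_one_le_left (by positivity) (by linarith [abs_nonneg s])

theorem integral_Ioi_eq_integral_exp {E : Type*} [NormedAddCommGroup E] [NormedSpace ℝ E]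
    (g : ℝ → E) : ∫ u in Ioi 0, g u = ∫ s, exp s • g (exp s) := by
  have := integral_image_eq_integral_abs_deriv_smul MeasurableSet.univ
      (fun x _ ↦ (hasDerivAt_exp x).hasDerivWithinAt) exp_injective.injOn g
  rw [image_univ, range_exp, Measure.restrict_univ] at this
  simpa [abs_of_pos (exp_pos _)] using this

/-- The integral of `exp (I u) u ^ a` over the ray `arg u = π / 6`, in the coordinate `u = exp z`.
Another rotation, to `arg u = π / 2`, makes it a Gamma integral. -/
theorem integral_ray_eq_Gamma {a : ℝ} (ha : 0 < a) (ha2 : a < 2) :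
    ∫ s : ℝ, Complex.exp (Complex.I * Complex.exp (s + (π / 6 : ℝ) * Complex.I)) *
      Complex.exp ((1 + a) * (s + (π / 6 : ℝ) * Complex.I)) =
      Complex.exp (((1 + a) * (π / 2) : ℝ) * Complex.I) * (Gamma (1 + a) : ℝ) := by
  set H : ℂ → ℂ := fun z ↦ Complex.exp (Complex.I * Complex.exp (z + (π / 6 : ℝ) * Complex.I)) *
      Complex.exp ((1 + a) * (z + (π / 6 : ℝ) * Complex.I)) with hH
  have hb : ∀ s : ℝ, ∀ y ∈ Icc 0 (π / 3), ‖H (s + y * Complex.I)‖ ≤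
      645120 * exp (-(|s| / 2)) := by
    intro s y hy
    have h1 : ‖H (s + y * Complex.I)‖ =
        exp ((1 + a) * s) * exp (-(exp s * sin (y + π / 6))) := by
      rw [hH]
      simp only
      rw [norm_mul, Complex.norm_exp, Complex.norm_exp, mul_comm]
      congr 2
      · simp
      · simp [Complex.exp_im]
    rw [h1]
    refine le_trans ?_ (exp_mul_exp_le (p := 1 + a) (by linarith) (by linarith) s)
    · gcongr
      have : 1 / 2 ≤ sin (y + π / 6) := by
        rw [← sin_pi_div_six]
        exact sin_le_sin_of_le_of_le_pi_div_two (by linarith [pi_pos]) (by linarith [hy.2])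
          (by linarith [hy.1])
      nlinarith [exp_pos s]
  have hd : Differentiable ℂ H := by fun_prop
  have := integral_horizontal_shift hd (by positivity) hb
  rw [this]
  have hI : ∀ s : ℝ, H (s + (π / 3 : ℝ) * Complex.I) =
      Complex.exp (((1 + a) * (π / 2) : ℝ) * Complex.I) *
        ((exp s * (exp (-exp s) * exp s ^ ((1 + a) - 1)) : ℝ) : ℂ) := by
    intro s
    rw [hH]
    simp only
    have e1 : (s : ℂ) + (π / 3 : ℝ) * Complex.I + (π / 6 : ℝ) * Complex.I =
        s + π / 2 * Complex.I := by push_cast; ring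
    rw [e1, Complex.exp_add, Complex.exp_pi_div_two_mul_I, add_sub_cancel_left,
      ← exp_mul, ← exp_add, ← exp_add, Complex.ofReal_exp, ← Complex.exp_add, ← Complex.exp_add]
    congr 1
    push_cast
    linear_combination Complex.exp s * Complex.I_mul_I
  simp_rw [hI]
  rw [integral_const_mul, integral_complex_ofReal, Gamma_eq_integral (by linarith),
    integral_Ioi_eq_integral_exp]
  simp only [smul_eq_mul]

/-! ### Derivatives of the density and their tails -/

/-- The derivative of `stableGaussDensity a c x` in the scale `c`. -/
noncomputable def stableGaussDerivScale (a c x : ℝ) : ℝ :=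
  -(1 / π) * ∫ u in Ioi 0, cos (u * x) * (u ^ a * exp (-(u ^ 2 / 2) - c * u ^ a))

/-- The derivative of `stableGaussDensity a c x` in the index `a`, divided by `c`. -/
noncomputable def stableGaussDerivIndex (a c x : ℝ) : ℝ :=
  -(1 / π) * ∫ u in Ioi 0, cos (u * x) * (u ^ a * log u * exp (-(u ^ 2 / 2) - c * u ^ a))

/-- The integrand of `stableGaussDerivScale`, after the substitution `u = exp z`. Unlike
`u ^ a`, it is an entire function. -/
noncomputable def expIntegrand (a c x : ℝ) (z : ℂ) : ℂ :=
  Complex.exp (Complex.I * x * Complex.exp z) * Complex.exp ((1 + a) * z) *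
    Complex.exp (-(Complex.exp (2 * z) / 2) - c * Complex.exp (a * z))

theorem differentiable_expIntegrand (a c x : ℝ) : Differentiable ℂ (expIntegrand a c x) := by
  unfold expIntegrand; fun_prop

/-- The bound holds in the strip `0 ≤ Im z ≤ π / 6`, where `Im exp z`, `Re exp (2 * z)` and
`Re exp (a * z)` are all nonnegative. -/
theorem norm_expIntegrand_le {a c x : ℝ} (ha : 0 < a) (ha2 : a < 2) (hc : 0 ≤ c) (hx : 0 ≤ x)
    (s : ℝ) {y : ℝ} (hy : y ∈ Icc 0 (π / 6)) :
    (1 + |s|) * ‖expIntegrand a c x (s + y * Complex.I)‖ ≤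
      2 * 645120 * exp (-(|s| / 2)) := by
  have hpi := pi_pos
  obtain ⟨hy0, hy1⟩ := hy
  have h1 : ‖expIntegrand a c x (s + y * Complex.I)‖ =
      exp (-(x * (exp s * sin y))) * exp ((1 + a) * s) *
        exp (-(exp (2 * s) * cos (2 * y) / 2) - c * (exp (a * s) * cos (a * y))) := by
    rw [expIntegrand, norm_mul, norm_mul, Complex.norm_exp, Complex.norm_exp, Complex.norm_exp]
    congr 3
    · simp [Complex.exp_im]
    · simp
    · simp [Complex.exp_re]
  have hs : 0 ≤ sin y := sin_nonneg_of_nonneg_of_le_pi hy0 (by linarith)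
  have hc1 : 1 / 2 ≤ cos (2 * y) := by
    rw [← cos_pi_div_three]
    exact cos_le_cos_of_nonneg_of_le_pi (by linarith) (by linarith) (by linarith)
  have hc2 : 0 ≤ cos (a * y) := cos_nonneg_of_neg_pi_div_two_le_of_le (by nlinarith) (by nlinarith)
  have h2 : exp (-(x * (exp s * sin y))) ≤ 1 := exp_le_one_iff.2 (by
    have : 0 ≤ x * (exp s * sin y) := by positivity
    linarith)
  have h3 : exp (-(exp (2 * s) * cos (2 * y) / 2) - c * (exp (a * s) * cos (a * y))) ≤
      2 * exp (-(exp s / 2)) := by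
    have h4 : (2 : ℝ) ≥ exp (1 / 4) := by
      have := exp_bound_div_one_sub_of_interval (x := 1 / 4) (by norm_num) (by norm_num)
      norm_num at this ⊢
      linarith
    have h5 : 0 ≤ c * (exp (a * s) * cos (a * y)) := by positivity
    have h6 : exp (2 * s) = exp s ^ 2 := by rw [two_mul, exp_add]; ring
    calc _ ≤ exp (1 / 4 + -(exp s / 2)) := by
          refine exp_le_exp.2 ?_
          rw [h6]
          nlinarith [sq_nonneg (exp s - 1), mul_le_mul_of_nonneg_left hc1 (sq_nonneg (exp s))]
      _ = exp (1 / 4) * exp (-(exp s / 2)) := exp_add _ _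
      _ ≤ _ := by gcongr
  rw [h1]
  calc _ ≤ (1 + |s|) * (1 * exp ((1 + a) * s) * (2 * exp (-(exp s / 2)))) := by gcongr
    _ = 2 * ((1 + |s|) * (exp ((1 + a) * s) * exp (-(exp s / 2)))) := by ring
    _ ≤ 2 * (645120 * exp (-(|s| / 2))) := mul_le_mul_of_nonneg_left
      (one_add_abs_mul_exp_le (p := 1 + a) (by linarith) (by linarith) s) two_pos.le
    _ = _ := by ring

theorem norm_expIntegrand_le' {a c x : ℝ} (ha : 0 < a) (ha2 : a < 2) (hc : 0 ≤ c) (hx : 0 ≤ x)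
    (s : ℝ) {y : ℝ} (hy : y ∈ Icc 0 (π / 6)) :
    ‖expIntegrand a c x (s + y * Complex.I)‖ ≤ 2 * 645120 * exp (-(|s| / 2)) :=
  (le_mul_of_one_le_left (norm_nonneg _) (by linarith [abs_nonneg s])).trans
    (norm_expIntegrand_le ha ha2 hc hx s hy)

theorem norm_expIntegrand_mul_le {a c x : ℝ} (ha : 0 < a) (ha2 : a < 2) (hc : 0 ≤ c) (hx : 0 ≤ x)
    (s : ℝ) {y : ℝ} (hy : y ∈ Icc 0 (π / 6)) :
    ‖expIntegrand a c x (s + y * Complex.I) * (s + y * Complex.I)‖ ≤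
      2 * 645120 * exp (-(|s| / 2)) := by
  refine le_trans ?_ (norm_expIntegrand_le ha ha2 hc hx s hy)
  rw [norm_mul, mul_comm]
  gcongr
  refine (norm_add_le _ _).trans ?_
  rw [norm_mul, Complex.norm_I, mul_one, Complex.norm_real, Complex.norm_real, norm_eq_abs,
    norm_eq_abs, abs_of_nonneg hy.1, add_comm]
  gcongr
  linarith [hy.2, pi_le_four]

theorem integrable_expIntegrand_mul {a c x : ℝ} (ha : 0 < a) (ha2 : a < 2) (hc : 0 ≤ c)
    (hx : 0 ≤ x) : Integrable fun s : ℝ ↦ expIntegrand a c x s * s := by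
  have := (differentiable_expIntegrand a c x).continuous
  refine (integrable_exp_neg_half_abs.const_mul (2 * 645120)).mono'
    (Continuous.aestronglyMeasurable (by fun_prop)) (ae_of_all _ fun s ↦ ?_)
  simpa using norm_expIntegrand_mul_le ha ha2 hc hx s (y := 0) ⟨le_rfl, by positivity⟩

theorem integrable_expIntegrand {a c x : ℝ} (ha : 0 < a) (ha2 : a < 2) (hc : 0 ≤ c)
    (hx : 0 ≤ x) : Integrable fun s : ℝ ↦ expIntegrand a c x s := by
  have := (differentiable_expIntegrand a c x).continuous
  refine (integrable_exp_neg_half_abs.const_mul (2 * 645120)).mono'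
    (Continuous.aestronglyMeasurable (by fun_prop)) (ae_of_all _ fun s ↦ ?_)
  simpa using norm_expIntegrand_le' ha ha2 hc hx s (y := 0) ⟨le_rfl, by positivity⟩

theorem expIntegrand_re (a c x s : ℝ) : (expIntegrand a c x s).re =
    exp s * (cos (exp s * x) * (exp s ^ a * exp (-(exp s ^ 2 / 2) - c * exp s ^ a))) := by
  have h : expIntegrand a c x s = Complex.exp (((exp s * x : ℝ) : ℂ) * Complex.I) *
      ((exp s * (exp s ^ a * exp (-(exp s ^ 2 / 2) - c * exp s ^ a)) : ℝ) : ℂ) := by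
    rw [expIntegrand, mul_assoc, ← exp_mul, ← exp_nat_mul]
    push_cast
    simp only [← Complex.exp_add]
    congr 1
    ring_nf
  rw [h, Complex.re_mul_ofReal, Complex.exp_ofReal_mul_I_re]
  ring

/-- The Fourier integral, moved to the ray `arg u = π / 6`. -/
theorem stableGaussDerivScale_eq {a c x : ℝ} (ha : 0 < a) (ha2 : a < 2) (hc : 0 ≤ c)
    (hx : 0 ≤ x) : stableGaussDerivScale a c x =
      -(1 / π) * (∫ s : ℝ, expIntegrand a c x (s + (π / 6 : ℝ) * Complex.I)).re := by
  rw [← integral_horizontal_shift (differentiable_expIntegrand a c x) (by positivity)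
    fun s y hy ↦ norm_expIntegrand_le' ha ha2 hc hx s hy, stableGaussDerivScale,
    integral_Ioi_eq_integral_exp]
  have := Complex.reCLM.integral_comp_comm (integrable_expIntegrand ha ha2 hc hx)
  simp only [Complex.reCLM_apply] at this
  rw [← this]
  simp_rw [expIntegrand_re, smul_eq_mul]

theorem stableGaussDerivIndex_eq {a c x : ℝ} (ha : 0 < a) (ha2 : a < 2) (hc : 0 ≤ c)
    (hx : 0 ≤ x) : stableGaussDerivIndex a c x =
      -(1 / π) * (∫ s : ℝ, expIntegrand a c x (s + (π / 6 : ℝ) * Complex.I) *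
        (s + (π / 6 : ℝ) * Complex.I)).re := by
  rw [← integral_horizontal_shift (F := fun z ↦ expIntegrand a c x z * z)
    ((differentiable_expIntegrand a c x).mul differentiable_id) (by positivity)
    fun s y hy ↦ norm_expIntegrand_mul_le ha ha2 hc hx s hy, stableGaussDerivIndex,
    integral_Ioi_eq_integral_exp]
  have := Complex.reCLM.integral_comp_comm (integrable_expIntegrand_mul ha ha2 hc hx)
  simp only [Complex.reCLM_apply] at this
  rw [← this]
  simp_rw [Complex.re_mul_ofReal, expIntegrand_re, smul_eq_mul, log_exp]
  congr 2
  ext s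
  ring

/-- The limit of the rescaled integrand on the line `Im z = π / 6`. -/
noncomputable def rayLimit (a : ℝ) (s : ℝ) : ℂ :=
  Complex.exp (Complex.I * Complex.exp (s + (π / 6 : ℝ) * Complex.I)) *
    Complex.exp ((1 + a) * (s + (π / 6 : ℝ) * Complex.I))

theorem norm_rayLimit (a s : ℝ) :
    ‖rayLimit a s‖ = exp ((1 + a) * s) * exp (-(exp s / 2)) := by
  rw [rayLimit, norm_mul, Complex.norm_exp, Complex.norm_exp, mul_comm]
  congr 2
  · simp
  · simp [Complex.exp_im]
    ring

theorem continuous_rayLimit (a : ℝ) : Continuous (rayLimit a) := by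
  unfold rayLimit; fun_prop

/-- Scaling: after translation by `log x`, the integrand is a perturbation of its limit. -/
theorem expIntegrand_sub_log {a c x : ℝ} (hx : 0 < x) (s : ℝ) :
    ((x ^ (1 + a) : ℝ) : ℂ) * expIntegrand a c x ((s - log x : ℝ) + (π / 6 : ℝ) * Complex.I) =
      rayLimit a s * Complex.exp (-(((x ^ (-2 : ℝ) : ℝ) : ℂ) *
        (Complex.exp (2 * (s + (π / 6 : ℝ) * Complex.I)) / 2) + ((c * x ^ (-a) : ℝ) : ℂ) *
          Complex.exp (a * (s + (π / 6 : ℝ) * Complex.I)))) := by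
  have hxe : (x : ℂ) = Complex.exp (log x) := by rw [← Complex.ofReal_exp, exp_log hx]
  have hp : ∀ p : ℝ, ((x ^ p : ℝ) : ℂ) = Complex.exp (log x * p) := fun p ↦ by
    rw [rpow_def_of_pos hx, Complex.ofReal_exp]; push_cast; rfl
  have e1 : Complex.I * x * Complex.exp ((s - log x : ℝ) + (π / 6 : ℝ) * Complex.I) =
      Complex.I * Complex.exp (s + (π / 6 : ℝ) * Complex.I) := by
    rw [hxe, mul_assoc, ← Complex.exp_add]
    push_cast; ring_nf
  have e2 : Complex.exp (2 * ((s - log x : ℝ) + (π / 6 : ℝ) * Complex.I)) =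
      ((x ^ (-2 : ℝ) : ℝ) : ℂ) * Complex.exp (2 * (s + (π / 6 : ℝ) * Complex.I)) := by
    rw [hp, ← Complex.exp_add]; push_cast; ring_nf
  have e3 : Complex.exp (a * ((s - log x : ℝ) + (π / 6 : ℝ) * Complex.I)) =
      ((x ^ (-a) : ℝ) : ℂ) * Complex.exp (a * (s + (π / 6 : ℝ) * Complex.I)) := by
    rw [hp, ← Complex.exp_add]; push_cast; ring_nf
  have e4 : ((x ^ (1 + a) : ℝ) : ℂ) *
      Complex.exp ((1 + a) * ((s - log x : ℝ) + (π / 6 : ℝ) * Complex.I)) =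
      Complex.exp ((1 + a) * (s + (π / 6 : ℝ) * Complex.I)) := by
    rw [hp, ← Complex.exp_add]; push_cast; ring_nf
  rw [expIntegrand, rayLimit, e1, e2, e3, ← e4]
  push_cast
  ring_nf

theorem rayPerturbation_re_nonpos {a : ℝ} (ha : 0 < a) (ha2 : a < 2) {p q : ℝ} (hp : 0 ≤ p)
    (hq : 0 ≤ q) (s : ℝ) :
    (-((p : ℂ) * (Complex.exp (2 * (s + (π / 6 : ℝ) * Complex.I)) / 2) + (q : ℂ) *
          Complex.exp (a * (s + (π / 6 : ℝ) * Complex.I)))).re ≤ 0 := by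
  have hpi := pi_pos
  have hc1 : 0 ≤ cos (2 * (π / 6)) :=
    cos_nonneg_of_neg_pi_div_two_le_of_le (by linarith) (by linarith)
  have hc2 : 0 ≤ cos (a * (π / 6)) :=
    cos_nonneg_of_neg_pi_div_two_le_of_le (by nlinarith) (by nlinarith)
  have : (-((p : ℂ) * (Complex.exp (2 * (s + (π / 6 : ℝ) * Complex.I)) / 2) + (q : ℂ) *
      Complex.exp (a * (s + (π / 6 : ℝ) * Complex.I)))).re =
      -(p * (exp (2 * s) * cos (2 * (π / 6)) / 2) + q * (exp (a * s) * cos (a * (π / 6)))) := by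
    rw [Complex.neg_re, Complex.add_re, Complex.re_ofReal_mul, Complex.re_ofReal_mul]
    simp [Complex.exp_re]
  rw [this, neg_nonpos]
  positivity

/-- The constant of the Lévy density, after scaling its exponent to `|u| ^ a`. -/
theorem integral_rayLimit {a : ℝ} (ha : 0 < a) (ha2 : a < 2) :
    -(1 / π) * (∫ s, rayLimit a s).re = a / stableConst a := by
  have h := integral_ray_eq_Gamma ha ha2
  simp only [rayLimit]
  rw [h, Complex.re_mul_ofReal, Complex.exp_ofReal_mul_I_re,
    show (1 + a) * (π / 2) = π * a / 2 + π / 2 by ring, cos_add_pi_div_two, stableConst]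
  have hG := Gamma_pos_of_pos (show 0 < 1 + a by linarith)
  have := sin_pi_mul_half_pos ha ha2
  field_simp

/-- The tail of the derivative in the scale is that of the Lévy density, uniformly in the scale. -/
theorem exists_stableGaussDerivScale_tail {a : ℝ} (ha : 0 < a) (ha2 : a < 2) :
    ∃ D, 0 < D ∧ ∀ c x, 0 ≤ c → 0 < x →
      |stableGaussDerivScale a c x * x ^ (1 + a) - a / stableConst a| ≤
        D * (x ^ (-2 : ℝ) + c * x ^ (-a)) := by
  set W : ℝ := ∫ s : ℝ, exp (-(|s| / 2)) with hW
  have hW0 : 0 ≤ W := integral_nonneg fun s ↦ (exp_pos _).le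
  refine ⟨(1 / π) * (645120 * W) + 1, by positivity, fun c x hc hx ↦ ?_⟩
  set Q : ℝ → ℂ := fun s ↦ -(((x ^ (-2 : ℝ) : ℝ) : ℂ) *
        (Complex.exp (2 * (s + (π / 6 : ℝ) * Complex.I)) / 2) + ((c * x ^ (-a) : ℝ) : ℂ) *
          Complex.exp (a * (s + (π / 6 : ℝ) * Complex.I))) with hQ
  have hQc : Continuous Q := by fun_prop
  have hQre : ∀ s, (Q s).re ≤ 0 := fun s ↦
    rayPerturbation_re_nonpos ha ha2 (by positivity) (by positivity) s
  have hQn : ∀ s, ‖Q s‖ ≤ x ^ (-2 : ℝ) * exp (2 * s) + c * x ^ (-a) * exp (a * s) := by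
    intro s
    simp only [hQ, norm_neg]
    refine (norm_add_le _ _).trans ?_
    rw [norm_mul, norm_mul, norm_div, Complex.norm_real, Complex.norm_real, Complex.norm_exp,
      Complex.norm_exp, norm_eq_abs, norm_eq_abs, abs_of_nonneg (by positivity),
      abs_of_nonneg (by positivity)]
    simp
    gcongr
    linarith [exp_pos (2 * s)]
  have hlim : Integrable (rayLimit a) := by
    refine (integrable_exp_neg_half_abs.const_mul 645120).mono'
      (continuous_rayLimit a).aestronglyMeasurable (ae_of_all _ fun s ↦ ?_)
    rw [norm_rayLimit]
    exact exp_mul_exp_le (by linarith) (by linarith) s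
  have hlimQ : Integrable fun s ↦ rayLimit a s * Complex.exp (Q s) := by
    refine hlim.norm.mono' ((continuous_rayLimit a).mul (by fun_prop)).aestronglyMeasurable
      (ae_of_all _ fun s ↦ ?_)
    rw [norm_mul, Complex.norm_exp]
    exact mul_le_of_le_one_right (norm_nonneg _) (exp_le_one_iff.2 (hQre s))
  have hmain : ((x ^ (1 + a) : ℝ) : ℂ) *
      (∫ s : ℝ, expIntegrand a c x (s + (π / 6 : ℝ) * Complex.I)) =
      ∫ s, rayLimit a s * Complex.exp (Q s) := by
    rw [← integral_sub_right_eq_self _ (log x), ← integral_const_mul]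
    exact integral_congr_ae (ae_of_all _ fun s ↦ expIntegrand_sub_log hx s)
  have hdiff : ‖(∫ s, rayLimit a s * Complex.exp (Q s)) - ∫ s, rayLimit a s‖ ≤
      645120 * (x ^ (-2 : ℝ) + c * x ^ (-a)) * W := by
    rw [← integral_sub hlimQ hlim, hW, ← integral_const_mul]
    refine norm_integral_le_of_norm_le (integrable_exp_neg_half_abs.const_mul _)
      (ae_of_all _ fun s ↦ ?_)
    rw [show rayLimit a s * Complex.exp (Q s) - rayLimit a s =
      rayLimit a s * (Complex.exp (Q s) - 1) by ring, norm_mul, norm_rayLimit]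
    have h1 : exp ((1 + a) * s) * exp (-(exp s / 2)) * exp (2 * s) ≤
        645120 * exp (-(|s| / 2)) := by
      refine le_trans (le_of_eq ?_) (exp_mul_exp_le (p := 3 + a) (by linarith) (by linarith) s)
      rw [mul_right_comm, ← exp_add]; ring_nf
    have h2 : exp ((1 + a) * s) * exp (-(exp s / 2)) * exp (a * s) ≤
        645120 * exp (-(|s| / 2)) := by
      refine le_trans (le_of_eq ?_) (exp_mul_exp_le (p := 1 + 2 * a) (by linarith) (by linarith) s)
      rw [mul_right_comm, ← exp_add]; ring_nf
    calc _ ≤ exp ((1 + a) * s) * exp (-(exp s / 2)) *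
          (x ^ (-2 : ℝ) * exp (2 * s) + c * x ^ (-a) * exp (a * s)) := by
          gcongr
          exact (norm_cexp_sub_one_le_norm (hQre s)).trans (hQn s)
      _ = x ^ (-2 : ℝ) * (exp ((1 + a) * s) * exp (-(exp s / 2)) * exp (2 * s)) +
          c * x ^ (-a) * (exp ((1 + a) * s) * exp (-(exp s / 2)) * exp (a * s)) := by ring
      _ ≤ x ^ (-2 : ℝ) * (645120 * exp (-(|s| / 2))) +
          c * x ^ (-a) * (645120 * exp (-(|s| / 2))) := by gcongr
      _ = _ := by ring
  have hA : stableGaussDerivScale a c x * x ^ (1 + a) - a / stableConst a =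
      -(1 / π) * ((∫ s, rayLimit a s * Complex.exp (Q s)) - ∫ s, rayLimit a s).re := by
    rw [stableGaussDerivScale_eq ha ha2 hc hx.le, ← integral_rayLimit ha ha2, ← hmain,
      Complex.sub_re, Complex.re_ofReal_mul]
    ring
  rw [hA, abs_mul, abs_neg, abs_of_pos (show 0 < 1 / π by positivity)]
  calc _ ≤ 1 / π * (645120 * (x ^ (-2 : ℝ) + c * x ^ (-a)) * W) := by
        gcongr
        exact (Complex.abs_re_le_norm _).trans hdiff
    _ ≤ _ := by
        have : 0 ≤ x ^ (-2 : ℝ) + c * x ^ (-a) := by positivity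
        nlinarith

/-- On the ray, the logarithm in the integrand costs a factor `1 + |log x|`. -/
theorem exists_stableGaussDerivIndex_tail {a : ℝ} (ha : 0 < a) (ha2 : a < 2) :
    ∃ D, 0 < D ∧ ∀ c x, 0 ≤ c → 0 < x →
      |stableGaussDerivIndex a c x| * x ^ (1 + a) ≤ D * (1 + |log x|) := by
  set W : ℝ := ∫ s : ℝ, exp (-(|s| / 2)) with hW
  have hW0 : 0 ≤ W := integral_nonneg fun s ↦ (exp_pos _).le
  refine ⟨(1 / π) * (645120 * W) + 1, by positivity, fun c x hc hx ↦ ?_⟩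
  have hmain : ‖((x ^ (1 + a) : ℝ) : ℂ) *
      (∫ s : ℝ, expIntegrand a c x (s + (π / 6 : ℝ) * Complex.I) *
        (s + (π / 6 : ℝ) * Complex.I))‖ ≤ 645120 * (1 + |log x|) * W := by
    rw [← integral_sub_right_eq_self _ (log x), ← integral_const_mul, hW, ← integral_const_mul]
    refine norm_integral_le_of_norm_le (integrable_exp_neg_half_abs.const_mul _)
      (ae_of_all _ fun s ↦ ?_)
    rw [← mul_assoc, expIntegrand_sub_log hx, norm_mul, norm_mul, norm_rayLimit, Complex.norm_exp]
    have h1 : ‖((s - log x : ℝ) : ℂ) + (π / 6 : ℝ) * Complex.I‖ ≤ (1 + |s|) * (1 + |log x|) := by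
      refine (norm_add_le _ _).trans ?_
      rw [norm_mul, Complex.norm_I, mul_one, Complex.norm_real, Complex.norm_real, norm_eq_abs,
        norm_eq_abs, abs_of_nonneg (show 0 ≤ π / 6 by positivity)]
      have := abs_sub s (log x)
      nlinarith [pi_le_four, mul_nonneg (abs_nonneg s) (abs_nonneg (log x))]
    have h2 : exp ((-(((x ^ (-2 : ℝ) : ℝ) : ℂ) *
        (Complex.exp (2 * (s + (π / 6 : ℝ) * Complex.I)) / 2) + ((c * x ^ (-a) : ℝ) : ℂ) *
          Complex.exp (a * (s + (π / 6 : ℝ) * Complex.I)))).re) ≤ 1 :=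
      exp_le_one_iff.2 (rayPerturbation_re_nonpos ha ha2 (by positivity) (by positivity) s)
    calc _ ≤ exp ((1 + a) * s) * exp (-(exp s / 2)) * 1 * ((1 + |s|) * (1 + |log x|)) := by
          gcongr
      _ = (1 + |s|) * (exp ((1 + a) * s) * exp (-(exp s / 2))) * (1 + |log x|) := by ring
      _ ≤ 645120 * exp (-(|s| / 2)) * (1 + |log x|) := mul_le_mul_of_nonneg_right
          (one_add_abs_mul_exp_le (p := 1 + a) (by linarith) (by linarith) s) (by positivity)
      _ = _ := by ring
  have hx' : 0 ≤ x ^ (1 + a) := by positivity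
  have hB : |stableGaussDerivIndex a c x| * x ^ (1 + a) = 1 / π * |(((x ^ (1 + a) : ℝ) : ℂ) *
      (∫ s : ℝ, expIntegrand a c x (s + (π / 6 : ℝ) * Complex.I) *
        (s + (π / 6 : ℝ) * Complex.I))).re| := by
    rw [stableGaussDerivIndex_eq ha ha2 hc hx.le, Complex.re_ofReal_mul, abs_mul, abs_mul, abs_neg,
      abs_of_pos (show 0 < 1 / π by positivity), abs_of_nonneg hx']
    ring
  rw [hB]
  calc _ ≤ 1 / π * (645120 * (1 + |log x|) * W) := by
        gcongr
        exact (Complex.abs_re_le_norm _).trans hmain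
    _ ≤ _ := by
        nlinarith [abs_nonneg (log x)]

/-! ### Differentiability in scale and index -/

theorem integrableOn_cubic_mul_exp (C : ℝ) :
    IntegrableOn (fun u : ℝ ↦ (C + u ^ 2 + u ^ 3) * exp (-(u ^ 2 / 2))) (Ioi 0) := by
  have h2 := integrableOn_rpow_mul_exp_neg_sq_half (b := (2 : ℕ)) (by norm_num)
  have h3 := integrableOn_rpow_mul_exp_neg_sq_half (b := (3 : ℕ)) (by norm_num)
  simp_rw [rpow_natCast] at h2 h3
  refine (((integrableOn_exp_neg_sq_half.const_mul C).add h2).add h3).congr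
    (ae_of_all _ fun u ↦ ?_)
  simp only [Pi.add_apply]
  ring

/-- A majorant that is uniform for indices `b` between `a / 2` and `2`. -/
theorem rpow_le_cubic {a b u : ℝ} (ha : 0 < a) (hab : a / 2 ≤ b) (hb2 : b ≤ 2) (hu : 0 < u) :
    u ^ b ≤ 1 + 2 / a + u ^ 2 + u ^ 3 := by
  have : 0 < 2 / a := by positivity
  have h3 : 0 < u ^ 3 := by positivity
  rcases le_total u 1 with h | h
  · have := rpow_le_one hu.le h (show 0 ≤ b by linarith)
    nlinarith [sq_nonneg u]
  · have h1 := rpow_le_rpow_of_exponent_le h hb2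
    rw [rpow_two] at h1
    linarith

theorem rpow_mul_log_le_cubic {a b u : ℝ} (ha : 0 < a) (hab : a / 2 ≤ b) (hb2 : b ≤ 2)
    (hu : 0 < u) : |u ^ b * log u| ≤ 1 + 2 / a + u ^ 2 + u ^ 3 := by
  have h0 : 0 < 2 / a := by positivity
  have h3 : 0 < u ^ 3 := by positivity
  rcases le_total u 1 with h | h
  · have h1 := abs_log_mul_self_rpow_lt u b hu h (by linarith)
    have h2 : 1 / b ≤ 2 / a := by
      rw [div_le_div_iff₀ (by linarith) ha]; linarith
    rw [mul_comm]
    nlinarith [sq_nonneg u]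
  · have h1 := rpow_le_rpow_of_exponent_le h hb2
    rw [rpow_two] at h1
    have h2 : log u ≤ u := (log_le_sub_one_of_pos hu).trans (by linarith)
    have h4 : 0 ≤ log u := log_nonneg h
    rw [abs_mul, abs_of_nonneg (rpow_nonneg hu.le _), abs_of_nonneg h4]
    calc _ ≤ u ^ 2 * u := by gcongr
      _ ≤ _ := by nlinarith [sq_nonneg u]

theorem norm_derivScale_integrand_le {a b c u x : ℝ} (ha : 0 < a) (hab : a / 2 ≤ b) (hb2 : b ≤ 2)
    (hc : 0 ≤ c) (hu : 0 < u) : ‖cos (u * x) * (u ^ b * exp (-(u ^ 2 / 2) - c * u ^ b))‖ ≤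
      (1 + 2 / a + u ^ 2 + u ^ 3) * exp (-(u ^ 2 / 2)) := by
  rw [mul_left_comm, norm_mul, norm_eq_abs, abs_of_nonneg (rpow_nonneg hu.le _)]
  exact mul_le_mul (rpow_le_cubic ha hab hb2 hu) (norm_cos_mul_exp_le hc hu.le) (norm_nonneg _)
    (by positivity)

theorem norm_derivIndex_integrand_le {a b c u x : ℝ} (ha : 0 < a) (hab : a / 2 ≤ b) (hb2 : b ≤ 2)
    (hc : 0 ≤ c) (hu : 0 < u) :
    ‖cos (u * x) * (u ^ b * log u * exp (-(u ^ 2 / 2) - c * u ^ b))‖ ≤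
      (1 + 2 / a + u ^ 2 + u ^ 3) * exp (-(u ^ 2 / 2)) := by
  rw [mul_left_comm, norm_mul, norm_eq_abs]
  exact mul_le_mul (rpow_mul_log_le_cubic ha hab hb2 hu) (norm_cos_mul_exp_le hc hu.le)
    (norm_nonneg _) (by positivity)

theorem integrableOn_derivScale_integrand {a c : ℝ} (ha : 0 < a) (ha2 : a < 2) (hc : 0 ≤ c)
    (x : ℝ) : IntegrableOn (fun u ↦ cos (u * x) * (u ^ a * exp (-(u ^ 2 / 2) - c * u ^ a)))
      (Ioi 0) := by
  refine (integrableOn_cubic_mul_exp (1 + 2 / a)).mono' (by fun_prop) ?_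
  filter_upwards [self_mem_ae_restrict measurableSet_Ioi] with u hu
  exact norm_derivScale_integrand_le ha (by linarith) ha2.le hc hu

theorem integrableOn_derivIndex_integrand {a c : ℝ} (ha : 0 < a) (ha2 : a < 2) (hc : 0 ≤ c)
    (x : ℝ) : IntegrableOn (fun u ↦ cos (u * x) * (u ^ a * log u * exp (-(u ^ 2 / 2) - c * u ^ a)))
      (Ioi 0) := by
  refine (integrableOn_cubic_mul_exp (1 + 2 / a)).mono' (by fun_prop) ?_
  filter_upwards [self_mem_ae_restrict measurableSet_Ioi] with u hu
  exact norm_derivIndex_integrand_le ha (by linarith) ha2.le hc hu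

/-- Joint differentiability of the density in the index and the scale. -/
theorem hasFDerivAt_stableGaussDensity {a c : ℝ} (ha : 0 < a) (ha2 : a < 2) (hc : 0 < c) (x : ℝ) :
    HasFDerivAt (fun p : ℝ × ℝ ↦ stableGaussDensity p.1 p.2 x)
      (stableGaussDerivScale a c x • ContinuousLinearMap.snd ℝ ℝ ℝ +
        (c * stableGaussDerivIndex a c x) • ContinuousLinearMap.fst ℝ ℝ ℝ) (a, c) := by
  set f : ℝ × ℝ → ℝ → ℝ := fun p u ↦
    cos (u * x) * (u ^ p.1 * exp (-(u ^ 2 / 2) - p.2 * u ^ p.1)) with hf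
  set g : ℝ × ℝ → ℝ → ℝ := fun p u ↦
    cos (u * x) * (u ^ p.1 * log u * exp (-(u ^ 2 / 2) - p.2 * u ^ p.1)) with hg
  set F' : ℝ × ℝ → ℝ → (ℝ × ℝ →L[ℝ] ℝ) := fun p u ↦
    (-f p u) • ContinuousLinearMap.snd ℝ ℝ ℝ + (-(p.2 * g p u)) • ContinuousLinearMap.fst ℝ ℝ ℝ
    with hF'
  have hfi := integrableOn_derivScale_integrand ha ha2 hc.le x
  have hgi := integrableOn_derivIndex_integrand ha ha2 hc.le x
  have hF1 : Integrable (fun u ↦ (-f (a, c) u) • ContinuousLinearMap.snd ℝ ℝ ℝ)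
      (volume.restrict (Ioi 0)) := Integrable.smul_const hfi.neg _
  have hF2 : Integrable (fun u ↦ (-(c * g (a, c) u)) • ContinuousLinearMap.fst ℝ ℝ ℝ)
      (volume.restrict (Ioi 0)) := Integrable.smul_const (hgi.const_mul c).neg _
  have hFint : IntegrableOn (fun u ↦ cos (u * x) * exp (-(u ^ 2 / 2) - c * u ^ a)) (Ioi 0) := by
    refine integrableOn_exp_neg_sq_half.mono' (by fun_prop) ?_
    filter_upwards [self_mem_ae_restrict measurableSet_Ioi] with u hu
    exact norm_cos_mul_exp_le hc.le (le_of_lt hu)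
  have hs : Ioo (a / 2) 2 ×ˢ Ioo 0 (2 * c) ∈ 𝓝 (a, c) :=
    prod_mem_nhds (Ioo_mem_nhds (by linarith) ha2) (Ioo_mem_nhds hc (by linarith))
  have key : HasFDerivAt (fun p : ℝ × ℝ ↦
      ∫ u in Ioi 0, cos (u * x) * exp (-(u ^ 2 / 2) - p.2 * u ^ p.1))
      (∫ u in Ioi 0, F' (a, c) u) (a, c) := by
    refine hasFDerivAt_integral_of_dominated_of_fderiv_le (F' := F')
      (bound := fun u ↦ (1 + 2 * c) * ((1 + 2 / a + u ^ 2 + u ^ 3) * exp (-(u ^ 2 / 2)))) hs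
      (Eventually.of_forall fun p ↦ by fun_prop) hFint ?_ ?_
      ((integrableOn_cubic_mul_exp (1 + 2 / a)).const_mul _) ?_
    · exact hF1.1.add hF2.1
    · filter_upwards [self_mem_ae_restrict measurableSet_Ioi] with u hu p hp
      have h1 := norm_derivScale_integrand_le (x := x) ha hp.1.1.le hp.1.2.le hp.2.1.le hu
      have h2 := norm_derivIndex_integrand_le (x := x) ha hp.1.1.le hp.1.2.le hp.2.1.le hu
      refine (norm_add_le _ _).trans ?_
      rw [norm_smul, norm_smul, norm_neg, norm_neg, norm_mul p.2, norm_eq_abs p.2,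
        abs_of_pos hp.2.1]
      have hfst := ContinuousLinearMap.norm_fst_le ℝ ℝ ℝ
      have hsnd := ContinuousLinearMap.norm_snd_le ℝ ℝ ℝ
      have h0 := (norm_nonneg _).trans h1
      calc _ ≤ (1 + 2 / a + u ^ 2 + u ^ 3) * exp (-(u ^ 2 / 2)) * 1 +
            2 * c * ((1 + 2 / a + u ^ 2 + u ^ 3) * exp (-(u ^ 2 / 2))) * 1 := by
            have := hp.2.2.le
            gcongr
        _ = _ := by ring
    · filter_upwards [self_mem_ae_restrict measurableSet_Ioi] with u hu p _
      have hpow : HasFDerivAt (fun p : ℝ × ℝ ↦ u ^ p.1)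
          ((u ^ p.1 * log u) • ContinuousLinearMap.fst ℝ ℝ ℝ) p :=
        HasFDerivAt.const_rpow hasFDerivAt_fst hu
      have hmul : HasFDerivAt (fun p : ℝ × ℝ ↦ p.2 * u ^ p.1)
          (p.2 • (u ^ p.1 * log u) • ContinuousLinearMap.fst ℝ ℝ ℝ +
            u ^ p.1 • ContinuousLinearMap.snd ℝ ℝ ℝ) p := hasFDerivAt_snd.mul hpow
      have hexp := (hmul.const_sub (-(u ^ 2 / 2))).exp.const_mul
        (cos (u * x))
      refine hexp.congr_fderiv ?_
      ext <;> simp [hF', hf, hg] <;> first | ring1 | (left; ring1)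
  have hint : ∫ u in Ioi 0, F' (a, c) u =
      (-∫ u in Ioi 0, f (a, c) u) • ContinuousLinearMap.snd ℝ ℝ ℝ +
      (-(c * ∫ u in Ioi 0, g (a, c) u)) • ContinuousLinearMap.fst ℝ ℝ ℝ := by
    simp only [hF']
    rw [integral_add hF1 hF2,
      integral_smul_const, integral_smul_const, integral_neg, integral_neg, integral_const_mul]
  have := key.const_mul (1 / π)
  rw [hint] at this
  refine this.congr_fderiv ?_
  simp only [stableGaussDerivScale, stableGaussDerivIndex, hf, hg]
  refine ContinuousLinearMap.ext fun p ↦ ?_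
  simp
  ring

theorem hasDerivAt_stableGaussDensity_scale {a c : ℝ} (ha : 0 < a) (ha2 : a < 2) (hc : 0 < c)
    (x : ℝ) : HasDerivAt (fun t ↦ stableGaussDensity a t x) (stableGaussDerivScale a c x) c := by
  have h := (hasFDerivAt_stableGaussDensity ha ha2 hc x).comp_hasDerivAt c
    ((hasDerivAt_const c a).prodMk (hasDerivAt_id c))
  refine h.congr_deriv ?_
  simp

theorem continuousOn_stableGaussDensity_scale {a : ℝ} (x : ℝ) :
    ContinuousOn (fun t ↦ stableGaussDensity a t x) (Ici 0) := by
  refine continuousOn_const.mul (continuousOn_of_dominated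
    (bound := fun u ↦ exp (-(u ^ 2 / 2))) (fun c _ ↦ by fun_prop) (fun c hc ↦ ?_)
    integrableOn_exp_neg_sq_half (ae_of_all _ fun u ↦ by fun_prop))
  filter_upwards [self_mem_ae_restrict measurableSet_Ioi] with u hu
  exact norm_cos_mul_exp_le hc (le_of_lt hu)

/-- Mean value theorem between the scales `0`, where the density is Gaussian, and `c`. -/
theorem exists_stableGaussDensity_eq {a c : ℝ} (ha : 0 < a) (ha2 : a < 2) (hc : 0 < c) (x : ℝ) :
    ∃ t ∈ Ioo 0 c, stableGaussDensity a c x =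
      ProbabilityTheory.gaussianPDFReal 0 1 x + c * stableGaussDerivScale a t x := by
  obtain ⟨t, ht, h⟩ := exists_hasDerivAt_eq_slope (fun t ↦ stableGaussDensity a t x)
    (fun t ↦ stableGaussDerivScale a t x) hc
    ((continuousOn_stableGaussDensity_scale x).mono Icc_subset_Ici_self)
    (fun t ht ↦ hasDerivAt_stableGaussDensity_scale ha ha2 ht.1 x)
  refine ⟨t, ht, ?_⟩
  rw [h, stableGaussDensity_zero]
  have := hc.ne'
  field_simp
  ring

theorem continuous_stableGaussDerivScale {a c : ℝ} (ha : 0 < a) (ha2 : a < 2) (hc : 0 ≤ c) :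
    Continuous (stableGaussDerivScale a c) := by
  refine continuous_const.mul (continuous_of_dominated (fun x ↦ by fun_prop) (fun x ↦ ?_)
    (integrableOn_cubic_mul_exp (1 + 2 / a)) (ae_of_all _ fun u ↦ by fun_prop))
  filter_upwards [self_mem_ae_restrict measurableSet_Ioi] with u hu
  exact norm_derivScale_integrand_le ha (by linarith) ha2.le hc hu

theorem continuous_stableGaussDerivIndex {a c : ℝ} (ha : 0 < a) (ha2 : a < 2) (hc : 0 ≤ c) :
    Continuous (stableGaussDerivIndex a c) := by
  refine continuous_const.mul (continuous_of_dominated (fun x ↦ by fun_prop) (fun x ↦ ?_)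
    (integrableOn_cubic_mul_exp (1 + 2 / a)) (ae_of_all _ fun u ↦ by fun_prop))
  filter_upwards [self_mem_ae_restrict measurableSet_Ioi] with u hu
  exact norm_derivIndex_integrand_le ha (by linarith) ha2.le hc hu

theorem exists_abs_stableGaussDeriv_le {a : ℝ} (ha : 0 < a) (ha2 : a < 2) :
    ∃ D, 0 < D ∧ ∀ c x, 0 ≤ c →
      |stableGaussDerivScale a c x| ≤ D ∧ |stableGaussDerivIndex a c x| ≤ D := by
  set W := ∫ u in Ioi 0, (1 + 2 / a + u ^ 2 + u ^ 3) * exp (-(u ^ 2 / 2)) with hW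
  have hW0 : 0 ≤ W := setIntegral_nonneg measurableSet_Ioi fun u hu ↦ by
    have : (0 : ℝ) < u := hu
    positivity
  refine ⟨1 / π * W + 1, by positivity, fun c x hc ↦ ⟨?_, ?_⟩⟩
  · rw [stableGaussDerivScale, abs_mul, abs_neg, abs_of_pos (show 0 < 1 / π by positivity)]
    have : |∫ u in Ioi 0, cos (u * x) * (u ^ a * exp (-(u ^ 2 / 2) - c * u ^ a))| ≤ W := by
      rw [← norm_eq_abs]
      refine norm_integral_le_of_norm_le (integrableOn_cubic_mul_exp _) ?_
      filter_upwards [self_mem_ae_restrict measurableSet_Ioi] with u hu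
      exact norm_derivScale_integrand_le ha (by linarith) ha2.le hc hu
    have := mul_le_mul_of_nonneg_left this (show 0 ≤ 1 / π by positivity)
    linarith
  · rw [stableGaussDerivIndex, abs_mul, abs_neg, abs_of_pos (show 0 < 1 / π by positivity)]
    have : |∫ u in Ioi 0, cos (u * x) * (u ^ a * log u * exp (-(u ^ 2 / 2) - c * u ^ a))| ≤ W := by
      rw [← norm_eq_abs]
      refine norm_integral_le_of_norm_le (integrableOn_cubic_mul_exp _) ?_
      filter_upwards [self_mem_ae_restrict measurableSet_Ioi] with u hu
      exact norm_derivIndex_integrand_le ha (by linarith) ha2.le hc hu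
    have := mul_le_mul_of_nonneg_left this (show 0 ≤ 1 / π by positivity)
    linarith

theorem stableGaussDerivScale_abs (a c x : ℝ) :
    stableGaussDerivScale a c |x| = stableGaussDerivScale a c x := by
  rcases abs_choice x with h | h <;> rw [h]
  simp [stableGaussDerivScale]

theorem stableGaussDerivIndex_abs (a c x : ℝ) :
    stableGaussDerivIndex a c |x| = stableGaussDerivIndex a c x := by
  rcases abs_choice x with h | h <;> rw [h]
  simp [stableGaussDerivIndex]

theorem stableGaussDensity_abs (a c x : ℝ) :
    stableGaussDensity a c |x| = stableGaussDensity a c x := by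
  rcases abs_choice x with h | h <;> rw [h]
  simp [stableGaussDensity]

/-! ### Lower bounds on the density and information integrals -/

theorem one_add_abs_rpow_le {b : ℝ} (hb : 0 ≤ b) {x : ℝ} (hx : x ≠ 0) :
    (1 + |x|) ^ (-b) ≤ |x| ^ (-b) :=
  rpow_le_rpow_of_nonpos (abs_pos.2 hx) (by linarith) (by linarith)

theorem abs_rpow_neg_le {b : ℝ} (hb : 0 ≤ b) {x : ℝ} (hx : 1 ≤ |x|) :
    |x| ^ (-b) ≤ 2 ^ b * (1 + |x|) ^ (-b) := by
  have h : 1 + |x| ≤ 2 * |x| := by linarith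
  have h1 := rpow_le_rpow_of_nonpos (show 0 < 1 + |x| by linarith) h (show -b ≤ 0 by linarith)
  rw [mul_rpow two_pos.le (abs_nonneg x), rpow_neg two_pos.le] at h1
  have h2 : (0 : ℝ) < 2 ^ b := by positivity
  rwa [inv_mul_le_iff₀ h2] at h1

theorem one_le_two_rpow_mul {b : ℝ} (hb : 0 ≤ b) {x : ℝ} (hx : |x| ≤ 1) :
    1 ≤ 2 ^ b * (1 + |x|) ^ (-b) := by
  have h0 : 0 < 1 + |x| := by linarith [abs_nonneg x]
  rw [rpow_neg h0.le, ← div_eq_mul_inv, one_le_div (by positivity)]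
  exact rpow_le_rpow h0.le (by linarith) hb

/-- A function bounded near the origin and by `|x| ^ (-b)` elsewhere is bounded by
`(1 + |x|) ^ (-b)`. -/
theorem le_mul_one_add_abs_rpow {b K v x : ℝ} (hb : 0 ≤ b) (hK : 0 ≤ K) (h1 : v ≤ K)
    (h2 : 1 ≤ |x| → v * |x| ^ b ≤ K) : v ≤ K * 2 ^ b * (1 + |x|) ^ (-b) := by
  rcases le_total |x| 1 with hx | hx
  · calc v ≤ K * 1 := by linarith
      _ ≤ K * (2 ^ b * (1 + |x|) ^ (-b)) := by gcongr; exact one_le_two_rpow_mul hb hx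
      _ = _ := by ring
  · have hx0 : 0 < |x| := by linarith
    calc v = v * |x| ^ b * |x| ^ (-b) := by
          rw [mul_assoc, ← rpow_add hx0, add_neg_cancel, rpow_zero, mul_one]
      _ ≤ K * (2 ^ b * (1 + |x|) ^ (-b)) := by
          gcongr
          · exact h2 hx
          · exact abs_rpow_neg_le hb hx
      _ = _ := by ring

theorem exists_stableGaussDerivScale_le {a : ℝ} (ha : 0 < a) (ha2 : a < 2) :
    ∃ K, 0 < K ∧ ∀ c x, 0 ≤ c →
      |stableGaussDerivScale a c x| ≤ K * (1 + c) * (1 + |x|) ^ (-(1 + a)) := by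
  obtain ⟨D, hD, hA⟩ := exists_stableGaussDerivScale_tail ha ha2
  obtain ⟨D', hD', hB⟩ := exists_abs_stableGaussDeriv_le ha ha2
  have hκ := stableConst_pos ha ha2
  refine ⟨(D' + a / stableConst a + D) * 2 ^ (1 + a), by positivity, fun c x hc ↦ ?_⟩
  refine (le_mul_one_add_abs_rpow (b := 1 + a) (K := (D' + a / stableConst a + D) * (1 + c))
    (by linarith) (by positivity) ?_ fun hx ↦ ?_).trans (le_of_eq (by ring))
  · have h1 := (hB c x hc).1
    have h2 : 0 < a / stableConst a := by positivity
    nlinarith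
  · have hx0 : 0 < |x| := by linarith
    have h1 := hA c |x| hc hx0
    rw [stableGaussDerivScale_abs] at h1
    have h2 : |x| ^ (-2 : ℝ) ≤ 1 := rpow_le_one_of_one_le_of_nonpos hx (by norm_num)
    have h3 : |x| ^ (-a) ≤ 1 := rpow_le_one_of_one_le_of_nonpos hx (by linarith)
    have h4 : |stableGaussDerivScale a c x * |x| ^ (1 + a)| ≤
        a / stableConst a + D * (1 + c * 1) := by
      have h5 : |stableGaussDerivScale a c x * |x| ^ (1 + a)| ≤
          |stableGaussDerivScale a c x * |x| ^ (1 + a) - a / stableConst a| +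
          |a / stableConst a| := by
        refine le_trans (le_of_eq ?_) (abs_add_le _ _)
        rw [sub_add_cancel]
      rw [abs_of_pos (show 0 < a / stableConst a by positivity)] at h5
      have h6 : D * (|x| ^ (-2 : ℝ) + c * |x| ^ (-a)) ≤ D * (1 + c * 1) := by gcongr
      linarith
    rw [abs_mul, abs_of_nonneg (rpow_nonneg (abs_nonneg x) (1 + a))] at h4
    have h7 : 0 < a / stableConst a := by positivity
    nlinarith

/-- The logarithm in the tail is absorbed into the exponent, which drops from `1 + a` to
`1 + 3 * a / 4`: still more than half of the way from `1` to `1 + a`. -/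
theorem exists_stableGaussDerivIndex_le {a : ℝ} (ha : 0 < a) (ha2 : a < 2) :
    ∃ K, 0 < K ∧ ∀ c x, 0 ≤ c →
      |stableGaussDerivIndex a c x| ≤ K * (1 + |x|) ^ (-(1 + 3 * a / 4)) := by
  obtain ⟨D, hD, hA⟩ := exists_stableGaussDerivIndex_tail ha ha2
  obtain ⟨D', hD', hB⟩ := exists_abs_stableGaussDeriv_le ha ha2
  refine ⟨(D' + D * (1 + 4 / a)) * 2 ^ (1 + 3 * a / 4), by positivity, fun c x hc ↦ ?_⟩
  refine le_mul_one_add_abs_rpow (b := 1 + 3 * a / 4) (K := D' + D * (1 + 4 / a))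
    (by linarith) (by positivity) ?_ fun hx ↦ ?_
  · have h1 := (hB c x hc).2
    have : 0 < D * (1 + 4 / a) := by positivity
    linarith
  · have hx0 : 0 < |x| := by linarith
    have h1 := hA c |x| hc hx0
    rw [stableGaussDerivIndex_abs] at h1
    have h2 := log_le_rpow_div hx0.le (show 0 < a / 4 by linarith)
    have h3 : 1 ≤ |x| ^ (a / 4) := one_le_rpow hx (by linarith)
    rw [abs_of_nonneg (log_nonneg hx)] at h1
    have h4 : |x| ^ (1 + a) = |x| ^ (1 + 3 * a / 4) * |x| ^ (a / 4) := by
      rw [← rpow_add hx0]; ring_nf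
    have h5 : 1 + log |x| ≤ (1 + 4 / a) * |x| ^ (a / 4) := by
      have : |x| ^ (a / 4) / (a / 4) = 4 / a * |x| ^ (a / 4) := by field_simp
      linarith
    rw [h4, ← mul_assoc] at h1
    have h6 : |stableGaussDerivIndex a c x| * |x| ^ (1 + 3 * a / 4) ≤ D * (1 + 4 / a) := by
      refine le_of_mul_le_mul_right (h1.trans ?_) (show 0 < |x| ^ (a / 4) by linarith)
      rw [mul_assoc]
      gcongr
    linarith

theorem exists_le_stableGaussDerivScale {a : ℝ} (ha : 0 < a) (ha2 : a < 2) (c : ℝ) :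
    ∃ M, 1 ≤ M ∧ ∀ t ∈ Icc 0 c, ∀ x, M ≤ |x| →
      a / (2 * stableConst a) * (1 + |x|) ^ (-(1 + a)) ≤ stableGaussDerivScale a t x := by
  obtain ⟨D, hD, hA⟩ := exists_stableGaussDerivScale_tail ha ha2
  have hκ := stableConst_pos ha ha2
  have hlim : Tendsto (fun x : ℝ ↦ D * (x ^ (-2 : ℝ) + c * x ^ (-a))) atTop (𝓝 0) := by
    have := ((tendsto_rpow_neg_atTop two_pos).add
      ((tendsto_rpow_neg_atTop ha).const_mul c)).const_mul D
    simpa using this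
  have hev := hlim.eventually_le_const (show 0 < a / (2 * stableConst a) by positivity)
  obtain ⟨M, hM⟩ := eventually_atTop.1 hev
  refine ⟨max M 1, le_max_right _ _, fun t ht x hx ↦ ?_⟩
  have hx1 : 1 ≤ |x| := (le_max_right _ _).trans hx
  have hx0 : 0 < |x| := by linarith
  have h1 := hA t |x| ht.1 hx0
  rw [stableGaussDerivScale_abs] at h1
  have h2 := hM |x| ((le_max_left _ _).trans hx)
  have h3 : D * (|x| ^ (-2 : ℝ) + t * |x| ^ (-a)) ≤ D * (|x| ^ (-2 : ℝ) + c * |x| ^ (-a)) := by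
    have := ht.2
    gcongr
  have h4 : a / stableConst a = 2 * (a / (2 * stableConst a)) := by field_simp
  have h5 : a / (2 * stableConst a) ≤ stableGaussDerivScale a t x * |x| ^ (1 + a) := by
    have := (abs_le.1 (h1.trans (h3.trans h2))).1
    linarith
  calc _ ≤ a / (2 * stableConst a) * |x| ^ (-(1 + a)) :=
        mul_le_mul_of_nonneg_left (one_add_abs_rpow_le (b := 1 + a) (by linarith) (abs_pos.1 hx0))
          (by positivity)
    _ ≤ stableGaussDerivScale a t x * |x| ^ (1 + a) * |x| ^ (-(1 + a)) := by gcongr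
    _ = _ := by rw [mul_assoc, ← rpow_add hx0, add_neg_cancel, rpow_zero, mul_one]

theorem one_add_abs_rpow_le_one {b : ℝ} (hb : 0 ≤ b) (x : ℝ) : (1 + |x|) ^ (-b) ≤ 1 :=
  rpow_le_one_of_one_le_of_nonpos (by linarith [abs_nonneg x]) (by linarith)

theorem exists_le_stableGaussDensity {a c : ℝ} (ha : 0 < a) (ha2 : a < 2) (hc : 0 < c) :
    ∃ k, 0 < k ∧ ∀ x, k * (1 + |x|) ^ (-(1 + a)) ≤ stableGaussDensity a c x := by
  obtain ⟨M, hM1, hM⟩ := exists_le_stableGaussDerivScale ha ha2 c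
  have hκ := stableConst_pos ha ha2
  have hpos := (stableGaussDensity_spec ha ha2 hc).1
  obtain ⟨x₀, -, hx₀⟩ := (isCompact_Icc (a := -M) (b := M)).exists_isMinOn
    ⟨0, by constructor <;> linarith⟩ (continuous_stableGaussDensity (a := a) hc.le).continuousOn
  refine ⟨min (stableGaussDensity a c x₀) (c * (a / (2 * stableConst a))),
    lt_min (hpos x₀) (by positivity), fun x ↦ ?_⟩
  have hw : 0 ≤ (1 + |x|) ^ (-(1 + a)) := by positivity
  rcases le_total |x| M with hx | hx
  · calc _ ≤ stableGaussDensity a c x₀ * 1 := by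
          gcongr
          · exact (hpos x₀).le
          · exact min_le_left _ _
          · exact one_add_abs_rpow_le_one (by linarith) x
      _ ≤ _ := by rw [mul_one]; exact hx₀ (abs_le.1 hx)
  · obtain ⟨t, ht, h⟩ := exists_stableGaussDensity_eq ha ha2 hc x
    have h1 := hM t ⟨ht.1.le, ht.2.le⟩ x hx
    calc _ ≤ c * (a / (2 * stableConst a)) * (1 + |x|) ^ (-(1 + a)) := by
          gcongr
          exact min_le_right _ _
      _ = c * (a / (2 * stableConst a) * (1 + |x|) ^ (-(1 + a))) := by ring
      _ ≤ c * stableGaussDerivScale a t x := by gcongr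
      _ ≤ _ := by
          rw [h]
          linarith [ProbabilityTheory.gaussianPDFReal_nonneg 0 1 x]

theorem gaussianPDFReal_std (x : ℝ) :
    ProbabilityTheory.gaussianPDFReal 0 1 x = (√(2 * π))⁻¹ * exp (-(x ^ 2 / 2)) := by
  simp only [ProbabilityTheory.gaussianPDFReal, NNReal.coe_one, mul_one, sub_zero, neg_div]

/-- Two lower bounds, uniform in small scales: the Gaussian density dominates in the bulk, and the
Lévy density in the tails. -/
theorem exists_uniform_le_stableGaussDensity {a : ℝ} (ha : 0 < a) (ha2 : a < 2) :
    ∃ c₀ k, 0 < c₀ ∧ c₀ ≤ 1 ∧ 0 < k ∧ ∀ c ∈ Ioc 0 c₀, ∀ x,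
      k * ProbabilityTheory.gaussianPDFReal 0 1 x ≤ stableGaussDensity a c x ∧
      k * (c * (1 + |x|) ^ (-(1 + a))) ≤ stableGaussDensity a c x := by
  obtain ⟨M, hM1, hM⟩ := exists_le_stableGaussDerivScale ha ha2 1
  obtain ⟨D, hD, hB⟩ := exists_abs_stableGaussDeriv_le ha ha2
  have hκ := stableConst_pos ha ha2
  set m := ProbabilityTheory.gaussianPDFReal 0 1 M with hm
  have hm0 : 0 < m := ProbabilityTheory.gaussianPDFReal_pos 0 1 M one_ne_zero
  refine ⟨min 1 (m / (2 * D)), min (1 / 2) (min (m / 2) (a / (2 * stableConst a))),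
    by positivity, min_le_left _ _, by positivity, fun c hc x ↦ ?_⟩
  set k := min (1 / 2) (min (m / 2) (a / (2 * stableConst a))) with hk
  have hk1 : k ≤ 1 / 2 := min_le_left _ _
  have hk2 : k ≤ m / 2 := (min_le_right _ _).trans (min_le_left _ _)
  have hk3 : k ≤ a / (2 * stableConst a) := (min_le_right _ _).trans (min_le_right _ _)
  have hk0 : 0 < k := by positivity
  have hc0 := hc.1
  have hc1 : c ≤ 1 := hc.2.trans (min_le_left _ _)
  have hφ := ProbabilityTheory.gaussianPDFReal_nonneg 0 1 x
  have hw : 0 ≤ (1 + |x|) ^ (-(1 + a)) := by positivity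
  have hw1 := one_add_abs_rpow_le_one (b := 1 + a) (by linarith) x
  obtain ⟨t, ht, h⟩ := exists_stableGaussDensity_eq ha ha2 hc0 x
  -- For `|x| ≤ M` the normal density is at least `m`, and the stable part at most `m / 2`. For
  -- `|x| ≥ M` the stable part is positive.
  rcases le_total |x| M with hx | hx
  · have h1 : c * D ≤ m / 2 := by
      have := hc.2.trans (min_le_right _ _)
      rw [le_div_iff₀ (by positivity)] at this
      linarith
    have h2 := (abs_le.1 (hB t x ht.1.le).1).1
    have h3 : m ≤ ProbabilityTheory.gaussianPDFReal 0 1 x := by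
      rw [hm, gaussianPDFReal_std, gaussianPDFReal_std]
      have : x ^ 2 ≤ M ^ 2 := by
        rw [← sq_abs]; exact pow_le_pow_left₀ (abs_nonneg x) hx 2
      gcongr
    have h4 : -(c * D) ≤ c * stableGaussDerivScale a t x := by nlinarith
    have h5 : c * (1 + |x|) ^ (-(1 + a)) ≤ 1 := mul_le_one₀ hc1 hw hw1
    constructor
    · rw [h]; nlinarith
    · rw [h]; nlinarith
  · have h1 := hM t ⟨ht.1.le, ht.2.le.trans hc1⟩ x hx
    have h2 : k * (c * (1 + |x|) ^ (-(1 + a))) ≤ c * stableGaussDerivScale a t x := by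
      calc _ = c * (k * (1 + |x|) ^ (-(1 + a))) := by ring
        _ ≤ c * (a / (2 * stableConst a) * (1 + |x|) ^ (-(1 + a))) := by gcongr
        _ ≤ _ := by gcongr
    have h3 : 0 ≤ k * (c * (1 + |x|) ^ (-(1 + a))) := by positivity
    constructor
    · rw [h]; nlinarith
    · rw [h]; linarith

theorem integrable_one_add_abs_rpow {b : ℝ} (hb : 1 < b) :
    Integrable fun x : ℝ ↦ (1 + |x|) ^ (-b) := by
  have := integrable_one_add_norm (E := ℝ) (μ := volume) (r := b) (by simpa using hb)
  simpa only [norm_eq_abs] using this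

theorem abs_mul_div_le {a K k f g G x : ℝ} (hk : 0 < k)
    (hf : |f| ≤ K * (1 + |x|) ^ (-(1 + 3 * a / 4)))
    (hg : |g| ≤ K * (1 + |x|) ^ (-(1 + 3 * a / 4))) (hG : k * (1 + |x|) ^ (-(1 + a)) ≤ G) :
    |f * g / G| ≤ K ^ 2 / k * (1 + |x|) ^ (-(1 + a / 2)) := by
  have h0 : 0 < 1 + |x| := by linarith [abs_nonneg x]
  have hw : 0 < k * (1 + |x|) ^ (-(1 + a)) := by positivity
  rw [abs_div, abs_mul, abs_of_pos (hw.trans_le hG)]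
  have e : (1 + |x|) ^ (-(1 + 3 * a / 4)) * (1 + |x|) ^ (-(1 + 3 * a / 4)) =
      (1 + |x|) ^ (-(1 + a / 2)) * (1 + |x|) ^ (-(1 + a)) := by
    rw [← rpow_add h0, ← rpow_add h0]; ring_nf
  have h2 : 0 ≤ K * (1 + |x|) ^ (-(1 + 3 * a / 4)) := (abs_nonneg _).trans hf
  calc _ ≤ (K * (1 + |x|) ^ (-(1 + 3 * a / 4))) * (K * (1 + |x|) ^ (-(1 + 3 * a / 4))) /
        (k * (1 + |x|) ^ (-(1 + a))) := by gcongr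
    _ = K ^ 2 * ((1 + |x|) ^ (-(1 + 3 * a / 4)) * (1 + |x|) ^ (-(1 + 3 * a / 4))) /
        (k * (1 + |x|) ^ (-(1 + a))) := by ring
    _ = _ := by
      rw [e]
      have : (1 + |x|) ^ (-(1 + a)) ≠ 0 := by positivity
      field_simp

/-- A common bound for both derivatives, strong enough for the products divided by the density to
be integrable. -/
theorem exists_stableGaussDeriv_le {a : ℝ} (ha : 0 < a) (ha2 : a < 2) :
    ∃ K, 0 < K ∧ ∀ c x, 0 ≤ c →
      |stableGaussDerivScale a c x| ≤ K * (1 + c) * (1 + |x|) ^ (-(1 + 3 * a / 4)) ∧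
      |stableGaussDerivIndex a c x| ≤ K * (1 + c) * (1 + |x|) ^ (-(1 + 3 * a / 4)) := by
  obtain ⟨K, hK, hA⟩ := exists_stableGaussDerivScale_le ha ha2
  obtain ⟨K', hK', hB⟩ := exists_stableGaussDerivIndex_le ha ha2
  refine ⟨K + K', by positivity, fun c x hc ↦ ?_⟩
  have h1 : (1 + |x|) ^ (-(1 + a)) ≤ (1 + |x|) ^ (-(1 + 3 * a / 4)) :=
    rpow_le_rpow_of_exponent_le (by linarith [abs_nonneg x]) (by linarith)
  have h2 : 0 ≤ (1 + |x|) ^ (-(1 + 3 * a / 4)) := by positivity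
  constructor
  · refine (hA c x hc).trans ?_
    calc _ ≤ K * (1 + c) * (1 + |x|) ^ (-(1 + 3 * a / 4)) := by gcongr
      _ ≤ _ := by gcongr; linarith
  · refine (hB c x hc).trans ?_
    gcongr
    nlinarith

/-- The integral `∫ f g / p`, an entry of the Fisher information matrix when `f` and `g` are partial
derivatives of the density `p`. -/
noncomputable def fisherIntegral (p f g : ℝ → ℝ) : ℝ := ∫ x, f x * g x / p x

theorem integrable_mul_div_stableGaussDensity {a c : ℝ} (ha : 0 < a) (ha2 : a < 2) (hc : 0 < c)
    {f g : ℝ → ℝ}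
    (hf : f = stableGaussDerivScale a c ∨ f = stableGaussDerivIndex a c)
    (hg : g = stableGaussDerivScale a c ∨ g = stableGaussDerivIndex a c) :
    Integrable fun x ↦ f x * g x / stableGaussDensity a c x := by
  obtain ⟨K, hK, h⟩ := exists_stableGaussDeriv_le ha ha2
  obtain ⟨k, hk, hG⟩ := exists_le_stableGaussDensity ha ha2 hc
  have hcA := continuous_stableGaussDerivScale ha ha2 hc.le
  have hcB := continuous_stableGaussDerivIndex ha ha2 hc.le
  have hfc : Continuous f := by rcases hf with rfl | rfl <;> assumption
  have hgc : Continuous g := by rcases hg with rfl | rfl <;> assumption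
  have hpos := (stableGaussDensity_spec ha ha2 hc).1
  refine ((integrable_one_add_abs_rpow (b := 1 + a / 2) (by linarith)).const_mul
    ((K * (1 + c)) ^ 2 / k)).mono' ((hfc.mul hgc).div (continuous_stableGaussDensity hc.le)
      fun x ↦ (hpos x).ne').aestronglyMeasurable (ae_of_all _ fun x ↦ ?_)
  refine abs_mul_div_le hk ?_ ?_ (hG x)
  · rcases hf with rfl | rfl
    exacts [(h c x hc.le).1, (h c x hc.le).2]
  · rcases hg with rfl | rfl
    exacts [(h c x hc.le).1, (h c x hc.le).2]

/-- Since `G` is at least a multiple of `c * (1 + |x|) ^ (-(1 + a))`, the integrands of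
`c * ∫ A B / G` and `c * ∫ B ^ 2 / G` have an integrable majorant that does not depend on `c`. -/
theorem exists_fisherIntegral_le {a : ℝ} (ha : 0 < a) (ha2 : a < 2) :
    ∃ c₀ N, 0 < c₀ ∧ ∀ c ∈ Ioc 0 c₀,
      |c * fisherIntegral (stableGaussDensity a c) (stableGaussDerivScale a c)
        (stableGaussDerivIndex a c)| ≤ N ∧
      |c * fisherIntegral (stableGaussDensity a c) (stableGaussDerivIndex a c)
        (stableGaussDerivIndex a c)| ≤ N := by
  obtain ⟨K, hK, h⟩ := exists_stableGaussDeriv_le ha ha2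
  obtain ⟨c₀, k, hc₀, hc₁, hk, hG⟩ := exists_uniform_le_stableGaussDensity ha ha2
  have hint := (integrable_one_add_abs_rpow (b := 1 + a / 2) (by linarith)).const_mul
    ((K * 2) ^ 2 / k)
  refine ⟨c₀, ∫ x : ℝ, (K * 2) ^ 2 / k * (1 + |x|) ^ (-(1 + a / 2)), hc₀, fun c hc ↦ ?_⟩
  have key : ∀ f g : ℝ → ℝ, (∀ x, |f x| ≤ K * (1 + c) * (1 + |x|) ^ (-(1 + 3 * a / 4))) →
      (∀ x, |g x| ≤ K * (1 + c) * (1 + |x|) ^ (-(1 + 3 * a / 4))) →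
      |c * fisherIntegral (stableGaussDensity a c) f g| ≤
        ∫ x : ℝ, (K * 2) ^ 2 / k * (1 + |x|) ^ (-(1 + a / 2)) := by
    intro f g hf hg
    rw [fisherIntegral, ← integral_const_mul, ← norm_eq_abs]
    refine norm_integral_le_of_norm_le hint (ae_of_all _ fun x ↦ ?_)
    have e : c * (f x * g x / stableGaussDensity a c x) =
        f x * g x / (stableGaussDensity a c x / c) := by
      have := hc.1.ne'
      field_simp
    have h2 : K * (1 + c) * (1 + |x|) ^ (-(1 + 3 * a / 4)) ≤
        K * 2 * (1 + |x|) ^ (-(1 + 3 * a / 4)) := by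
      have := hc.2
      gcongr
      linarith
    rw [e]
    refine abs_mul_div_le hk ((hf x).trans h2) ((hg x).trans h2) ?_
    rw [le_div_iff₀ hc.1]
    calc _ = k * (c * (1 + |x|) ^ (-(1 + a))) := by ring
      _ ≤ _ := (hG c hc x).2
  exact ⟨key _ _ (fun x ↦ (h c x hc.1.le).1) (fun x ↦ (h c x hc.1.le).2),
    key _ _ (fun x ↦ (h c x hc.1.le).2) (fun x ↦ (h c x hc.1.le).2)⟩

/-! ### Asymptotics of the information on the scale -/

theorem tendsto_rpow_mul_exp_neg_sq (q : ℝ) {p : ℝ} (hp : 0 < p) :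
    Tendsto (fun R : ℝ ↦ R ^ q * exp (-(p * R ^ 2))) atTop (𝓝 0) := by
  have h := (tendsto_rpow_mul_exp_neg_mul_atTop_nhds_zero (q / 2) p hp).comp
    (tendsto_pow_atTop (α := ℝ) two_ne_zero)
  refine h.congr' ?_
  filter_upwards [eventually_gt_atTop 0] with R hR
  simp only [Function.comp]
  rw [← rpow_natCast, ← rpow_mul hR.le, neg_mul]
  congr 2
  push_cast; ring

theorem integral_one_lt_abs_rpow {a : ℝ} (ha : 0 < a) :
    ∫ y : ℝ, (Ioi 1).indicator (fun y ↦ y ^ (-(1 + a))) |y| = 2 / a := by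
  rw [integral_comp_abs (f := (Ioi 1).indicator (fun y ↦ y ^ (-(1 + a)))),
    setIntegral_indicator measurableSet_Ioi,
    inter_eq_self_of_subset_right (Ioi_subset_Ioi zero_le_one),
    integral_Ioi_rpow_of_lt (by linarith) one_pos]
  rw [one_rpow, show -(1 + a) + 1 = -a by ring, neg_div_neg_eq]
  ring

/-- The coefficient `t R` may vary with `R`, because the tail estimate is uniform. -/
theorem tendsto_stableGaussDerivScale_mul_rpow {a : ℝ} (ha : 0 < a) (ha2 : a < 2) {t X : ℝ → ℝ}
    (ht : ∀ R, 0 ≤ t R) (ht1 : ∀ R, t R ≤ 1) (hX : Tendsto X atTop atTop) :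
    Tendsto (fun R ↦ stableGaussDerivScale a (t R) (X R) * X R ^ (1 + a)) atTop
      (𝓝 (a / stableConst a)) := by
  obtain ⟨D, hD, hA⟩ := exists_stableGaussDerivScale_tail ha ha2
  rw [tendsto_iff_norm_sub_tendsto_zero]
  have hlim : Tendsto (fun R ↦ D * (X R ^ (-2 : ℝ) + 1 * X R ^ (-a))) atTop (𝓝 0) := by
    have := ((((tendsto_rpow_neg_atTop two_pos).add
      ((tendsto_rpow_neg_atTop ha).const_mul 1)).const_mul D)).comp hX
    simpa [Function.comp_def] using this
  refine squeeze_zero' (Eventually.of_forall fun R ↦ norm_nonneg _) ?_ hlim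
  filter_upwards [hX.eventually_gt_atTop 0] with R hR
  refine (hA (t R) (X R) (ht R) hR).trans ?_
  have := ht1 R
  gcongr

/-- The integrand of `∫ A ^ 2 / G`, for `A` the derivative in the scale and `G` the density, after
the substitution `x = R * y`, at the scale `c = exp (-R ^ 2 / 2)`. With this choice the Gaussian
and the Lévy tails balance at `|y| = 1`, up to a power of `R`. -/
noncomputable def rescaledIntegrand (a R y : ℝ) : ℝ :=
  R ^ (1 + a) * (exp (-(R ^ 2 / 2)) * (stableGaussDerivScale a (exp (-(R ^ 2 / 2))) (R * y) *
    stableGaussDerivScale a (exp (-(R ^ 2 / 2))) (R * y) /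
      stableGaussDensity a (exp (-(R ^ 2 / 2))) (R * y)))

theorem rescaledIntegrand_nonneg {a R : ℝ} (ha : 0 < a) (ha2 : a < 2) (hR : 0 ≤ R) (y : ℝ) :
    0 ≤ rescaledIntegrand a R y := by
  have := ((stableGaussDensity_spec ha ha2 (exp_pos (-(R ^ 2 / 2)))).1 (R * y)).le
  have h := mul_self_nonneg (stableGaussDerivScale a (exp (-(R ^ 2 / 2))) (R * y))
  unfold rescaledIntegrand
  positivity

/-- The bound for the bulk comes from the Gaussian lower bound on the density, and the one for the
tail from the Lévy lower bound. -/
theorem exists_rescaledIntegrand_le {a : ℝ} (ha : 0 < a) (ha2 : a < 2) :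
    ∃ N R₀, 0 < N ∧ 0 < R₀ ∧ ∀ R, R₀ ≤ R → ∀ y,
      rescaledIntegrand a R y ≤ N * (R ^ (1 + a) * exp (-((1 - y ^ 2) / 2 * R ^ 2))) ∧
      (y ≠ 0 → rescaledIntegrand a R y ≤ N * |y| ^ (-(1 + a))) := by
  obtain ⟨c₀, k, hc₀, hc₁, hk, hG⟩ := exists_uniform_le_stableGaussDensity ha ha2
  obtain ⟨K, hK, hA⟩ := exists_stableGaussDerivScale_le ha ha2
  have hc : Tendsto (fun R : ℝ ↦ exp (-(R ^ 2 / 2))) atTop (𝓝 0) :=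
    tendsto_exp_neg_atTop_nhds_zero.comp
      ((tendsto_pow_atTop (α := ℝ) two_ne_zero).atTop_div_const two_pos)
  obtain ⟨R₁, hR₁⟩ := eventually_atTop.1 (hc.eventually_le_const hc₀)
  refine ⟨(2 * K) ^ 2 / k * (√(2 * π) + 1), max R₁ 1, by positivity, by positivity,
    fun R hR y ↦ ?_⟩
  have hR0 : 0 < R := by linarith [le_max_right R₁ 1]
  have hcR := hR₁ R ((le_max_left _ _).trans hR)
  unfold rescaledIntegrand
  set c := exp (-(R ^ 2 / 2)) with hcdef
  have hc0 : 0 < c := exp_pos _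
  obtain ⟨hG1, hG2⟩ := hG c ⟨hc0, hcR⟩ (R * y)
  have hA1 := hA c (R * y) hc0.le
  set A := stableGaussDerivScale a c (R * y)
  set G := stableGaussDensity a c (R * y)
  set w := (1 + |R * y|) ^ (-(1 + a)) with hw
  have hw0 : 0 < w := by positivity
  have hw1 : w ≤ 1 := one_add_abs_rpow_le_one (by linarith) _
  have hA2 : A * A ≤ (2 * K * w) * (2 * K * w) := by
    rw [← abs_mul_abs_self A]
    have : |A| ≤ 2 * K * w := hA1.trans
      (mul_le_mul_of_nonneg_right (by nlinarith) hw0.le)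
    gcongr
  have hs : 0 < √(2 * π) := by positivity
  constructor
  · rw [gaussianPDFReal_std] at hG1
    have h1 : 0 < k * ((√(2 * π))⁻¹ * exp (-((R * y) ^ 2 / 2))) := by positivity
    have h2 : A * A ≤ (2 * K) ^ 2 := by
      refine hA2.trans ?_
      calc _ = (2 * K) ^ 2 * (w * w) := by ring
        _ ≤ (2 * K) ^ 2 * (1 * 1) := by gcongr
        _ = _ := by ring
    calc _ ≤ R ^ (1 + a) * (c * ((2 * K) ^ 2 /
          (k * ((√(2 * π))⁻¹ * exp (-((R * y) ^ 2 / 2)))))) := by gcongr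
      _ = (2 * K) ^ 2 / k * √(2 * π) * (R ^ (1 + a) * (c * exp ((R * y) ^ 2 / 2))) := by
        rw [exp_neg]; field_simp
      _ = (2 * K) ^ 2 / k * √(2 * π) * (R ^ (1 + a) * exp (-((1 - y ^ 2) / 2 * R ^ 2))) := by
        rw [hcdef, ← exp_add]; ring_nf
      _ ≤ _ := by gcongr; linarith
  · intro hy
    have hy0 : 0 < |y| := abs_pos.2 hy
    have h1 : R ^ (1 + a) * w ≤ |y| ^ (-(1 + a)) := by
      have := one_add_abs_rpow_le (b := 1 + a) (by linarith) (mul_ne_zero hR0.ne' hy)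
      rw [abs_mul, abs_of_pos hR0, mul_rpow hR0.le hy0.le, ← abs_of_pos hR0, ← abs_mul,
        abs_of_pos hR0] at this
      calc _ ≤ R ^ (1 + a) * (R ^ (-(1 + a)) * |y| ^ (-(1 + a))) := by gcongr
        _ = _ := by rw [← mul_assoc, ← rpow_add hR0, add_neg_cancel, rpow_zero, one_mul]
    calc _ ≤ R ^ (1 + a) * (c * ((2 * K * w) * (2 * K * w) / (k * (c * w)))) := by gcongr
      _ = (2 * K) ^ 2 / k * (R ^ (1 + a) * w) := by field_simp
      _ ≤ (2 * K) ^ 2 / k * |y| ^ (-(1 + a)) := by gcongr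
      _ ≤ _ := by gcongr; nlinarith [show 0 < (2 * K) ^ 2 / k by positivity]

theorem tendsto_rescaledIntegrand_of_abs_lt_one {a : ℝ} (ha : 0 < a) (ha2 : a < 2) {y : ℝ}
    (hy : |y| < 1) : Tendsto (fun R ↦ rescaledIntegrand a R y) atTop (𝓝 0) := by
  obtain ⟨N, R₀, hN, hR₀, h⟩ := exists_rescaledIntegrand_le ha ha2
  have hy2 : 0 < (1 - y ^ 2) / 2 := by
    have : y ^ 2 < 1 := (sq_lt_one_iff_abs_lt_one y).2 hy
    linarith
  have hlim := (tendsto_rpow_mul_exp_neg_sq (1 + a) hy2).const_mul N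
  rw [mul_zero] at hlim
  refine squeeze_zero' ?_ ?_ hlim
  · filter_upwards [eventually_ge_atTop 0] with R hR using rescaledIntegrand_nonneg ha ha2 hR y
  · filter_upwards [eventually_ge_atTop R₀] with R hR using (h R hR y).1

/-- Beyond the crossover the density is `c * A` to leading order, and `c * A ^ 2 / G` is `A`. -/
theorem tendsto_rescaledIntegrand_of_one_lt_abs {a : ℝ} (ha : 0 < a) (ha2 : a < 2) {y : ℝ}
    (hy : 1 < |y|) : Tendsto (fun R ↦ rescaledIntegrand a R y) atTop
      (𝓝 (a / stableConst a * |y| ^ (-(1 + a)))) := by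
  have hκ := stableConst_pos ha ha2
  have hy0 : 0 < |y| := by linarith
  have hX : Tendsto (fun R : ℝ ↦ R * |y|) atTop atTop := tendsto_id.atTop_mul_const hy0
  have hc0 : ∀ R : ℝ, 0 < exp (-(R ^ 2 / 2)) := fun R ↦ exp_pos _
  have hc1 : ∀ R : ℝ, exp (-(R ^ 2 / 2)) ≤ 1 := fun R ↦ exp_le_one_iff.2 (by
    have := sq_nonneg R; linarith)
  choose t ht hGt using fun R : ℝ ↦ exists_stableGaussDensity_eq ha ha2 (hc0 R) (R * |y|)
  have h1 := tendsto_stableGaussDerivScale_mul_rpow ha ha2 (fun R ↦ (hc0 R).le) hc1 hX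
  have h2 := tendsto_stableGaussDerivScale_mul_rpow ha ha2 (fun R ↦ (ht R).1.le)
    (fun R ↦ (ht R).2.le.trans (hc1 R)) hX
  have hy2 : 0 < (y ^ 2 - 1) / 2 := by
    have := (one_lt_sq_iff_one_lt_abs y).2 hy
    linarith
  have h3 : Tendsto (fun R ↦ ProbabilityTheory.gaussianPDFReal 0 1 (R * |y|) *
      (R * |y|) ^ (1 + a) / exp (-(R ^ 2 / 2))) atTop (𝓝 0) := by
    have := (tendsto_rpow_mul_exp_neg_sq (1 + a) hy2).const_mul ((√(2 * π))⁻¹ * |y| ^ (1 + a))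
    rw [mul_zero] at this
    refine this.congr' ?_
    filter_upwards [eventually_gt_atTop 0] with R hR
    rw [gaussianPDFReal_std, mul_rpow hR.le hy0.le,
      show -((y ^ 2 - 1) / 2 * R ^ 2) = -((R * |y|) ^ 2 / 2) - -(R ^ 2 / 2) by
        rw [mul_pow, sq_abs]; ring, exp_sub]
    ring
  have h4 : Tendsto (fun R ↦ stableGaussDensity a (exp (-(R ^ 2 / 2))) (R * |y|) *
      (R * |y|) ^ (1 + a) / exp (-(R ^ 2 / 2))) atTop (𝓝 (a / stableConst a)) := by
    have := h3.add h2
    rw [zero_add] at this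
    refine this.congr fun R ↦ ?_
    rw [hGt R]
    have := (hc0 R).ne'
    field_simp
  have hne : a / stableConst a ≠ 0 := by positivity
  have h5 := ((h1.mul h1).div h4 hne).const_mul (|y| ^ (-(1 + a)))
  have e : |y| ^ (-(1 + a)) * (a / stableConst a * (a / stableConst a) / (a / stableConst a)) =
      a / stableConst a * |y| ^ (-(1 + a)) := by
    field_simp
  rw [e] at h5
  refine h5.congr' ?_
  filter_upwards [eventually_gt_atTop 0] with R hR
  have e2 : R * |y| = |R * y| := by rw [abs_mul, abs_of_pos hR]
  have hG := ((stableGaussDensity_spec ha ha2 (hc0 R)).1 (R * y)).ne'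
  have hp : (0 : ℝ) < R ^ (1 + a) := by positivity
  have hq : 0 < |y| ^ (1 + a) := by positivity
  unfold rescaledIntegrand
  simp only [Pi.div_apply]
  rw [mul_rpow hR.le hy0.le, e2, stableGaussDerivScale_abs, stableGaussDensity_abs,
    rpow_neg hy0.le]
  have := (hc0 R).ne'
  field_simp

/-- Asymptotics of the information on the scale as the scale `exp (-R ^ 2 / 2)` tends to `0`. -/
theorem tendsto_rpow_mul_fisherIntegral {a : ℝ} (ha : 0 < a) (ha2 : a < 2) :
    Tendsto (fun R : ℝ ↦ R ^ a * (exp (-(R ^ 2 / 2)) *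
      fisherIntegral (stableGaussDensity a (exp (-(R ^ 2 / 2))))
        (stableGaussDerivScale a (exp (-(R ^ 2 / 2))))
        (stableGaussDerivScale a (exp (-(R ^ 2 / 2)))))) atTop (𝓝 (2 / stableConst a)) := by
  have hκ := stableConst_pos ha ha2
  obtain ⟨N, R₀, hN, hR₀, hb⟩ := exists_rescaledIntegrand_le ha ha2
  have hlim : Tendsto (fun R ↦ ∫ y, rescaledIntegrand a R y) atTop
      (𝓝 (∫ y : ℝ, a / stableConst a * (Ioi 1).indicator (fun y ↦ y ^ (-(1 + a))) |y|)) := by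
    refine tendsto_integral_filter_of_dominated_convergence
      (fun y ↦ N * 3 ^ (1 + a) * (1 + |y|) ^ (-(1 + a))) ?_ ?_
      ((integrable_one_add_abs_rpow (by linarith)).const_mul _) ?_
    · refine Eventually.of_forall fun R ↦ ?_
      have h1 := continuous_stableGaussDerivScale ha ha2 (exp_pos (-(R ^ 2 / 2))).le
      have h2 := continuous_stableGaussDensity (a := a) (exp_pos (-(R ^ 2 / 2))).le
      unfold rescaledIntegrand
      exact ((h1.measurable.comp (measurable_const_mul R)).mul
        (h1.measurable.comp (measurable_const_mul R)) |>.div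
        (h2.measurable.comp (measurable_const_mul R)) |>.const_mul _ |>.const_mul
          _).aestronglyMeasurable
    · have hsmall := (tendsto_rpow_mul_exp_neg_sq (1 + a) (show (0 : ℝ) < 3 / 8 by
        norm_num)).eventually_le_const one_pos
      filter_upwards [eventually_ge_atTop R₀, hsmall] with R hR hR1
      refine ae_of_all _ fun y ↦ ?_
      have hR0 : 0 < R := hR₀.trans_le hR
      rw [norm_eq_abs, abs_of_nonneg (rescaledIntegrand_nonneg ha ha2 hR0.le y)]
      obtain ⟨h1, h2⟩ := hb R hR y
      have hy1 : 0 < 1 + |y| := by linarith [abs_nonneg y]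
      -- In the bulk `|y| ≤ 1 / 2` the exponent `1 - y ^ 2` is at least `3 / 4`.
      rcases le_total |y| (1 / 2) with hy | hy
      · have h3 : rescaledIntegrand a R y ≤ N * 1 := by
          refine h1.trans ?_
          gcongr
          refine le_trans ?_ hR1
          have : y ^ 2 ≤ (1 / 2) ^ 2 := by
            rw [← sq_abs]; exact pow_le_pow_left₀ (abs_nonneg y) hy 2
          have h3 : 3 / 8 ≤ (1 - y ^ 2) / 2 := by linarith
          gcongr
        have h4 : 1 ≤ 3 ^ (1 + a) * (1 + |y|) ^ (-(1 + a)) := by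
          rw [rpow_neg hy1.le, ← div_eq_mul_inv, one_le_div (by positivity)]
          gcongr
          linarith
        refine h3.trans ?_
        rw [mul_assoc]
        gcongr
      · have hy0 : 0 < |y| := by linarith
        refine (h2 (abs_pos.1 hy0)).trans ?_
        rw [mul_assoc]
        gcongr
        have h3 := rpow_le_rpow_of_nonpos hy1 (show 1 + |y| ≤ 3 * |y| by linarith)
          (show -(1 + a) ≤ 0 by linarith)
        rw [mul_rpow (by norm_num) hy0.le, rpow_neg (by norm_num : (0 : ℝ) ≤ 3)] at h3
        rwa [inv_mul_le_iff₀ (by positivity)] at h3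
    · have hnull : ∀ᵐ y : ℝ, y ∉ ({-1, 1} : Set ℝ) :=
        (Set.toFinite ({-1, 1} : Set ℝ)).countable.ae_notMem volume
      filter_upwards [hnull] with y hy
      have hne : |y| ≠ 1 := fun h ↦ hy (by
        rcases eq_or_eq_neg_of_abs_eq h with h | h <;> simp [h])
      rcases lt_or_gt_of_ne hne with h | h
      · rw [indicator_of_notMem (by simpa using h.le), mul_zero]
        exact tendsto_rescaledIntegrand_of_abs_lt_one ha ha2 h
      · rw [indicator_of_mem (by simpa using h)]
        exact tendsto_rescaledIntegrand_of_one_lt_abs ha ha2 h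
  rw [integral_const_mul, integral_one_lt_abs_rpow ha,
    show a / stableConst a * (2 / a) = 2 / stableConst a by field_simp] at hlim
  refine hlim.congr' ?_
  filter_upwards [eventually_gt_atTop 0] with R hR
  unfold rescaledIntegrand
  rw [integral_const_mul, integral_const_mul, Measure.integral_comp_mul_left
    (fun x ↦ stableGaussDerivScale a (exp (-(R ^ 2 / 2))) x *
      stableGaussDerivScale a (exp (-(R ^ 2 / 2))) x / stableGaussDensity a (exp (-(R ^ 2 / 2))) x),
    abs_of_pos (inv_pos.2 hR), smul_eq_mul, fisherIntegral, add_comm 1 a, rpow_add_one hR.ne']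
  field_simp

/-! ### The Fisher information of the model -/

theorem map_mul_withDensity_ofReal (f : ℝ → ℝ) {s : ℝ} (hs : 0 < s) :
    (volume.withDensity fun x ↦ ENNReal.ofReal (f x)).map (fun x ↦ s * x) =
      volume.withDensity fun x ↦ ENNReal.ofReal (s⁻¹ * f (x / s)) := by
  ext A hA
  have himg : (fun x : ℝ ↦ s * x) ⁻¹' A = (fun x ↦ s⁻¹ * x) '' A := by
    ext x
    constructor
    · intro hx
      exact ⟨s * x, hx, by field_simp⟩
    · rintro ⟨y, hy, rfl⟩
      simpa [mem_preimage, mul_inv_cancel_left₀ hs.ne'] using hy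
  have hd : ∀ x ∈ A, HasDerivWithinAt (fun x : ℝ ↦ s⁻¹ * x) s⁻¹ A x := fun x _ ↦ by
    simpa using ((hasDerivAt_id x).const_mul s⁻¹).hasDerivWithinAt
  rw [Measure.map_apply (measurable_const_mul s) hA,
    withDensity_apply _ (measurable_const_mul s hA), withDensity_apply _ hA, himg,
    lintegral_image_eq_lintegral_abs_deriv_mul hA hd
      (mul_right_injective₀ (inv_ne_zero hs.ne')).injOn]
  refine lintegral_congr fun x ↦ ?_
  rw [abs_of_pos (inv_pos.2 hs), ← ENNReal.ofReal_mul (inv_pos.2 hs).le, div_eq_inv_mul]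

/-- The coefficient `c` for which `x ↦ s⁻¹ * stableGaussDensity a c (x / s)` is the density at time
`h` of the process with triplet `(0, σ ^ 2, a r |z| ^ (-1 - a) dz)`, where `s = σ √h` is the
standard deviation of its Gaussian part. -/
noncomputable def stableGaussCoeff (σ h r a : ℝ) : ℝ := r * stableConst a * h * (σ * √h) ^ (-a)

theorem stableGaussCoeff_pos {σ h r a : ℝ} (hσ : 0 < σ) (hh : 0 < h) (hr : 0 < r) (ha : 0 < a)
    (ha2 : a < 2) : 0 < stableGaussCoeff σ h r a := by
  have := stableConst_pos ha ha2
  unfold stableGaussCoeff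
  positivity

theorem isContinuousDensity_levyMarginal {τ : ℝ → ℝ} (hτ : IsTruncation τ) {σ h r a : ℝ}
    (hσ : 0 < σ) (hh : 0 < h) (hr : 0 < r) (ha : 0 < a) (ha2 : a < 2) :
    IsContinuousDensity (levyMarginal τ 0 (σ ^ 2) (stableLevyMeasure a r r) h)
      (fun x ↦ (σ * √h)⁻¹ * stableGaussDensity a (stableGaussCoeff σ h r a) (x / (σ * √h))) := by
  have hc := stableGaussCoeff_pos hσ hh hr ha ha2
  obtain ⟨hpos, hprob, hchar⟩ := stableGaussDensity_spec ha ha2 hc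
  have hcont := continuous_stableGaussDensity (a := a) hc.le
  have hs : 0 < σ * √h := by positivity
  have hmap := map_mul_withDensity_ofReal (stableGaussDensity a (stableGaussCoeff σ h r a)) hs
  have hprob' := Measure.isProbabilityMeasure_map
    (μ := volume.withDensity fun x ↦
      ENNReal.ofReal (stableGaussDensity a (stableGaussCoeff σ h r a) x))
    (measurable_const_mul (σ * √h)).aemeasurable
  have hlevy : IsLevyMarginal τ 0 (σ ^ 2) (stableLevyMeasure a r r) h
      ((volume.withDensity fun x ↦
        ENNReal.ofReal (stableGaussDensity a (stableGaussCoeff σ h r a) x)).map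
          (fun x ↦ σ * √h * x)) := by
    refine ⟨hprob', fun u ↦ ?_⟩
    rw [charFun_map_mul, hchar, levyExponent_stable hτ ha ha2 hr, ← Complex.ofReal_mul,
      ← Complex.ofReal_exp]
    congr 2
    have h1 : (σ * √h) ^ (-a) * (σ * √h) ^ a = 1 := by
      rw [← rpow_add hs, neg_add_cancel, rpow_zero]
    rw [abs_mul, abs_of_pos hs, mul_rpow hs.le (abs_nonneg u), stableGaussCoeff,
      show r * stableConst a * h * (σ * √h) ^ (-a) * ((σ * √h) ^ a * |u| ^ a) =
        r * stableConst a * h * |u| ^ a * ((σ * √h) ^ (-a) * (σ * √h) ^ a) by ring, h1,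
      mul_pow, mul_pow, sq_sqrt hh.le]
    ring
  rw [levyMarginal_eq hlevy, hmap]
  refine ⟨hmap ▸ hprob', by fun_prop, fun x ↦ ?_, rfl⟩
  have := (hpos (x / (σ * √h))).le
  positivity

/-- The logarithmic derivative of `a ↦ stableGaussCoeff σ h r a`. -/
noncomputable def logDerivStableGaussCoeff (σ h a : ℝ) : ℝ :=
  deriv stableConst a / stableConst a - log (σ * √h)

theorem hasDerivAt_stableGaussCoeff {σ h r a : ℝ} (hσ : 0 < σ) (hh : 0 < h) (ha : 0 < a)
    (ha2 : a < 2) : HasDerivAt (fun t ↦ stableGaussCoeff σ h r t)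
      (stableGaussCoeff σ h r a * logDerivStableGaussCoeff σ h a) a := by
  have hs : 0 < σ * √h := by positivity
  have hκ := (stableConst_pos ha ha2).ne'
  have h1 := (differentiableAt_stableConst ha ha2).hasDerivAt
  have h2 := (hasDerivAt_id a).neg.const_rpow hs
  have h3 := ((h1.const_mul r).mul_const h).mul h2
  refine h3.congr_deriv ?_
  simp only [stableGaussCoeff, logDerivStableGaussCoeff, Pi.neg_apply, id]
  field_simp
  ring

/-- The partial derivatives of the density of the model in `(r, a)` are rescaled linear combinations
of the two partial derivatives of `stableGaussDensity`. These are the coefficients of the derivative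
in the scale; those of the derivative in the index are `![0, c]`. -/
noncomputable def scaleWeight (σ h r a : ℝ) : Fin 2 → ℝ :=
  ![stableGaussCoeff σ h r a / r, stableGaussCoeff σ h r a * logDerivStableGaussCoeff σ h a]

theorem hasDerivAt_model_density {σ h r a : ℝ} (hσ : 0 < σ) (hh : 0 < h) (hr : 0 < r)
    (ha : 0 < a) (ha2 : a < 2) (i : Fin 2) (x : ℝ) :
    HasDerivAt (fun t ↦ (σ * √h)⁻¹ * stableGaussDensity (Function.update ![r, a] i t 1)
        (stableGaussCoeff σ h (Function.update ![r, a] i t 0) (Function.update ![r, a] i t 1))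
        (x / (σ * √h)))
      ((σ * √h)⁻¹ *
        (scaleWeight σ h r a i * stableGaussDerivScale a (stableGaussCoeff σ h r a) (x / (σ * √h)) +
          ![0, stableGaussCoeff σ h r a] i *
            stableGaussDerivIndex a (stableGaussCoeff σ h r a) (x / (σ * √h))))
      (![r, a] i) := by
  have hc := stableGaussCoeff_pos hσ hh hr ha ha2
  have hF := hasFDerivAt_stableGaussDensity ha ha2 hc (x / (σ * √h))
  refine HasDerivAt.const_mul _ ?_
  fin_cases i
  · have h1 : HasDerivAt (fun t ↦ stableGaussCoeff σ h t a) (stableGaussCoeff σ h r a / r) r := by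
      have := (((hasDerivAt_id r).mul_const (stableConst a)).mul_const h).mul_const
        ((σ * √h) ^ (-a))
      refine this.congr_deriv ?_
      simp only [stableGaussCoeff]
      field_simp
    have h2 := hF.comp_hasDerivAt_of_eq r ((hasDerivAt_const r a).prodMk h1) rfl
    have h3 : HasDerivAt (fun t ↦ stableGaussDensity a (stableGaussCoeff σ h t a) (x / (σ * √h)))
        _ r := h2
    simp [scaleWeight]
    refine h3.congr_deriv ?_
    simp [mul_comm]
  · have h2 := hF.comp_hasDerivAt_of_eq a
      ((hasDerivAt_id a).prodMk (hasDerivAt_stableGaussCoeff (r := r) hσ hh ha ha2)) rfl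
    have h3 : HasDerivAt (fun t ↦ stableGaussDensity t (stableGaussCoeff σ h r t) (x / (σ * √h)))
        _ a := h2
    simp [scaleWeight]
    refine h3.congr_deriv ?_
    simp [mul_comm]

theorem integrable_comp_div_and_integral_eq {p f g : ℝ → ℝ} {s : ℝ} (hs : 0 < s)
    (hfg : Integrable fun x ↦ f x * g x / p x) :
    Integrable (fun x ↦ s⁻¹ * f (x / s) * (s⁻¹ * g (x / s)) / (s⁻¹ * p (x / s))) ∧
      ∫ x, s⁻¹ * f (x / s) * (s⁻¹ * g (x / s)) / (s⁻¹ * p (x / s)) = fisherIntegral p f g := by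
  have e : (fun x ↦ s⁻¹ * f (x / s) * (s⁻¹ * g (x / s)) / (s⁻¹ * p (x / s))) =
      fun x ↦ s⁻¹ * (f (x / s) * g (x / s) / p (x / s)) := by
    funext x
    rw [show s⁻¹ * f (x / s) * (s⁻¹ * g (x / s)) =
      s⁻¹ * (s⁻¹ * (f (x / s) * g (x / s))) by ring, mul_div_mul_left _ _ (inv_ne_zero hs.ne'),
      mul_div_assoc]
  rw [e]
  refine ⟨(hfg.comp_div hs.ne').const_mul _, ?_⟩
  rw [integral_const_mul, Measure.integral_comp_div (fun x ↦ f x * g x / p x), abs_of_pos hs,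
    smul_eq_mul, inv_mul_cancel_left₀ hs.ne', fisherIntegral]

theorem fisherIntegral_linear_combination {p f g : ℝ → ℝ} (hff : Integrable fun x ↦ f x * f x / p x)
    (hfg : Integrable fun x ↦ f x * g x / p x) (hgg : Integrable fun x ↦ g x * g x / p x)
    (v w v' w' : ℝ) :
    Integrable (fun x ↦ (v * f x + w * g x) * (v' * f x + w' * g x) / p x) ∧
    fisherIntegral p (fun x ↦ v * f x + w * g x) (fun x ↦ v' * f x + w' * g x) =
      v * v' * fisherIntegral p f f + (v * w' + v' * w) * fisherIntegral p f g +
        w * w' * fisherIntegral p g g := by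
  have e : (fun x ↦ (v * f x + w * g x) * (v' * f x + w' * g x) / p x) =
      fun x ↦ v * v' * (f x * f x / p x) + (v * w' + v' * w) * (f x * g x / p x) +
        w * w' * (g x * g x / p x) := by
    funext x
    ring
  have h1 := hff.const_mul (v * v')
  have h2 := hfg.const_mul (v * w' + v' * w)
  have h3 := hgg.const_mul (w * w')
  have h12 : Integrable fun x ↦ v * v' * (f x * f x / p x) + (v * w' + v' * w) *
    (f x * g x / p x) := h1.add h2
  refine ⟨e ▸ h12.add h3, ?_⟩
  unfold fisherIntegral
  rw [e, integral_add h12 h3, integral_add h1 h2, integral_const_mul, integral_const_mul,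
    integral_const_mul]

/-- The Fisher information matrix of the model at `(r, a)`. -/
noncomputable def stablePlusBrownianFisher (σ r a h : ℝ) : Matrix (Fin 2) (Fin 2) ℝ :=
  Matrix.of fun i j ↦
    scaleWeight σ h r a i * scaleWeight σ h r a j *
        fisherIntegral (stableGaussDensity a (stableGaussCoeff σ h r a))
          (stableGaussDerivScale a (stableGaussCoeff σ h r a))
          (stableGaussDerivScale a (stableGaussCoeff σ h r a)) +
      (scaleWeight σ h r a i * ![0, stableGaussCoeff σ h r a] j +
          scaleWeight σ h r a j * ![0, stableGaussCoeff σ h r a] i) *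
        fisherIntegral (stableGaussDensity a (stableGaussCoeff σ h r a))
          (stableGaussDerivScale a (stableGaussCoeff σ h r a))
          (stableGaussDerivIndex a (stableGaussCoeff σ h r a)) +
      ![0, stableGaussCoeff σ h r a] i * ![0, stableGaussCoeff σ h r a] j *
        fisherIntegral (stableGaussDensity a (stableGaussCoeff σ h r a))
          (stableGaussDerivIndex a (stableGaussCoeff σ h r a))
          (stableGaussDerivIndex a (stableGaussCoeff σ h r a))

theorem isFisherInformation_stablePlusBrownianModel {τ : ℝ → ℝ} (hτ : IsTruncation τ) {σ r a h : ℝ}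
    (hσ : 0 < σ) (hr : 0 < r) (ha : 0 < a) (ha2 : a < 2) (hh : 0 < h) :
    IsFisherInformation (stablePlusBrownianModel τ σ h) ![r, a]
      (stablePlusBrownianFisher σ r a h) := by
  have hc := stableGaussCoeff_pos hσ hh hr ha ha2
  have hs : 0 < σ * √h := by positivity
  have hI := fun {f g} ↦ integrable_mul_div_stableGaussDensity (f := f) (g := g) ha ha2 hc
  refine ⟨fun η x ↦ (σ * √h)⁻¹ *
      stableGaussDensity (η 1) (stableGaussCoeff σ h (η 0) (η 1)) (x / (σ * √h)), _, ?_,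
    hasDerivAt_model_density hσ hh hr ha ha2, fun i j ↦ ?_⟩
  · have h0 : ∀ᶠ η : Fin 2 → ℝ in 𝓝 ![r, a], 0 < η 0 :=
      (continuous_apply 0).continuousAt.eventually_const_lt (by simpa using hr)
    have h1 : ∀ᶠ η : Fin 2 → ℝ in 𝓝 ![r, a], 0 < η 1 :=
      (continuous_apply 1).continuousAt.eventually_const_lt (by simpa using ha)
    have h2 : ∀ᶠ η : Fin 2 → ℝ in 𝓝 ![r, a], η 1 < 2 :=
      (continuous_apply 1).continuousAt.eventually_lt_const (by simpa using ha2)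
    filter_upwards [h0, h1, h2] with η h0 h1 h2 using
      isContinuousDensity_levyMarginal hτ hσ hh h0 h1 h2
  · obtain ⟨h1, h2⟩ := fisherIntegral_linear_combination (hI (Or.inl rfl) (Or.inl rfl))
      (hI (Or.inl rfl) (Or.inr rfl)) (hI (Or.inr rfl) (Or.inr rfl))
      (scaleWeight σ h r a i) (![0, stableGaussCoeff σ h r a] i)
      (scaleWeight σ h r a j) (![0, stableGaussCoeff σ h r a] j)
    obtain ⟨h3, h4⟩ := integrable_comp_div_and_integral_eq hs h1
    exact ⟨h3, (h2.symm.trans h4.symm)⟩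

/-! ### Small-time asymptotics -/

theorem tendsto_log_one_div : Tendsto (fun h : ℝ ↦ log (1 / h)) (𝓝[>] 0) atTop := by
  simp only [one_div]
  exact tendsto_log_atTop.comp tendsto_inv_nhdsGT_zero

theorem stableGaussCoeff_eq_rpow {σ h r a : ℝ} (hσ : 0 < σ) (hh : 0 < h) :
    stableGaussCoeff σ h r a = r * stableConst a * σ ^ (-a) * (h / h ^ (a / 2)) := by
  rw [stableGaussCoeff, mul_rpow hσ.le (sqrt_nonneg h), rpow_neg (sqrt_nonneg h),
    rpow_div_two_eq_sqrt a hh.le]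
  ring

/-- The distance, in standard deviations of the Gaussian part, at which the Gaussian tail is of the
order of the coefficient of the stable part. -/
noncomputable def crossoverRadius (σ r a h : ℝ) : ℝ :=
  √((2 - a) * log (1 / h) - 2 * log (r * stableConst a * σ ^ (-a)))

section Asymptotics

variable {σ r a : ℝ}

theorem tendsto_mul_log_one_div_sub (ha2 : a < 2) (b : ℝ) :
    Tendsto (fun h : ℝ ↦ (2 - a) * log (1 / h) - b) (𝓝[>] 0) atTop :=
  tendsto_atTop_add_const_right _ _
    (tendsto_log_one_div.const_mul_atTop (show 0 < 2 - a by linarith))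

theorem exp_neg_crossoverRadius_sq (hσ : 0 < σ) (hr : 0 < r) (ha : 0 < a) (ha2 : a < 2) :
    ∀ᶠ h in 𝓝[>] 0, exp (-(crossoverRadius σ r a h ^ 2 / 2)) = stableGaussCoeff σ h r a := by
  have hκ := stableConst_pos ha ha2
  filter_upwards [self_mem_nhdsWithin, (tendsto_mul_log_one_div_sub ha2
    (2 * log (r * stableConst a * σ ^ (-a)))).eventually_ge_atTop 0] with h hh h0
  have hh : 0 < h := hh
  have hc := stableGaussCoeff_pos hσ hh hr ha ha2
  have hβ : 0 < r * stableConst a * σ ^ (-a) := by positivity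
  rw [crossoverRadius, sq_sqrt h0, ← exp_log hc, stableGaussCoeff_eq_rpow hσ hh,
    log_mul hβ.ne' (by positivity), log_div hh.ne' (by positivity), log_rpow hh, one_div, log_inv]
  ring_nf

theorem tendsto_crossoverRadius (ha2 : a < 2) :
    Tendsto (crossoverRadius σ r a) (𝓝[>] 0) atTop :=
  tendsto_sqrt_atTop.comp (tendsto_mul_log_one_div_sub ha2 _)

theorem tendsto_stableGaussCoeff (hσ : 0 < σ) (hr : 0 < r) (ha : 0 < a) (ha2 : a < 2) :
    Tendsto (fun h ↦ stableGaussCoeff σ h r a) (𝓝[>] 0) (𝓝 0) := by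
  have h1 : Tendsto (fun R : ℝ ↦ exp (-(R ^ 2 / 2))) atTop (𝓝 0) :=
    tendsto_exp_neg_atTop_nhds_zero.comp
      ((tendsto_pow_atTop (α := ℝ) two_ne_zero).atTop_div_const two_pos)
  exact (h1.comp (tendsto_crossoverRadius (σ := σ) (r := r) ha2)).congr'
    (exp_neg_crossoverRadius_sq hσ hr ha ha2)

theorem tendsto_log_rpow_div_crossoverRadius_rpow (ha2 : a < 2) :
    Tendsto (fun h ↦ log (1 / h) ^ (a / 2) / crossoverRadius σ r a h ^ a) (𝓝[>] 0)
      (𝓝 ((2 - a) ^ (-(a / 2)))) := by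
  set b := 2 * log (r * stableConst a * σ ^ (-a)) with hb
  have h2a : 0 < 2 - a := by linarith
  have h1 : Tendsto (fun h : ℝ ↦ (2 - a) - b * (log (1 / h))⁻¹) (𝓝[>] 0) (𝓝 (2 - a)) := by
    simpa using (tendsto_log_one_div.inv_tendsto_atTop.const_mul b).const_sub (2 - a)
  refine (h1.rpow_const (p := -(a / 2)) (Or.inl h2a.ne')).congr' ?_
  filter_upwards [(tendsto_mul_log_one_div_sub ha2 b).eventually_gt_atTop 0,
    tendsto_log_one_div.eventually_gt_atTop 0] with h h0 hL
  rw [crossoverRadius, ← hb, ← rpow_div_two_eq_sqrt a h0.le, ← div_rpow hL.le h0.le,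
    show 2 - a - b * (log (1 / h))⁻¹ = ((2 - a) * log (1 / h) - b) / log (1 / h) by
      rw [sub_div, mul_div_cancel_right₀ _ hL.ne', div_eq_mul_inv b],
    rpow_neg (div_pos h0 hL).le, ← inv_rpow (div_pos h0 hL).le, inv_div]

/-- The normalizing factor of the Fisher information, times the stable coefficient. -/
theorem rpow_div_mul_stableGaussCoeff (hσ : 0 < σ) :
    ∀ᶠ h : ℝ in 𝓝[>] 0, (h * log (1 / h)) ^ (a / 2) / h * stableGaussCoeff σ h r a =
      r * stableConst a * σ ^ (-a) * log (1 / h) ^ (a / 2) := by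
  filter_upwards [self_mem_nhdsWithin, tendsto_log_one_div.eventually_gt_atTop 0] with h hh hL
  have hh : 0 < h := hh
  rw [stableGaussCoeff_eq_rpow hσ hh, mul_rpow hh.le hL.le]
  have : 0 < h ^ (a / 2) := by positivity
  field_simp

theorem tendsto_rpow_div_mul_stableGaussCoeff_div_log (hσ : 0 < σ) (ha2 : a < 2) :
    Tendsto (fun h : ℝ ↦ (h * log (1 / h)) ^ (a / 2) / h * stableGaussCoeff σ h r a *
      (1 / log (1 / h))) (𝓝[>] 0) (𝓝 0) := by
  have h1 := ((tendsto_rpow_neg_atTop (show 0 < 1 - a / 2 by linarith)).comp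
    tendsto_log_one_div).const_mul (r * stableConst a * σ ^ (-a))
  rw [mul_zero] at h1
  refine h1.congr' ?_
  filter_upwards [rpow_div_mul_stableGaussCoeff (r := r) (a := a) hσ,
    tendsto_log_one_div.eventually_gt_atTop 0] with h e hL
  rw [e, Function.comp_apply, neg_sub, rpow_sub_one hL.ne']
  ring

/-- The normalized information on `r`, up to a factor `r ^ 2`. -/
theorem tendsto_rpow_div_mul_stableGaussCoeff_mul_fisherIntegral (hσ : 0 < σ) (hr : 0 < r)
    (ha : 0 < a) (ha2 : a < 2) :
    Tendsto (fun h : ℝ ↦ (h * log (1 / h)) ^ (a / 2) / h * stableGaussCoeff σ h r a *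
      (stableGaussCoeff σ h r a * fisherIntegral (stableGaussDensity a (stableGaussCoeff σ h r a))
        (stableGaussDerivScale a (stableGaussCoeff σ h r a))
        (stableGaussDerivScale a (stableGaussCoeff σ h r a)))) (𝓝[>] 0)
      (𝓝 (2 * r / (σ ^ a * (2 - a) ^ (a / 2)))) := by
  have hκ := stableConst_pos ha ha2
  have h1 := ((tendsto_log_rpow_div_crossoverRadius_rpow (σ := σ) (r := r) ha2).const_mul
    (r * stableConst a * σ ^ (-a))).mul
    ((tendsto_rpow_mul_fisherIntegral ha ha2).comp (tendsto_crossoverRadius (σ := σ) (r := r) ha2))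
  have e : r * stableConst a * σ ^ (-a) * (2 - a) ^ (-(a / 2)) * (2 / stableConst a) =
      2 * r / (σ ^ a * (2 - a) ^ (a / 2)) := by
    rw [rpow_neg hσ.le, rpow_neg (by linarith)]
    field_simp
  rw [e] at h1
  refine h1.congr' ?_
  filter_upwards [rpow_div_mul_stableGaussCoeff (r := r) (a := a) hσ,
    exp_neg_crossoverRadius_sq hσ hr ha ha2,
    (tendsto_crossoverRadius (σ := σ) (r := r) ha2).eventually_gt_atTop 0] with h e1 e2 hR
  rw [e1, Function.comp_apply, e2]
  have : 0 < crossoverRadius σ r a h ^ a := by positivity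
  field_simp

theorem tendsto_logDerivStableGaussCoeff_div_log (hσ : 0 < σ) :
    Tendsto (fun h ↦ 1 / log (1 / h) * logDerivStableGaussCoeff σ h a) (𝓝[>] 0) (𝓝 (1 / 2)) := by
  have h1 : Tendsto (fun h : ℝ ↦
      (deriv stableConst a / stableConst a - log σ) * (log (1 / h))⁻¹ + 1 / 2) (𝓝[>] 0)
      (𝓝 (1 / 2)) := by
    have := (tendsto_log_one_div.inv_tendsto_atTop.const_mul
      (deriv stableConst a / stableConst a - log σ)).add_const (1 / 2)
    rwa [mul_zero, zero_add] at this
  refine h1.congr' ?_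
  filter_upwards [self_mem_nhdsWithin, tendsto_log_one_div.eventually_gt_atTop 0] with h hh hL
  have hh : 0 < h := hh
  have e : log h = -log (1 / h) := by rw [one_div, log_inv, neg_neg]
  rw [logDerivStableGaussCoeff, log_mul hσ.ne' (by positivity), log_sqrt hh.le, e]
  field_simp
  ring

theorem tendsto_stablePlusBrownianFisher (hσ : 0 < σ) (hr : 0 < r) (ha : 0 < a) (ha2 : a < 2) :
    Tendsto (fun h : ℝ ↦ ((h * log (1 / h)) ^ (a / 2) / h) •
        (Matrix.diagonal ![1, 1 / log (1 / h)] * stablePlusBrownianFisher σ r a h *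
          Matrix.diagonal ![1, 1 / log (1 / h)])) (𝓝[>] 0)
      (𝓝 ((2 * r / (σ ^ a * (2 - a) ^ (a / 2))) •
        !![1 / r ^ 2, 1 / (2 * r); 1 / (2 * r), 1 / 4])) := by
  obtain ⟨c₀, N, hc₀, hN⟩ := exists_fisherIntegral_le ha ha2
  set W : ℝ → ℝ := fun h ↦ (h * log (1 / h)) ^ (a / 2) / h with hW
  set c : ℝ → ℝ := fun h ↦ stableGaussCoeff σ h r a with hc
  set K₀ : ℝ → ℝ := fun h ↦ c h * fisherIntegral (stableGaussDensity a (c h))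
    (stableGaussDerivScale a (c h)) (stableGaussDerivScale a (c h)) with hK₀
  set K₁ : ℝ → ℝ := fun h ↦ c h * fisherIntegral (stableGaussDensity a (c h))
    (stableGaussDerivScale a (c h)) (stableGaussDerivIndex a (c h)) with hK₁
  set K₂ : ℝ → ℝ := fun h ↦ c h * fisherIntegral (stableGaussDensity a (c h))
    (stableGaussDerivIndex a (c h)) (stableGaussDerivIndex a (c h)) with hK₂
  have hcpos : ∀ᶠ h in 𝓝[>] 0, 0 < c h := by
    filter_upwards [self_mem_nhdsWithin] with h hh using stableGaussCoeff_pos hσ hh hr ha ha2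
  have hmem : ∀ᶠ h in 𝓝[>] 0, c h ∈ Ioc 0 c₀ := by
    filter_upwards [hcpos, (tendsto_stableGaussCoeff hσ hr ha ha2).eventually_le_const hc₀]
      with h h1 h2 using ⟨h1, h2⟩
  have hK₁b : IsBoundedUnder (· ≤ ·) (𝓝[>] 0) (norm ∘ K₁) :=
    isBoundedUnder_of_eventually_le (a := N) (hmem.mono fun h hh ↦ (hN _ hh).1)
  have hK₂b : IsBoundedUnder (· ≤ ·) (𝓝[>] 0) (norm ∘ K₂) :=
    isBoundedUnder_of_eventually_le (a := N) (hmem.mono fun h hh ↦ (hN _ hh).2)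
  -- The normalized coefficients of the two derivatives of the density, divided by `c h`.
  set u : ℝ → Fin 2 → ℝ := fun h ↦
    ![1 / r, 1 / log (1 / h) * logDerivStableGaussCoeff σ h a] with hu
  set v : ℝ → Fin 2 → ℝ := fun h ↦ ![0, 1 / log (1 / h)] with hv
  have hulim : ∀ i, Tendsto (fun h ↦ u h i) (𝓝[>] 0) (𝓝 (![1 / r, 1 / 2] i)) := by
    intro i
    fin_cases i
    · exact tendsto_const_nhds
    · exact tendsto_logDerivStableGaussCoeff_div_log hσ
  have hL : Tendsto (fun h : ℝ ↦ 1 / log (1 / h)) (𝓝[>] 0) (𝓝 0) := by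
    simp only [one_div (log _)]
    exact tendsto_log_one_div.inv_tendsto_atTop
  have hvlim : ∀ i, Tendsto (fun h ↦ v h i) (𝓝[>] 0) (𝓝 0) := by
    intro i
    fin_cases i
    · exact tendsto_const_nhds
    · exact hL
  have hWv : ∀ i, Tendsto (fun h ↦ W h * c h * v h i) (𝓝[>] 0) (𝓝 0) := by
    intro i
    fin_cases i
    · simp [hv]
    · exact tendsto_rpow_div_mul_stableGaussCoeff_div_log hσ ha2
  have hmain := tendsto_rpow_div_mul_stableGaussCoeff_mul_fisherIntegral hσ hr ha ha2
  have hentry : ∀ i j, Tendsto (fun h ↦ u h i * u h j * (W h * c h * K₀ h) +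
      ((u h i * (W h * c h * v h j) + u h j * (W h * c h * v h i)) * K₁ h +
        v h i * (W h * c h * v h j) * K₂ h)) (𝓝[>] 0)
      (𝓝 (![1 / r, 1 / 2] i * ![1 / r, 1 / 2] j * (2 * r / (σ ^ a * (2 - a) ^ (a / 2))))) := by
    intro i j
    have h1 := ((hulim i).mul (hulim j)).mul hmain
    have h2 : Tendsto (fun h ↦ u h i * (W h * c h * v h j) + u h j * (W h * c h * v h i))
        (𝓝[>] 0) (𝓝 0) := by
      simpa using ((hulim i).mul (hWv j)).add ((hulim j).mul (hWv i))
    have h3 : Tendsto (fun h ↦ v h i * (W h * c h * v h j)) (𝓝[>] 0) (𝓝 0) := by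
      simpa using (hvlim i).mul (hWv j)
    have h4 := h1.add ((h2.zero_mul_isBoundedUnder_le hK₁b).add
      (h3.zero_mul_isBoundedUnder_le hK₂b))
    rwa [add_zero, add_zero] at h4
  refine tendsto_pi_nhds.2 fun i ↦ tendsto_pi_nhds.2 fun j ↦ ?_
  have hlim : ((2 * r / (σ ^ a * (2 - a) ^ (a / 2))) •
      !![1 / r ^ 2, 1 / (2 * r); 1 / (2 * r), 1 / 4]) i j =
      ![1 / r, 1 / 2] i * ![1 / r, 1 / 2] j * (2 * r / (σ ^ a * (2 - a) ^ (a / 2))) := by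
    fin_cases i <;> fin_cases j <;> simp <;> ring
  rw [hlim]
  refine (hentry i j).congr fun h ↦ ?_
  rw [Matrix.smul_apply, Matrix.mul_diagonal, Matrix.diagonal_mul, smul_eq_mul]
  have hd : ∀ i, ![1, 1 / log (1 / h)] i * scaleWeight σ h r a i = c h * u h i := by
    intro i
    fin_cases i
    · simp [scaleWeight, hu, hc, div_eq_mul_inv]
    · simp [scaleWeight, hu, hc]
      ring
  have hd' : ∀ i, ![1, 1 / log (1 / h)] i * ![0, c h] i = c h * v h i := by
    intro i
    fin_cases i
    · simp [hv]
    · simp [hv, mul_comm]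
  have e : ∀ di dj si sj ti tj A B C : ℝ,
      W h * (di * (si * sj * A + (si * tj + sj * ti) * B + ti * tj * C) * dj) =
        W h * (di * si * (dj * sj) * A + (di * si * (dj * tj) + dj * sj * (di * ti)) * B +
          di * ti * (dj * tj) * C) := fun _ _ _ _ _ _ _ _ _ ↦ by ring
  rw [stablePlusBrownianFisher, Matrix.of_apply, e, hd i, hd j, hd' i, hd' j]
  simp only [hK₀, hK₁, hK₂, hc]
  ring

end Asymptotics

end

theorem proposition2 (τ : ℝ → ℝ) (hτ : IsTruncation τ) (σ r α : ℝ)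
    (hσ : 0 < σ) (hr : 0 < r) (hα : 0 < α) (hα2 : α < 2) :
    (∃ J : ℝ → Matrix (Fin 2) (Fin 2) ℝ,
      (∀ h, 0 < h → IsFisherInformation (stablePlusBrownianModel τ σ h) ![r, α] (J h)) ∧
      Tendsto
        (fun h : ℝ => ((h * Real.log (1 / h)) ^ (α / 2) / h) •
          (Matrix.diagonal ![1, 1 / Real.log (1 / h)] * J h *
            Matrix.diagonal ![1, 1 / Real.log (1 / h)]))
        (𝓝[>] 0)
        (𝓝 ((2 * r / (σ ^ α * (2 - α) ^ (α / 2))) •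
          !![1 / r ^ 2, 1 / (2 * r); 1 / (2 * r), 1 / 4]))) ∧
    ((2 * r / (σ ^ α * (2 - α) ^ (α / 2))) •
      !![1 / r ^ 2, 1 / (2 * r); 1 / (2 * r), 1 / 4]).det = 0 := by
  refine ⟨⟨stablePlusBrownianFisher σ r α, fun h hh ↦
    isFisherInformation_stablePlusBrownianModel hτ hσ hr hα hα2 hh,
    tendsto_stablePlusBrownianFisher hσ hr hα hα2⟩, ?_⟩
  rw [Matrix.det_smul, Matrix.det_fin_two_of]
  field_simp
  ring
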